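/- Let $G$ be a split connected reductive group over $\mathbf Z$ with split maximal torus $T$ and derived subgroup $G^{der}$; let $\mathfrak g$, $\mathfrak g^{der}$, $\mathfrak t$ be the Lie algebras (over $\mathbf Z$) of $G$, $G^{der}$, $T$, let $\Phi=\Phi(G,T)$ be the root system, $\Delta\subset\Phi$ a set of simple roots, and for $\alpha=\sum_{\beta\in\Delta}n_\beta\beta\in\Phi$ put $\mathrm{ht}(\alpha)=\sum_\beta n_\beta$. Fix a Chevalley basis: elements $X_\alpha\in\mathfrak g^{der}$ and $H_\alpha\in\mathfrak t\cap\mathfrak g^{der}$ ($\alpha\in\Phi$) such that $X_\alpha$ generates the root space $\mathfrak g_\alpha$ over $\mathbf Z$; the $H_\beta$ ($\beta\in\Delta$) together with the $X_\alpha$ ($\alpha\in\Phi$) form a basis of $\mathfrak g^{der}\otimes\mathbf Q$; every $H_\alpha$ is an integral combination of the $H_\beta$, $\beta\in\Delta$; and $[H_\alpha,H_\beta]=0$, $[H_\beta,X_\alpha]=\alpha(H_\beta)X_\alpha$ with $\alpha(H_\beta)\in\mathbf Z$, $\alpha(H_\alpha)=2$, $[X_\alpha,X_{-\alpha}]=H_\alpha$,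 $[X_\alpha,X_\beta]=N_{\alpha,\beta}X_{\alpha+\beta}$ with $0\neq N_{\alpha,\beta}\in\mathbf Z$ if $\alpha+\beta\in\Phi$, and $[X_\alpha,X_\beta]=0$ if $0\ne\alpha+\beta\notin\Phi$. Put $n_{\alpha,\beta}=|N_{\alpha,\beta}|$ if $\alpha+\beta\in\Phi$ and $n_{\alpha,\beta}=0$ otherwise. Let $p$ be a prime, let $\Gamma_{\mathbf Q,\{p\}}$ be the Galois group over $\mathbf Q$ of the maximal extension of $\mathbf Q$ unramified at all primes $\ell\neq p$, let $\bar\rho\colon\Gamma_{\mathbf Q,\{p\}}\to G(\mathbf F_p)$ be a continuous representation, and let $\rho\colon\Gamma_{\mathbf Q,\{p\}}\to G(\mathbf Z_p)$ be a continuous representation lifting $\bar\rho$. For $m\ge1$ let $\rho_m$ be the reduction of $\rho$ modulo $p^m$, and set $\Phi_m(\rho)=\rho_{m+1}(\ker\rho_m)\subset\ker\bigl(G(\mathbf Z/p^{m+1})\to G(\mathbf Z/p^m)\bigr)$. Via the isomorphism $v\mapsto\exp(p^mv)$ from $\mathfrak g\otimes\mathbf F_p$ onto this kernel, regard $\Phi_m(\rho)$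 as a subset of $\mathfrak g\otimes\mathbf F_p$; write $\bar\rho(\mathfrak g^{der})$ for $\mathfrak g^{der}\otimes\mathbf F_p$, viewed inside $\mathfrak g\otimes\mathbf F_p$ (with the adjoint action through $\bar\rho$). Assume that $p>n_{\alpha,\beta}$ for all $\alpha,\beta\in\Phi$, that $\Phi_1(\rho)$ contains an element $H\in\mathfrak t\otimes\mathbf F_p$ with $\alpha(H)\neq0$ in $\mathbf F_p$ for all $\alpha\in\Phi$, and that $\Phi_1(\rho)$ contains (the reduction of) $X_\alpha$ for every $\alpha\in\Phi$ with $\mathrm{ht}(\alpha)$ odd. Then: 1. $\Phi_4(\rho)$ contains $\bar\rho(\mathfrak g^{der})$; 2. the image of $\rho$ contains $\mathcal U_4=\ker\bigl(G^{der}(\mathbf Z_p)\to G^{der}(\mathbf Z/p^4)\bigr)$. -/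

import Mathlib

open scoped TensorProduct
open WithConv

noncomputable section

/-! ## Affine group schemes, their points and their Lie algebras

An affine group scheme `G` over a commutative ring `O` is given by its coordinate ring, a
commutative Hopf algebra `A` over `O`. -/

namespace GroupScheme

section Points

variable (O A : Type*) [CommRing O] [CommRing A] [HopfAlgebra O A]

/-- The group `G(S)` of points of `G = Spec A` in an `O`-algebra `S` (the group law is
convolution of algebra homomorphisms). -/
abbrev Pts (S : Type*) [CommRing S] [Algebra O S] : Type _ := WithConv (A →ₐ[O] S)

instance (S : Type*) [CommRing S] [Algebra O S] : Group (Pts O A S) :=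
  { (inferInstance : Monoid (Pts O A S)) with
    inv := fun x => toConv (x.ofConv.comp (HopfAlgebra.antipodeAlgHom O A))
    inv_mul_cancel := fun x => by
      have h := AlgHom.comp_convMul_distrib x.ofConv
        (toConv (HopfAlgebra.antipodeAlgHom O A)) (toConv (AlgHom.id O A))
      rw [AlgHom.antipode_id_cancel] at h
      apply WithConv.ofConv_injective
      refine h.symm.trans ?_
      ext a
      simp [AlgHom.convOne_def] }

variable {O} in
/-- The homomorphism `G(S) → G(S')` induced by a homomorphism of `O`-algebras `S → S'`. -/
def mapPts {S S' : Type*} [CommRing S] [Algebra O S] [CommRing S'] [Algebra O S']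
    (f : S →ₐ[O] S') : Pts O A S →* Pts O A S' :=
  MonoidHom.mk' (fun x : Pts O A S => (toConv (f.comp x.ofConv) : Pts O A S')) fun x y => by
    apply WithConv.ofConv_injective
    exact AlgHom.comp_convMul_distrib f x y

/-- The algebra of linear forms on `A`, with the convolution product. -/
abbrev Dist : Type _ := WithConv (A →ₗ[O] O)

/-- The commutator bracket on `Dist O A`. -/
instance : LieRing (Dist O A) := LieRing.ofAssociativeRing

variable {O A} in
lemma conv_apply_mul {v w : Dist O A}
    (hv : ∀ a b, v (a * b) = Coalgebra.counit (R := O) a * v b + v a * Coalgebra.counit (R := O) b)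
    (hw : ∀ a b, w (a * b) = Coalgebra.counit (R := O) a * w b + w a * Coalgebra.counit (R := O) b)
    (a b : A) :
    (v * w) (a * b) = Coalgebra.counit (R := O) a * (v * w) b + w a * v b + v a * w b
      + (v * w) a * Coalgebra.counit (R := O) b := by
  have key : ∀ s t : A ⊗[O] A,
      LinearMap.mul' O O (TensorProduct.map v.ofConv w.ofConv (s * t))
      = LinearMap.mul' O O (TensorProduct.map Coalgebra.counit Coalgebra.counit s)
          * LinearMap.mul' O O (TensorProduct.map v.ofConv w.ofConv t)
        + LinearMap.mul' O O (TensorProduct.map Coalgebra.counit w.ofConv s)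
          * LinearMap.mul' O O (TensorProduct.map v.ofConv Coalgebra.counit t)
        + LinearMap.mul' O O (TensorProduct.map v.ofConv Coalgebra.counit s)
          * LinearMap.mul' O O (TensorProduct.map Coalgebra.counit w.ofConv t)
        + LinearMap.mul' O O (TensorProduct.map v.ofConv w.ofConv s)
          * LinearMap.mul' O O (TensorProduct.map Coalgebra.counit Coalgebra.counit t) := by
    intro s t
    induction s using TensorProduct.induction_on with
    | zero => simp
    | add x y hx hy => simp only [add_mul, map_add, hx, hy]; ring
    | tmul a₁ a₂ =>
      induction t using TensorProduct.induction_on with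
      | zero => simp
      | add x y hx hy => simp only [mul_add, map_add, hx, hy]; ring
      | tmul b₁ b₂ =>
        simp only [Algebra.TensorProduct.tmul_mul_tmul, TensorProduct.map_tmul,
          LinearMap.mul'_apply, hv, hw]
        ring
  have e1 : ∀ c : A, LinearMap.mul' O O (TensorProduct.map Coalgebra.counit w.ofConv
      (Coalgebra.comul (R := O) c)) = w c := fun c =>
    congrArg (fun f : Dist O A => f c) (one_mul w)
  have e2 : ∀ c : A, LinearMap.mul' O O (TensorProduct.map v.ofConv Coalgebra.counit
      (Coalgebra.comul (R := O) c)) = v c := fun c =>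
    congrArg (fun f : Dist O A => f c) (mul_one v)
  have e3 : ∀ c : A, LinearMap.mul' O O (TensorProduct.map Coalgebra.counit Coalgebra.counit
      (Coalgebra.comul (R := O) c)) = Coalgebra.counit (R := O) c := fun c =>
    congrArg (fun f : Dist O A => f c) (one_mul (1 : Dist O A))
  have h := key (Coalgebra.comul (R := O) a) (Coalgebra.comul (R := O) b)
  rw [← Bialgebra.comul_mul, e1, e2, e1, e2, e3, e3] at h
  exact h

/-- The Lie algebra `𝔤` of `G`: the derivations `A → O` at the identity, i.e. the tangent
space at the identity section; the bracket is the commutator for convolution. -/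
def lie : LieSubalgebra O (Dist O A) where
  carrier := {v | ∀ a b, v (a * b) =
    Coalgebra.counit (R := O) a * v b + v a * Coalgebra.counit (R := O) b}
  add_mem' {v w} hv hw a b := by
    have h1 := hv a b
    have h2 := hw a b
    change v (a * b) + w (a * b) = _ * (v b + w b) + (v a + w a) * _
    rw [h1, h2]; ring
  zero_mem' a b := by
    change (0 : O) = _ * 0 + 0 * _
    simp
  smul_mem' c v hv a b := by
    have h1 := hv a b
    change c * v (a * b) = _ * (c * v b) + (c * v a) * _
    rw [h1]; ring
  lie_mem' {v w} hv hw a b := by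
    have h1 := conv_apply_mul hv hw a b
    have h2 := conv_apply_mul hw hv a b
    change (v * w) (a * b) - (w * v) (a * b) =
      _ * ((v * w) b - (w * v) b) + ((v * w) a - (w * v) a) * _
    rw [h1, h2]; ring

variable {O A} in
/-- The point `1 + t v : a ↦ ε(a) + t v(a)` of `G(S)`, for `v ∈ 𝔤` and `t ∈ S` with `t² = 0`. -/
def infinitesimal {S : Type*} [CommRing S] [Algebra O S] (t : S) (ht : t * t = 0)
    (v : lie O A) : Pts O A S :=
  toConv <| AlgHom.ofLinearMap
    (Algebra.linearMap O S ∘ₗ Coalgebra.counit + t • (Algebra.linearMap O S ∘ₗ v.1.ofConv))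
    (by
      have h := v.2 1 1
      have h0 : v.1 1 = 0 := by simpa using h
      simp [h0])
    (fun a b => by
      have h := v.2 a b
      simp only [LinearMap.add_apply, LinearMap.smul_apply, LinearMap.comp_apply,
        Algebra.linearMap_apply, smul_eq_mul, h, Bialgebra.counit_mul, map_mul, map_add]
      linear_combination (-(algebraMap O S (v.1 a)) * algebraMap O S (v.1 b)) * ht)

/-- The universal commutator `x y x⁻¹ y⁻¹`, as a point of `G` in the coordinate ring of
`G × G`; i.e. the commutator morphism `G × G → G`. -/
def univCommutator : Pts O A (A ⊗[O] A) :=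
  let x : Pts O A (A ⊗[O] A) := toConv Algebra.TensorProduct.includeLeft
  let y : Pts O A (A ⊗[O] A) := toConv Algebra.TensorProduct.includeRight
  x * y * x⁻¹ * y⁻¹

/-- The ideal of the derived subgroup `G^der`: closed subgroup schemes of `G` are the zero loci
of Hopf ideals, and `G^der` is the smallest closed subgroup scheme through which the commutator
morphism `G × G → G` factors. -/
def derIdeal : Ideal A :=
  sSup {I : Ideal A | I.IsHopfIdeal O ∧ ∀ f ∈ I, (univCommutator O A).ofConv f = 0}

/-- The Lie algebra `𝔤^der` of `G^der`, inside `𝔤`. -/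
def lieDer : Submodule O (lie O A) where
  carrier := {v | ∀ a ∈ derIdeal O A, v.1 a = 0}
  add_mem' {v w} hv hw a ha := by
    change v.1 a + w.1 a = 0
    rw [hv a ha, hw a ha, add_zero]
  zero_mem' a _ := rfl
  smul_mem' c v hv a ha := by
    change c * v.1 a = 0
    rw [hv a ha, mul_zero]

end Points

/-! ## Reductive groups over a field -/

section Field

variable {k B : Type*} [Field k] [CommRing B] [HopfAlgebra k B]

/-- Right translation of functions on `G` by `g ∈ G(k)`: `f ↦ (x ↦ f (x g))`. -/
def rightTranslation (g : B →ₐ[k] k) : Module.End k B :=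
  (toConv LinearMap.id * toConv (Algebra.linearMap k B ∘ₗ g.toLinearMap) :
    WithConv (B →ₗ[k] B)).ofConv

/-- `g ∈ G(k)` is unipotent: right translation by `g` on the coordinate ring is locally
unipotent. -/
def IsUnipotentPoint (g : B →ₐ[k] k) : Prop :=
  ∀ f : B, ∃ n : ℕ, ((rightTranslation g - 1) ^ n) f = 0

/-- The universal conjugate `x n x⁻¹`, where `x` is the universal point of `G` and `n` the
universal point of the closed subscheme cut out by `I`. -/
def univConj (I : Ideal B) : Pts k B (B ⊗[k] (B ⧸ I)) :=
  let x : Pts k B (B ⊗[k] (B ⧸ I)) := toConv Algebra.TensorProduct.includeLeft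
  let n : Pts k B (B ⊗[k] (B ⧸ I)) :=
    toConv (Algebra.TensorProduct.includeRight.comp (Ideal.Quotient.mkₐ k I))
  x * n * x⁻¹

variable (k B) in
/-- For `k` algebraically closed: `Spec B` is a connected reductive group, i.e. it is smooth and
connected and every smooth connected unipotent normal closed subgroup is trivial. -/
structure IsConnectedReductive : Prop where
  smooth : Algebra.Smooth k B
  connected : ConnectedSpace (PrimeSpectrum B)
  radical : ∀ I : Ideal B, I.IsHopfIdeal k →
    Algebra.Smooth k (B ⧸ I) → ConnectedSpace (PrimeSpectrum (B ⧸ I)) →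
    (∀ f ∈ I, (univConj (k := k) I).ofConv f = 0) →
    (∀ g : B →ₐ[k] k, (∀ f ∈ I, g f = 0) → IsUnipotentPoint g) →
    I = RingHom.ker (Bialgebra.counitAlgHom k B)

end Field

/-! ## Split reductive groups and their roots -/

section Split

variable {O A M : Type*} [CommRing O] [CommRing A] [HopfAlgebra O A] [AddCommGroup M]

/-- `G = Spec A` together with `T = Spec O[M]` (the split torus with character group `M`) and
the homomorphism `T → G` given by `π` is a split connected reductive group with split maximal
torus `T`: `G` is smooth with connected reductive geometric fibres, `T → G` is a closed
immersion, and on every geometric fibre `T` is a maximal torus. -/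
structure IsSplitReductive (π : A →ₐc[O] AddMonoidAlgebra O M) : Prop where
  smooth : Algebra.Smooth O A
  fibres : ∀ (k : Type) [Field k] [IsAlgClosed k] [Algebra O k],
    IsConnectedReductive k (k ⊗[O] A)
  closed : Function.Surjective π
  maximal : ∀ (k : Type) [Field k] [IsAlgClosed k] [Algebra O k] (M' : Type) [AddCommGroup M']
    [Module.Free ℤ M'] [Module.Finite ℤ M'] (π' : k ⊗[O] A →ₐc[k] AddMonoidAlgebra k M'),
    Function.Surjective π' →
    RingHom.ker π' ≤
      (RingHom.ker π).map (Algebra.TensorProduct.includeRight : A →ₐ[O] k ⊗[O] A) →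
    RingHom.ker π' =
      (RingHom.ker π).map (Algebra.TensorProduct.includeRight : A →ₐ[O] k ⊗[O] A)

/-- The linear form on `O[M]` sending the character `m` to `φ m`. -/
def torusForm (φ : M →+ O) : AddMonoidAlgebra O M →ₗ[O] O :=
  Finsupp.lsum O (fun m => LinearMap.toSpanSingleton O O (φ m)) ∘ₗ
    (AddMonoidAlgebra.coeffLinearEquiv O).toLinearMap

lemma torusForm_single (φ : M →+ O) (m : M) (c : O) :
    torusForm φ (AddMonoidAlgebra.single m c) = c * φ m := by
  simp [torusForm]

lemma torusForm_mul (φ : M →+ O) (f g : AddMonoidAlgebra O M) :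
    torusForm φ (f * g) = Coalgebra.counit (R := O) f * torusForm φ g
      + torusForm φ f * Coalgebra.counit (R := O) g := by
  induction f using AddMonoidAlgebra.induction_linear with
  | zero => simp
  | add x y hx hy => simp only [add_mul, map_add, hx, hy]; ring
  | single m c =>
    induction g using AddMonoidAlgebra.induction_linear with
    | zero => simp
    | add x y hx hy => simp only [mul_add, map_add, hx, hy]; ring
    | single n d =>
      simp only [AddMonoidAlgebra.single_mul_single, torusForm_single,
        AddMonoidAlgebra.counit_single, map_add, CommSemiring.counit_apply]
      ring

/-- The Lie algebra of `T` is `Hom(M, O)`: this is the element `H` of `𝔱 ⊆ 𝔤` on which the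
differential of each character `m ∈ M` of `T` takes the value `m(H) = φ m`. -/
def toral (π : A →ₐc[O] AddMonoidAlgebra O M) (φ : M →+ O) : lie O A :=
  ⟨toConv (torusForm φ ∘ₗ (π : A →ₗ[O] AddMonoidAlgebra O M)), fun a b => by
    change torusForm φ (π (a * b)) = _ * torusForm φ (π b) + torusForm φ (π a) * _
    rw [map_mul, torusForm_mul]
    simp⟩

/-- The adjoint action of the universal point `τ` of `T` on a linear form `v`:
`Ad(τ) v = τ v τ⁻¹`, a linear form on `A` with values in `O[M]`. -/
def adTorus (π : A →ₐc[O] AddMonoidAlgebra O M) (v : Dist O A) :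
    WithConv (A →ₗ[O] AddMonoidAlgebra O M) :=
  toConv (π : A →ₗ[O] AddMonoidAlgebra O M)
    * toConv (Algebra.linearMap O (AddMonoidAlgebra O M) ∘ₗ v.ofConv)
    * toConv ((π : A →ₗ[O] AddMonoidAlgebra O M) ∘ₗ HopfAlgebra.antipode O)

/-- The weight space `𝔤_α = {v ∈ 𝔤 | Ad(t) v = α(t) v for t in T}`. -/
def weightSpace (π : A →ₐc[O] AddMonoidAlgebra O M) (α : M) : Submodule O (lie O A) where
  carrier := {v | ∀ a, adTorus π v.1 a = AddMonoidAlgebra.single α (v.1 a)}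
  add_mem' {v w} hv hw a := by
    have h : adTorus π (v + w).1 = adTorus π v.1 + adTorus π w.1 := by
      unfold adTorus
      rw [← add_mul, ← mul_add, ← WithConv.toConv_add, ← LinearMap.comp_add]
      rfl
    rw [h]
    change adTorus π v.1 a + adTorus π w.1 a = AddMonoidAlgebra.single α (v.1 a + w.1 a)
    rw [hv a, hw a, AddMonoidAlgebra.single_add]
  zero_mem' a := by
    have h : adTorus π (0 : lie O A).1 = 0 := by
      simp [adTorus]
    rw [h]
    change (0 : AddMonoidAlgebra O M) = AddMonoidAlgebra.single α 0
    simp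
  smul_mem' c v hv a := by
    have h : adTorus π (c • v).1 = c • adTorus π v.1 := by
      unfold adTorus
      rw [← smul_mul_assoc, ← mul_smul_comm, ← WithConv.toConv_smul, ← LinearMap.comp_smul]
      rfl
    rw [h]
    change c • adTorus π v.1 a = AddMonoidAlgebra.single α (c * v.1 a)
    rw [hv a, AddMonoidAlgebra.smul_single, smul_eq_mul]

/-- The set of roots `Φ = Φ(G, T)`: the nonzero weights of `T` on `𝔤`. -/
def roots (π : A →ₐc[O] AddMonoidAlgebra O M) : Set M :=
  {α | α ≠ 0 ∧ weightSpace π α ≠ ⊥}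

/-- `Δ` is a set of simple roots of `Φ`: it is linearly independent, and each root is
an integral combination of elements of `Δ` with coefficients all `≥ 0` or all `≤ 0`. -/
structure IsSimpleSystem (Φ Δ : Set M) : Prop where
  subset : Δ ⊆ Φ
  linearIndependent : LinearIndependent ℤ (Subtype.val : Δ → M)
  pos_or_neg : ∀ α ∈ Φ, ∃ c : Δ →₀ ℤ, Finsupp.linearCombination ℤ Subtype.val c = α ∧
    ((∀ β, 0 ≤ c β) ∨ ∀ β, c β ≤ 0)

/-- The height of `α = ∑_{β ∈ Δ} n_β β`, namely `∑_{β ∈ Δ} n_β` (the coefficients are unique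
if `Δ` is linearly independent). -/
def height (Δ : Set M) (α : M) : ℤ :=
  (Classical.epsilon fun c : Δ →₀ ℤ =>
    Finsupp.linearCombination ℤ Subtype.val c = α).sum fun _ n => n

/-- A Chevalley basis of `𝔤` with respect to `T` and `Δ`: root vectors `X α`, each
generating the root space `𝔤_α`, toral elements `H α = toral π (h α)` (so that
`α(H β) = h β α`) and structure constants `N α β`. The elements `H α` for `α ∈ Δ` and `X α` for
`α ∈ Φ` are linearly independent and they span `𝔤^der` rationally (even integrally, when
`G^der` is simply connected). -/
structure ChevalleyBasis (π : A →ₐc[O] AddMonoidAlgebra O M) (Δ : Set M) where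
  X : roots π → lie O A
  h : roots π → M →+ O
  N : roots π → roots π → ℤ
  span_X : ∀ α, Submodule.span O {X α} = weightSpace π α
  X_mem : ∀ α, X α ∈ lieDer O A
  H_mem : ∀ α, toral π (h α) ∈ lieDer O A
  h_self : ∀ α, h α α = 2
  h_int : ∀ α β : roots π, ∃ n : ℤ, h β α = n
  lie_H_H : ∀ α β, ⁅toral π (h α), toral π (h β)⁆ = 0
  lie_H_X : ∀ α β, ⁅toral π (h β), X α⁆ = h β α • X α
  lie_X_neg : ∀ α β : roots π, (β : M) = -α → ⁅X α, X β⁆ = toral π (h α)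
  H_span : ∀ α, toral π (h α) ∈
    Submodule.span ℤ ((fun β => toral π (h β)) '' {β | (β : M) ∈ Δ})
  lie_X_X : ∀ α β γ : roots π, (γ : M) = α + β → ⁅X α, X β⁆ = N α β • X γ ∧ N α β ≠ 0
  lie_X_X_zero : ∀ α β : roots π, (α : M) + β ≠ 0 → (α : M) + β ∉ roots π → ⁅X α, X β⁆ = 0
  linearIndependent : LinearIndependent O
    (Sum.elim (fun β : {β : roots π // (β : M) ∈ Δ} => toral π (h β)) X)
  span_der : ∀ v ∈ lieDer O A, ∃ n : ℤ, n ≠ 0 ∧ n • v ∈ Submodule.span O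
    (Set.range (Sum.elim (fun β : {β : roots π // (β : M) ∈ Δ} => toral π (h β)) X))

end Split

end GroupScheme

/-! ## Galois representations -/

namespace GaloisRep

open GroupScheme NumberField

/-- The maximal extension of `ℚ` inside `ℚ̄` that is unramified outside `p`: the compositum of
all finite Galois extensions of `ℚ` in which every prime number `ℓ ≠ p` is unramified. -/
def maxUnramifiedOutside (p : ℕ) : IntermediateField ℚ (AlgebraicClosure ℚ) :=
  ⨆ (L : IntermediateField ℚ (AlgebraicClosure ℚ))
    (_ : FiniteDimensional ℚ L ∧ IsGalois ℚ L ∧ ∀ ℓ : ℕ, ℓ.Prime → ℓ ≠ p →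
      Algebra.IsUnramifiedIn (𝓞 L) (Ideal.span {(ℓ : ℤ)})), L

/-- `Γ_{ℚ,{p}}`, with its Krull topology. -/
abbrev GalOutside (p : ℕ) : Type :=
  Gal(maxUnramifiedOutside p / ℚ)

variable {A : Type*} [CommRing A] [HopfAlgebra ℤ A] {p : ℕ} [Fact p.Prime]

/-- Reduction `G(ℤ_p) → G(𝔽_p)`. -/
def redModP (A : Type*) [CommRing A] [HopfAlgebra ℤ A] (p : ℕ) [Fact p.Prime] :
    Pts ℤ A ℤ_[p] →* Pts ℤ A (ZMod p) :=
  mapPts A (PadicInt.toZMod (p := p)).toIntAlgHom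

/-- Reduction `G(ℤ_p) → G(ℤ/p^m)`. -/
def red (A : Type*) [CommRing A] [HopfAlgebra ℤ A] (p : ℕ) [Fact p.Prime] (m : ℕ) :
    Pts ℤ A ℤ_[p] →* Pts ℤ A (ZMod (p ^ m)) :=
  mapPts A (PadicInt.toZModPow (p := p) m).toIntAlgHom

/-- The isomorphism `exp : 𝔤 ⊗ p^mℤ/p^{m+1}ℤ → ker(G(ℤ/p^{m+1}) → G(ℤ/p^m))`: this is
`exp(p^m v)`, the point `a ↦ ε(a) + p^m v(a)`; it depends only on `v` modulo `p`. -/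
def expPow (p : ℕ) {m : ℕ} (hm : 1 ≤ m) (v : lie ℤ A) : Pts ℤ A (ZMod (p ^ (m + 1))) :=
  infinitesimal ((p : ZMod (p ^ (m + 1))) ^ m) (by
    rw [← pow_add, ← Nat.cast_pow, ZMod.natCast_eq_zero_iff]
    exact pow_dvd_pow p (by omega)) v

/-- `Φ_m(ρ) = ρ_{m+1}(ker ρ_m) ⊆ G(ℤ/p^{m+1})`, where `ρ_m` is `ρ` modulo `p^m`. -/
def Phi {Γ : Type*} [Group Γ] (ρ : Γ →* Pts ℤ A ℤ_[p]) (m : ℕ) :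
    Subgroup (Pts ℤ A (ZMod (p ^ (m + 1)))) :=
  (((red A p m).comp ρ).ker).map ((red A p (m + 1)).comp ρ)

/-- `Φ_m(ρ)` as a subset of `𝔤 ⊗ 𝔽_p` under the identification of `exp(p^m v)` with
`v mod p` (every element of `𝔤 ⊗ 𝔽_p` is of the form `v mod p = 1 ⊗ v`). -/
def layer {Γ : Type*} [Group Γ] (ρ : Γ →* Pts ℤ A ℤ_[p]) {m : ℕ} (hm : 1 ≤ m) :
    Set (ZMod p ⊗[ℤ] lie ℤ A) :=
  {x | ∃ v : lie ℤ A, x = 1 ⊗ₜ[ℤ] v ∧ expPow p hm v ∈ Phi ρ m}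

/-- `𝒰_m = ker (G^der(ℤ_p) → G^der(ℤ/p^m))`, as a subset of `G(ℤ_p)`. -/
def congruenceDer (A : Type*) [CommRing A] [HopfAlgebra ℤ A] (p : ℕ) [Fact p.Prime] (m : ℕ) :
    Set (Pts ℤ A ℤ_[p]) :=
  {u | (∀ a ∈ derIdeal ℤ A, u.ofConv a = 0) ∧ red A p m u = 1}

end GaloisRep

end

/-!
Points of `G` and elements of its Lie algebra `𝔤` are both linear forms on the coordinate ring, and
they are compared inside the convolution ring `Form` of all such forms. A point of `G(ℤ_p)` which
is `1` modulo `p ^ m` is `1 + p ^ m v + …` with `v` in `𝔤` well defined modulo `p`, and even modulo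
`p ^ m` (`exists_lie_of_ptForm_eq`); the leading terms `v` of a subgroup form a filtration
compatible with brackets (`lie_mem_leadingTerms`) and with `p`-th powers
(`mem_leadingTerms_succ`). The argument concerns the intersection `K` of the image of `ρ` with the
points of the derived group. It has four ingredients.

*Root vectors.* Bracketing the regular element of the first layer with the root vectors of odd
height puts these into the second layer of `K`. A root of even height is a sum of two roots of odd
height (`exists_odd_add_odd`) and the structure constants are prime to `p`, so the other root
vectors occur there as well, and so do the `H_β = [X_β, X_{-β}]` for simple `β`. Raising to `p`-th
powers carries all of these to the fourth layer.

*Toral elements.* If the derived group is not simply connected, its Lie algebra may be strictly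
larger than the span of the Chevalley basis, and at primes dividing the index new elements
`(∑ c_β H_β) / n` are needed. The existence of an element of `𝔱` on which no root vanishes modulo
`p` bounds the invariant form `∑ α(H_β)²` by `24 p - 40` (`CorootSystem.norm_le`, by means of
Bessel's inequality), and this excludes denominators divisible by `p²` (`exists_smul_eq_sum`). The
elements with a single `p` in the denominator come from second-order terms: the commutator of
elements of the image with leading terms `X_β` and `X_{-β}` in layers one and two has the form
`1 + p³ (H_β + p δ) + O(p⁵)`, where `δ` is again a leading term of the fourth layer
(`exists_add_smul_mem_approxTerms`). Multiplying powers of these for the various `β`, such that the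
`H_β` add up to a multiple of `p`, gives an element of `K` in the fourth layer. Together this is
`lieDer_le_leadingTerms`.

*Negative roots.* That the negative of a root is a root is not part of the definition of a Chevalley
basis, and is deduced from the triviality of the unipotent radical (`neg_mem_roots`). If some roots
had no negative, then the derived series of an ideal attached to the radical of the Killing form
would end in a nonzero abelian ideal spanned by root vectors and stable under the adjoint action
(`exists_stable_abelian`). The exponentials of the elements of this ideal form a connected normal
unipotent subgroup, isomorphic to a vector group (`isEmpty_of_isConnectedReductive`).

*Congruence subgroups.* The leading term of a point of the derived group is in the Lie algebra of
the derived group modulo `p`, even if the fibre of the derived group at `p` is not smooth: high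
`p`-th powers of the point have the same leading term, and the Artin-Rees lemma applies to them
(`exists_mem_lieDer_of_mem_derPts`). So every point of the congruence subgroup of level four is
approximated by elements of `K` to any precision (`exists_mul_eq_one_add`), and it belongs to the
image because the Galois group is compact (`mem_range_of_forall_red`).
-/

noncomputable section

/-! ### Forms on the coordinate ring and their convolution product -/

namespace GroupScheme

section Forms

variable {O A R S : Type*} [CommRing O] [CommRing A] [HopfAlgebra O A]
  [CommRing R] [Algebra O R] [CommRing S] [Algebra O S]

variable (O A R) in
/-- The linear forms on the coordinate ring `A` with values in `R`, with the convolution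
product. The group `G(R)` and the tangent space at the identity both embed into this ring. -/
abbrev Form : Type _ := WithConv (A →ₗ[O] R)

/-- Post-composition of forms with an algebra homomorphism. -/
def mapForm (f : R →ₐ[O] S) : Form O A R →+* Form O A S where
  toFun v := toConv (f.toLinearMap ∘ₗ v.ofConv)
  map_one' := by ext a; simp
  map_mul' v w := by
    apply WithConv.ofConv_injective
    exact LinearMap.algHom_comp_convMul_distrib f v w
  map_zero' := by ext a; simp
  map_add' v w := by ext a; simp

@[simp] lemma mapForm_apply (f : R →ₐ[O] S) (v : Form O A R) (a : A) :
    mapForm f v a = f (v a) := rfl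

@[simp] lemma mapForm_smul (f : R →ₐ[O] S) (r : R) (v : Form O A R) :
    mapForm f (r • v) = f r • mapForm f v := by
  ext a; simp [mapForm]

variable (R) in
/-- The extension of scalars of a form with values in the base ring. -/
def castForm : Dist O A →+* Form O A R := mapForm (Algebra.ofId O R)

@[simp] lemma castForm_apply (v : Dist O A) (a : A) : castForm R v a = algebraMap O R (v a) := rfl

@[simp] lemma castForm_smul (c : O) (v : Dist O A) : castForm R (c • v) = c • castForm R v := by
  ext a
  change algebraMap O R (c * v a) = c • algebraMap O R (v a)
  rw [map_mul, Algebra.smul_def]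

@[simp] lemma mapForm_castForm (f : R →ₐ[O] S) (v : Dist O A) :
    mapForm f (castForm R v) = castForm S v := by
  ext a; simp

/-- A point of `G`, viewed as a form. -/
def ptForm : Pts O A R →* Form O A R where
  toFun x := toConv x.ofConv.toLinearMap
  map_one' := rfl
  map_mul' _ _ := rfl

@[simp] lemma ptForm_apply (x : Pts O A R) (a : A) : ptForm x a = x.ofConv a := rfl

lemma ptForm_injective : Function.Injective (ptForm : Pts O A R → Form O A R) := fun x y h => by
  apply WithConv.ofConv_injective
  ext a
  exact congrArg (fun f : Form O A R => f a) h

lemma ptForm_mul_inv (x : Pts O A R) : ptForm x * ptForm x⁻¹ = 1 := by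
  rw [← map_mul, mul_inv_cancel, map_one]

lemma ptForm_inv_mul (x : Pts O A R) : ptForm x⁻¹ * ptForm x = 1 := by
  rw [← map_mul, inv_mul_cancel, map_one]

lemma mapForm_ptForm (f : R →ₐ[O] S) (x : Pts O A R) :
    mapForm f (ptForm x) = ptForm (mapPts A f x) := rfl

/-- The exterior product of two forms: `a ⊗ b ↦ v a * w b`. -/
def box (v w : Form O A R) : WithConv (A ⊗[O] A →ₗ[O] R) :=
  toConv (LinearMap.mul' O R ∘ₗ TensorProduct.map v.ofConv w.ofConv)

@[simp] lemma box_tmul (v w : Form O A R) (a b : A) : box v w (a ⊗ₜ b) = v a * w b := rfl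

lemma mul_apply_eq_box (v w : Form O A R) (a : A) :
    (v * w) a = box v w (Coalgebra.comul (R := O) a) := rfl

lemma box_mul_box (v w v' w' : Form O A R) : box v w * box v' w' = box (v * v') (w * w') := by
  have h := congrArg (fun u => toConv ((Algebra.TensorProduct.lmul' O (S := R)).toLinearMap ∘ₗ
      WithConv.ofConv u)) (TensorProduct.map_convMul_map (R := O) (f := v) (h := v') (g := w)
      (k := w'))
  simp only [LinearMap.algHom_comp_convMul_distrib] at h
  exact h

lemma box_one_one : box (1 : Form O A R) 1 = 1 := by
  apply WithConv.ofConv_injective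
  ext a b
  simp [box, mul_comm]

lemma box_add_left (v v' w : Form O A R) : box (v + v') w = box v w + box v' w := by
  apply WithConv.ofConv_injective
  ext a b
  simp [box, add_mul]

lemma box_add_right (v w w' : Form O A R) : box v (w + w') = box v w + box v w' := by
  apply WithConv.ofConv_injective
  ext a b
  simp [box, mul_add]

lemma box_smul_left (c : R) (v w : Form O A R) : box (c • v) w = c • box v w := by
  apply WithConv.ofConv_injective
  ext a b
  simp [box, mul_assoc]

lemma box_smul_right (c : R) (v w : Form O A R) : box v (c • w) = c • box v w := by
  apply WithConv.ofConv_injective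
  ext a b
  simp [box, mul_left_comm]

/-- The pull-back of forms along the diagonal embedding, `v ↦ (a ⊗ b ↦ v (a * b))`. -/
def pullMul : Form O A R →+* WithConv (A ⊗[O] A →ₗ[O] R) where
  toFun v := toConv (v.ofConv ∘ₗ LinearMap.mul' O A)
  map_one' := by
    apply WithConv.ofConv_injective
    ext a b
    simp [map_mul, mul_comm]
  map_mul' v w := by
    apply WithConv.ofConv_injective
    exact LinearMap.convMul_comp_coalgHom_distrib v w (Bialgebra.mulBialgHom O A).toCoalgHom
  map_zero' := by apply WithConv.ofConv_injective; ext a b; simp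
  map_add' v w := by apply WithConv.ofConv_injective; ext a b; simp

@[simp] lemma pullMul_tmul (v : Form O A R) (a b : A) : pullMul v (a ⊗ₜ b) = v (a * b) := by
  change v (LinearMap.mul' O A (a ⊗ₜ b)) = _
  simp

lemma pullMul_smul (c : R) (v : Form O A R) : pullMul (c • v) = c • pullMul v := rfl

lemma pullMul_ext {v : Form O A R} {u : WithConv (A ⊗[O] A →ₗ[O] R)} :
    pullMul v = u ↔ ∀ a b, v (a * b) = u (a ⊗ₜ b) := by
  constructor
  · intro h a b
    rw [← h, pullMul_tmul]
  · intro h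
    apply WithConv.ofConv_injective
    ext a b
    exact (pullMul_tmul v a b).trans (h a b)

lemma pullMul_ptForm (x : Pts O A R) : pullMul (ptForm x) = box (ptForm x) (ptForm x) := by
  rw [pullMul_ext]
  intro a b
  simp

/-- `v` is a derivation at the identity, with values in `R`. -/
def IsDer (v : Form O A R) : Prop := pullMul v = box v 1 + box 1 v

lemma isDer_iff {v : Form O A R} : IsDer v ↔ ∀ a b, v (a * b) =
    algebraMap O R (Coalgebra.counit (R := O) a) * v b
      + v a * algebraMap O R (Coalgebra.counit (R := O) b) := by
  rw [IsDer, pullMul_ext]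
  refine forall₂_congr fun a b => ?_
  change _ = box v 1 (a ⊗ₜ b) + box 1 v (a ⊗ₜ b) ↔ _
  simp [add_comm]

lemma IsDer.add {v w : Form O A R} (hv : IsDer v) (hw : IsDer w) : IsDer (v + w) := by
  rw [IsDer, map_add, hv, hw, box_add_left, box_add_right]; abel

lemma IsDer.smul {v : Form O A R} (hv : IsDer v) (c : R) : IsDer (c • v) := by
  rw [IsDer, pullMul_smul, hv, box_smul_left, box_smul_right, smul_add]

lemma isDer_zero : IsDer (0 : Form O A R) := by
  rw [isDer_iff]; intro a b; simp

lemma IsDer.sum {ι : Type*} {s : Finset ι} {v : ι → Form O A R} (hv : ∀ i ∈ s, IsDer (v i)) :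
    IsDer (∑ i ∈ s, v i) := by
  classical
  induction s using Finset.induction_on with
  | empty => simpa using isDer_zero
  | insert i s hi ih =>
    rw [Finset.sum_insert hi]
    exact (hv i (by simp)).add (ih fun j hj => hv j (by simp [hj]))

lemma IsDer.apply_one {v : Form O A R} (hv : IsDer v) : v 1 = 0 := by
  have h := isDer_iff.1 hv 1 1
  simpa using h

/-- The adjoint action of `G(R)` preserves the tangent space. -/
lemma IsDer.conj {v : Form O A R} (hv : IsDer v) (x : Pts O A R) :
    IsDer (ptForm x * v * ptForm x⁻¹) := by
  rw [IsDer, map_mul, map_mul, pullMul_ptForm, pullMul_ptForm, hv, mul_add, add_mul, box_mul_box,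
    box_mul_box, box_mul_box, box_mul_box, mul_one, ptForm_mul_inv]

lemma isDer_castForm (v : lie O A) : IsDer (castForm R v.1) := by
  rw [isDer_iff]
  intro a b
  have h := v.2 a b
  simp [h]

lemma isDer_iff_mem_lie {v : Dist O A} : IsDer v ↔ v ∈ lie O A := by
  rw [isDer_iff]; rfl

lemma IsDer.map {v : Form O A R} (hv : IsDer v) (f : R →ₐ[O] S) : IsDer (mapForm f v) := by
  rw [isDer_iff] at hv ⊢
  intro a b
  simp [hv]

lemma IsDer.lie {v w : Form O A R} (hv : IsDer v) (hw : IsDer w) : IsDer (v * w - w * v) := by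
  rw [IsDer, map_sub, map_mul, map_mul, hv, hw]
  simp only [add_mul, mul_add, box_mul_box, one_mul, mul_one]
  have h1 : box (v * w - w * v) (1 : Form O A R) = box (v * w) 1 - box (w * v) 1 := by
    rw [eq_sub_iff_add_eq, ← box_add_left, sub_add_cancel]
  have h2 : box (1 : Form O A R) (v * w - w * v) = box 1 (v * w) - box 1 (w * v) := by
    rw [eq_sub_iff_add_eq, ← box_add_right, sub_add_cancel]
  rw [h1, h2]
  abel

lemma lie_val (v w : lie O A) : (⁅v, w⁆ : lie O A).1 = v.1 * w.1 - w.1 * v.1 := rfl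

end Forms

end GroupScheme

/-! ### The tangent space at the identity of a smooth affine group scheme -/

namespace GroupScheme

section Tangent

variable {O A : Type*} [CommRing O] [CommRing A] [HopfAlgebra O A]

variable (O A) in
/-- The submodule `O + I²` of `A`, where `I` is the augmentation ideal. -/
def augSq : Submodule O A :=
  Submodule.span O ({1} ∪ {z | ∃ x y : A, Coalgebra.counit (R := O) x = 0 ∧
    Coalgebra.counit (R := O) y = 0 ∧ z = x * y})

lemma counit_sub_smul_one (a : A) :
    Coalgebra.counit (R := O) (a - Coalgebra.counit (R := O) a • (1 : A)) = 0 := by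
  simp

lemma mul_sub_mem_augSq (a b : A) : a * b - (Coalgebra.counit (R := O) a • b
    + Coalgebra.counit (R := O) b • a) ∈ augSq O A := by
  have h1 : (a - Coalgebra.counit (R := O) a • (1 : A)) *
      (b - Coalgebra.counit (R := O) b • (1 : A)) ∈ augSq O A :=
    Submodule.subset_span (Or.inr ⟨_, _, counit_sub_smul_one a, counit_sub_smul_one b, rfl⟩)
  have h2 : (1 : A) ∈ augSq O A := Submodule.subset_span (Or.inl rfl)
  have h3 := (augSq O A).sub_mem h1 ((augSq O A).smul_mem (Coalgebra.counit (R := O) a *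
    Coalgebra.counit (R := O) b) h2)
  convert h3 using 1
  simp only [mul_sub, sub_mul, smul_mul_assoc, mul_smul_comm, one_mul, mul_one, smul_sub,
    mul_smul, smul_comm (Coalgebra.counit (R := O) b)]
  abel

lemma IsDer.eq_zero_of_mem_augSq {R : Type*} [CommRing R] [Algebra O R] {v : Form O A R}
    (hv : IsDer v) {a : A} (ha : a ∈ augSq O A) : v a = 0 := by
  have hle : augSq O A ≤ LinearMap.ker v.ofConv := by
    rw [augSq, Submodule.span_le]
    rintro z (rfl | ⟨x, y, hx, hy, rfl⟩)
    · exact hv.apply_one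
    · have h := isDer_iff.1 hv x y
      simpa [hx, hy] using h
  exact hle ha

instance finite_quotient_augSq [Algebra.FiniteType O A] : Module.Finite O (A ⧸ augSq O A) := by
  obtain ⟨s, hs⟩ := ‹Algebra.FiniteType O A›.out
  have key : ∀ a : A, a ∈ augSq O A ⊔ Submodule.span O (s : Set A) := by
    intro a
    have ha : a ∈ Algebra.adjoin O (s : Set A) := by rw [hs]; trivial
    induction ha using Algebra.adjoin_induction with
    | mem x hx => exact Submodule.mem_sup_right (Submodule.subset_span hx)
    | algebraMap r =>
      rw [Algebra.algebraMap_eq_smul_one]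
      exact Submodule.smul_mem _ _ (Submodule.mem_sup_left (Submodule.subset_span (Or.inl rfl)))
    | add x y _ _ hx hy => exact add_mem hx hy
    | mul x y _ _ hx hy =>
      have h := add_mem
        (Submodule.mem_sup_left (T := Submodule.span O (s : Set A))
          (mul_sub_mem_augSq (O := O) x y))
        (add_mem (Submodule.smul_mem _ (Coalgebra.counit (R := O) x) hy)
          (Submodule.smul_mem _ (Coalgebra.counit (R := O) y) hx))
      simpa using h
  classical
  refine ⟨⟨s.image (augSq O A).mkQ, ?_⟩⟩
  rw [eq_top_iff]
  rintro x -
  obtain ⟨a, rfl⟩ := (augSq O A).mkQ_surjective x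
  obtain ⟨y, hy, z, hz, rfl⟩ := Submodule.mem_sup.1 (key a)
  have hy0 : (augSq O A).mkQ y = 0 := by simpa using hy
  rw [map_add, hy0, zero_add, Finset.coe_image, ← Submodule.map_span]
  exact Submodule.mem_map_of_mem hz

variable (O A) in
/-- The cotangent space at the identity modulo torsion. -/
abbrev Cotan : Type _ := (A ⧸ augSq O A) ⧸ Submodule.torsion O (A ⧸ augSq O A)

variable (O A) in
/-- The class in the cotangent space of (the linear part of) a function. -/
def toCotan : A →ₗ[O] Cotan O A := (Submodule.torsion O (A ⧸ augSq O A)).mkQ ∘ₗ (augSq O A).mkQ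

lemma toCotan_surjective : Function.Surjective (toCotan O A) :=
  (Submodule.mkQ_surjective _).comp (Submodule.mkQ_surjective _)

lemma toCotan_mul (a b : A) : toCotan O A (a * b) = Coalgebra.counit (R := O) a • toCotan O A b
    + Coalgebra.counit (R := O) b • toCotan O A a := by
  have h : toCotan O A (a * b - (Coalgebra.counit (R := O) a • b
    + Coalgebra.counit (R := O) b • a)) = 0 := by
    have h0 := (Submodule.Quotient.mk_eq_zero (augSq O A)).2 (mul_sub_mem_augSq a b)
    rw [toCotan, LinearMap.comp_apply, Submodule.mkQ_apply (augSq O A), h0, map_zero]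
  rwa [map_sub, sub_eq_zero, map_add, map_smul, map_smul] at h

lemma IsDer.eq_zero_of_toCotan [IsDomain O] {R : Type*} [CommRing R] [Algebra O R]
    [Module.IsTorsionFree O R] {v : Form O A R} (hv : IsDer v) {a : A}
    (ha : toCotan O A a = 0) : v a = 0 := by
  have h1 : (augSq O A).mkQ a ∈ Submodule.torsion O (A ⧸ augSq O A) := by
    simpa [toCotan] using ha
  obtain ⟨n, hn⟩ := (Submodule.mem_torsion_iff _).1 h1
  have h2 : ((n : O) • a) ∈ augSq O A := by
    rw [← Submodule.Quotient.mk_eq_zero, Submodule.Quotient.mk_smul]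
    exact hn
  have h3 := hv.eq_zero_of_mem_augSq h2
  rw [map_smul] at h3
  exact (smul_eq_zero.1 h3).resolve_left (nonZeroDivisors.ne_zero n.2)

lemma exists_eq_smul_of_dvd {R : Type*} [CommRing R] [IsDomain R] [Algebra O R] {c : R}
    (hc : c ≠ 0) {f : Form O A R} (h : ∀ a, c ∣ f a) : ∃ g : Form O A R, f = c • g := by
  choose g hg using h
  refine ⟨toConv ⟨⟨g, fun a b => ?_⟩, fun n a => ?_⟩, ?_⟩
  · apply mul_left_cancel₀ hc
    rw [mul_add, ← hg, ← hg, ← hg, map_add]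
  · apply mul_left_cancel₀ hc
    simp only [RingHom.id_apply]
    rw [mul_smul_comm, ← hg, ← hg, map_smul]
  · ext a
    exact hg a

variable [Algebra.FiniteType O A] [IsDomain O] [IsPrincipalIdealRing O]

instance : Module.Free O (Cotan O A) := Module.free_of_finite_type_torsion_free'

variable (O A) in
/-- An index type for coordinates on the tangent space at the identity. -/
abbrev TanIdx : Type _ := Module.Free.ChooseBasisIndex O (Cotan O A)

variable (O A) in
/-- Functions whose differentials at the identity are coordinates on `𝔤`. -/
def tanFun (i : TanIdx O A) : A :=
  (toCotan_surjective (Module.Free.chooseBasis O (Cotan O A) i)).choose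

lemma toCotan_tanFun (i : TanIdx O A) : toCotan O A (tanFun O A i) =
    Module.Free.chooseBasis O (Cotan O A) i :=
  (toCotan_surjective (Module.Free.chooseBasis O (Cotan O A) i)).choose_spec

variable (O A) in
/-- The tangent vectors dual to the coordinates `tanFun`. -/
def tanVec (i : TanIdx O A) : lie O A :=
  ⟨toConv ((Module.Free.chooseBasis O (Cotan O A)).coord i ∘ₗ toCotan O A), fun a b => by
    change (Module.Free.chooseBasis O (Cotan O A)).coord i (toCotan O A (a * b)) =
      _ * (Module.Free.chooseBasis O (Cotan O A)).coord i (toCotan O A b)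
      + (Module.Free.chooseBasis O (Cotan O A)).coord i (toCotan O A a) * _
    rw [toCotan_mul, map_add, map_smul, map_smul, smul_eq_mul, smul_eq_mul]
    ring⟩

lemma tanVec_tanFun (i j : TanIdx O A) [Decidable (i = j)] :
    (tanVec O A i).1 (tanFun O A j) = if i = j then 1 else 0 := by
  change (Module.Free.chooseBasis O (Cotan O A)).coord i (toCotan O A (tanFun O A j)) = _
  rw [toCotan_tanFun, Module.Basis.coord_apply, Module.Basis.repr_self, Finsupp.single_apply]
  simp [eq_comm]

/-- A derivation at the identity is determined by its values on the coordinates `tanFun`. -/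
lemma IsDer.eq_sum {R : Type*} [CommRing R] [Algebra O R] [Module.IsTorsionFree O R]
    {v : Form O A R} (hv : IsDer v) :
    v = ∑ i, v (tanFun O A i) • castForm R (tanVec O A i).1 := by
  ext a
  set e := Module.Free.chooseBasis O (Cotan O A)
  have h0 : toCotan O A (a - ∑ i, e.coord i (toCotan O A a) • tanFun O A i) = 0 := by
    rw [map_sub, map_sum]
    simp only [map_smul, toCotan_tanFun]
    rw [sub_eq_zero]
    exact (e.sum_repr _).symm
  have h1 := hv.eq_zero_of_toCotan h0
  rw [map_sub, map_sum, sub_eq_zero] at h1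
  change v a = _
  rw [h1, WithConv.ofConv_sum, LinearMap.sum_apply]
  refine Finset.sum_congr rfl fun i _ => ?_
  change _ = v (tanFun O A i) * algebraMap O R (e.coord i (toCotan O A a))
  rw [map_smul, Algebra.smul_def, mul_comm]

lemma lie_eq_sum (v : lie O A) : v = ∑ i, v.1 (tanFun O A i) • tanVec O A i := by
  apply Subtype.ext
  have h := (isDer_iff_mem_lie.2 v.2).eq_sum
  rw [AddSubmonoidClass.coe_finsetSum]
  exact h

instance : Module.Finite O (lie O A) := by
  refine Module.Finite.of_surjective (Fintype.linearCombination O (tanVec O A)) fun v =>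
    ⟨fun i => v.1 (tanFun O A i), ?_⟩
  rw [Fintype.linearCombination_apply]
  exact (lie_eq_sum v).symm

instance : Module.IsTorsionFree O (Dist O A) := by
  refine ⟨fun n hn => ?_⟩
  intro x y hxy
  ext a
  have := congrArg (fun f : Dist O A => f a) hxy
  exact mul_left_cancel₀ hn.ne_zero this

instance : Module.IsTorsionFree O (lie O A) :=
  Function.Injective.moduleIsTorsionFree Subtype.val Subtype.val_injective fun _ _ => rfl

instance : Module.Free O (lie O A) := Module.free_of_finite_type_torsion_free'

end Tangent

section Lift

variable {A : Type*} [CommRing A] [HopfAlgebra ℤ A] {p : ℕ} [Fact p.Prime]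

lemma intCast_dvd_iff {n : ℕ} {k : ℤ} : (p : ℤ_[p]) ^ n ∣ (k : ℤ_[p]) ↔ (p : ℤ) ^ n ∣ k := by
  rw [PadicInt.pow_p_dvd_int_iff]

lemma algebraMap_int_padicInt (k : ℤ) : algebraMap ℤ ℤ_[p] k = k := by simp

/-- By smoothness, a derivation at the identity modulo `p ^ N` lifts to an element of `𝔤`: apply
the infinitesimal lifting property to `ℤ[ε] → ℤ[ε] / (p ^ N ε)`. -/
lemma exists_lie_congr [Algebra.FormallySmooth ℤ A] (N : ℕ) (f : Form ℤ A ℤ_[p])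
    (hf : ∀ a b, (p : ℤ_[p]) ^ N ∣ f (a * b) - (((Bialgebra.counitAlgHom ℤ A a) : ℤ_[p]) * f b
      + f a * ((Bialgebra.counitAlgHom ℤ A b) : ℤ_[p]))) :
    ∃ (v : lie ℤ A) (g : Form ℤ A ℤ_[p]), f = castForm ℤ_[p] v.1 + (p : ℤ_[p]) ^ N • g := by
  have hp0 : (p : ℤ_[p]) ^ N ≠ 0 := pow_ne_zero _ (by exact_mod_cast (Fact.out : p.Prime).ne_zero)
  let t : A → ℤ := fun a => ((f a).appr N : ℤ)
  have ht : ∀ a, (p : ℤ_[p]) ^ N ∣ f a - (t a : ℤ_[p]) := fun a => by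
    have := PadicInt.appr_spec N (f a)
    rw [Ideal.mem_span_singleton] at this
    simpa [t] using this
  let J : Ideal (TrivSqZeroExt ℤ ℤ) := Ideal.span {TrivSqZeroExt.inr ((p : ℤ) ^ N)}
  have hJmem : ∀ k : ℤ, (p : ℤ) ^ N ∣ k → (TrivSqZeroExt.inr k : TrivSqZeroExt ℤ ℤ) ∈ J := by
    rintro _ ⟨c, rfl⟩
    refine Ideal.mem_span_singleton.2 ⟨TrivSqZeroExt.inl c, ?_⟩
    ext <;> simp
  have hJ2 : ∀ x ∈ J, TrivSqZeroExt.fst x = 0 ∧ (p : ℤ) ^ N ∣ TrivSqZeroExt.snd x := by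
    intro x hx
    obtain ⟨c, rfl⟩ := Ideal.mem_span_singleton.1 hx
    rw [TrivSqZeroExt.fst_mul, TrivSqZeroExt.snd_mul, TrivSqZeroExt.fst_inr,
      TrivSqZeroExt.snd_inr]
    simp
  have hJnil : IsNilpotent J := by
    refine ⟨2, ?_⟩
    rw [pow_two, Ideal.span_singleton_mul_span_singleton, TrivSqZeroExt.inr_mul_inr]
    simp
  let e : A → TrivSqZeroExt ℤ ℤ := fun a => (Bialgebra.counitAlgHom ℤ A a, t a)
  have he1 : ∀ a, TrivSqZeroExt.fst (e a) = Bialgebra.counitAlgHom ℤ A a := fun a => rfl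
  have he2 : ∀ a, TrivSqZeroExt.snd (e a) = t a := fun a => rfl
  have hdiff : ∀ (a : A) (b : TrivSqZeroExt ℤ ℤ) (k : ℤ),
      TrivSqZeroExt.fst (e a - b) = 0 → TrivSqZeroExt.snd (e a - b) = k →
      (p : ℤ_[p]) ^ N ∣ (k : ℤ_[p]) → Ideal.Quotient.mk J (e a) = Ideal.Quotient.mk J b := by
    intro a b k h1 h2 h3
    rw [Ideal.Quotient.eq]
    have : e a - b = TrivSqZeroExt.inr k := by
      ext
      · simp [h1]
      · simp [h2]
    rw [this]
    exact hJmem _ (intCast_dvd_iff.1 h3)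
  let φ : A →+* TrivSqZeroExt ℤ ℤ ⧸ J :=
    { toFun := fun a => Ideal.Quotient.mk J (e a)
      map_one' := by
        rw [← map_one (Ideal.Quotient.mk J)]
        refine hdiff _ _ _ (by simp [he1]) rfl ?_
        have h1 : (p : ℤ_[p]) ^ N ∣ f 1 := by
          have := hf 1 1
          simpa using this
        simpa [he2] using (dvd_sub h1 (ht 1))
      map_mul' := fun a b => by
        rw [← map_mul]
        refine hdiff _ _ _ (by simp [he1]) rfl ?_
        have h := (((hf a b).sub (ht (a * b))).add
          ((ht b).mul_left ((Bialgebra.counitAlgHom ℤ A a) : ℤ_[p]))).add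
          ((ht a).mul_left ((Bialgebra.counitAlgHom ℤ A b) : ℤ_[p]))
        convert h using 1
        simp only [TrivSqZeroExt.snd_sub, TrivSqZeroExt.snd_mul, he1, he2, smul_eq_mul,
          MulOpposite.smul_eq_mul_unop, MulOpposite.unop_op]
        push_cast
        ring
      map_zero' := by
        rw [← map_zero (Ideal.Quotient.mk J)]
        refine hdiff _ _ _ (by simp [he1]) rfl ?_
        have h := ht 0
        simpa [he2] using h
      map_add' := fun a b => by
        rw [← map_add]
        refine hdiff _ _ _ (by simp [he1]) rfl ?_
        have h := (((ht a).add (ht b)).sub (ht (a + b)))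
        rw [show f (a + b) = f a + f b from map_add f.ofConv a b] at h
        convert h using 1
        simp only [TrivSqZeroExt.snd_sub, TrivSqZeroExt.snd_add, he2]
        push_cast
        ring }
  have hφ : ∀ r : ℤ, φ (algebraMap ℤ A r) = algebraMap ℤ (TrivSqZeroExt ℤ ℤ ⧸ J) r := fun r => by
    rw [← RingHom.comp_apply]
    exact congrArg (fun f : ℤ →+* TrivSqZeroExt ℤ ℤ ⧸ J => f r) (Subsingleton.elim _ _)
  let ψ : A →ₐ[ℤ] TrivSqZeroExt ℤ ℤ ⧸ J := { φ with commutes' := hφ }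
  obtain ⟨F, hF⟩ := Algebra.FormallySmooth.exists_lift (R := ℤ) J hJnil ψ
  have hFe : ∀ a, Ideal.Quotient.mk J (F a) = Ideal.Quotient.mk J (e a) := fun a =>
    congrArg (fun g : A →ₐ[ℤ] TrivSqZeroExt ℤ ℤ ⧸ J => g a) hF
  have hF1 : ∀ a, TrivSqZeroExt.fst (F a) = Bialgebra.counitAlgHom ℤ A a ∧
      (p : ℤ) ^ N ∣ TrivSqZeroExt.snd (F a) - t a := fun a => by
    have h := hJ2 _ (Ideal.Quotient.eq.1 (hFe a))
    constructor
    · have := h.1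
      simp only [TrivSqZeroExt.fst_sub, sub_eq_zero] at this
      simpa [e] using this
    · have h2 := h.2
      rwa [TrivSqZeroExt.snd_sub] at h2
  let v : lie ℤ A := ⟨toConv ((TrivSqZeroExt.sndHom ℤ ℤ) ∘ₗ F.toLinearMap), fun a b => by
    change TrivSqZeroExt.snd (F (a * b)) = _ * TrivSqZeroExt.snd (F b)
      + TrivSqZeroExt.snd (F a) * _
    rw [map_mul, TrivSqZeroExt.snd_mul, (hF1 a).1, (hF1 b).1]
    simp [mul_comm]⟩
  have hv : ∀ a, v.1 a = TrivSqZeroExt.snd (F a) := fun a => rfl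
  obtain ⟨g, hg⟩ := exists_eq_smul_of_dvd (f := f - castForm ℤ_[p] v.1) hp0 (fun a => by
    have h1 := (intCast_dvd_iff (p := p)).2 (hF1 a).2
    have h2 := (ht a).sub h1
    convert h2 using 1
    change f a - algebraMap ℤ ℤ_[p] (v.1 a) = _
    rw [hv, algebraMap_int_padicInt]
    push_cast
    ring)
  exact ⟨v, g, by rw [← hg]; abel⟩

end Lift

end GroupScheme

/-! ### Points of the derived group -/

namespace GroupScheme

section Derived

variable {O A R S : Type*} [CommRing O] [CommRing A] [HopfAlgebra O A]
  [CommRing R] [Algebra O R] [CommRing S] [Algebra O S]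

lemma mul_apply_eq_zero_of_isCoideal {I : Ideal A} [hI : (I.restrictScalars O).IsCoideal]
    {v w : Form O A R} (hv : ∀ f ∈ I, v f = 0) (hw : ∀ f ∈ I, w f = 0) {f : A} (hf : f ∈ I) :
    (v * w) f = 0 := by
  have hv' : I.restrictScalars O ≤ LinearMap.ker v.ofConv := hv
  have hw' : I.restrictScalars O ≤ LinearMap.ker w.ofConv := hw
  have e : TensorProduct.map v.ofConv w.ofConv =
      TensorProduct.map ((I.restrictScalars O).liftQ v.ofConv hv')
        ((I.restrictScalars O).liftQ w.ofConv hw') ∘ₗ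
      TensorProduct.map (I.restrictScalars O).mkQ (I.restrictScalars O).mkQ := by
    rw [← TensorProduct.map_comp, Submodule.liftQ_mkQ, Submodule.liftQ_mkQ]
  change LinearMap.mul' O R (TensorProduct.map v.ofConv w.ofConv (Coalgebra.comul f)) = 0
  rw [e, LinearMap.comp_apply, hI.map_mkQ_comul_eq_zero hf, map_zero, map_zero]

variable (O A) in
/-- The Hopf ideals of closed subgroups containing all commutators. -/
def commIdeals : Set (Ideal A) :=
  {I : Ideal A | I.IsHopfIdeal O ∧ ∀ f ∈ I, (univCommutator O A).ofConv f = 0}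

lemma forall_derIdeal_iff (u : Pts O A R) : (∀ a ∈ derIdeal O A, u.ofConv a = 0) ↔
    ∀ I ∈ commIdeals O A, ∀ a ∈ I, u.ofConv a = 0 := by
  have : (derIdeal O A ≤ RingHom.ker u.ofConv) ↔ ∀ I ∈ commIdeals O A, I ≤ RingHom.ker u.ofConv :=
    sSup_le_iff
  exact this

variable (O A R) in
/-- The group `G^der(R)`, as a subgroup of `G(R)`. -/
def derPts : Subgroup (Pts O A R) where
  carrier := {u | ∀ a ∈ derIdeal O A, u.ofConv a = 0}
  mul_mem' {u w} hu hw := by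
    simp only [Set.mem_ofPred_eq, forall_derIdeal_iff] at hu hw ⊢
    intro I hI a ha
    have := hI.1
    exact mul_apply_eq_zero_of_isCoideal (v := ptForm u) (w := ptForm w) (hu I hI) (hw I hI) ha
  one_mem' := by
    simp only [Set.mem_ofPred_eq, forall_derIdeal_iff]
    intro I hI a ha
    have := hI.1
    have h : Coalgebra.counit (R := O) a = 0 :=
      Submodule.IsCoideal.counit_eq_zero (I := I.restrictScalars O) ha
    change algebraMap O R (Coalgebra.counit a) = 0
    rw [h, map_zero]
  inv_mem' {u} hu := by
    simp only [Set.mem_ofPred_eq, forall_derIdeal_iff] at hu ⊢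
    intro I hI a ha
    have := hI.1
    exact hu I hI _ (Ideal.IsHopfIdeal.antipode_mem (R := O) ha)

lemma mem_derPts {u : Pts O A R} : u ∈ derPts O A R ↔ ∀ a ∈ derIdeal O A, u.ofConv a = 0 := Iff.rfl

lemma mapPts_univCommutator (x y : Pts O A R) :
    mapPts A (Algebra.TensorProduct.lift x.ofConv y.ofConv fun _ _ => .all _ _)
      (univCommutator O A) = x * y * x⁻¹ * y⁻¹ := by
  unfold univCommutator
  have hx : mapPts A (Algebra.TensorProduct.lift x.ofConv y.ofConv fun _ _ => .all _ _)
      (toConv Algebra.TensorProduct.includeLeft : Pts O A (A ⊗[O] A)) = x := by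
    apply WithConv.ofConv_injective
    exact Algebra.TensorProduct.lift_comp_includeLeft _ _ fun _ _ => .all _ _
  have hy : mapPts A (Algebra.TensorProduct.lift x.ofConv y.ofConv fun _ _ => .all _ _)
      (toConv Algebra.TensorProduct.includeRight : Pts O A (A ⊗[O] A)) = y := by
    apply WithConv.ofConv_injective
    exact Algebra.TensorProduct.lift_comp_includeRight _ _ fun _ _ => .all _ _
  simp only [map_mul, map_inv, hx, hy]

lemma commutator_mem_derPts (x y : Pts O A R) : x * y * x⁻¹ * y⁻¹ ∈ derPts O A R := by
  rw [mem_derPts, forall_derIdeal_iff]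
  intro I hI a ha
  rw [← mapPts_univCommutator]
  rw [← map_zero (Algebra.TensorProduct.lift x.ofConv y.ofConv fun _ _ => .all _ _), ← hI.2 a ha]
  rfl

lemma ptForm_infinitesimal (t : R) (ht : t * t = 0) (v : lie O A) :
    ptForm (infinitesimal t ht v) = 1 + t • castForm R v.1 := rfl

lemma ptForm_infinitesimal_inv (t : R) (ht : t * t = 0) (v : lie O A) :
    ptForm (infinitesimal t ht v)⁻¹ = 1 - t • castForm R v.1 := by
  have h : ptForm (infinitesimal t ht v) * (1 - t • castForm R v.1) = 1 := by
    rw [ptForm_infinitesimal, add_mul, one_mul, mul_sub, mul_one, smul_mul_smul_comm, ht, zero_smul]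
    abel
  calc ptForm (infinitesimal t ht v)⁻¹
      = ptForm (infinitesimal t ht v)⁻¹ * (ptForm (infinitesimal t ht v) *
        (1 - t • castForm R v.1)) := by rw [h, mul_one]
    _ = _ := by rw [← mul_assoc, ptForm_inv_mul, one_mul]

lemma ptForm_commutator_infinitesimal {s t : R} (hs : s * s = 0) (ht : t * t = 0) (v w : lie O A) :
    ptForm (infinitesimal s hs v * infinitesimal t ht w * (infinitesimal s hs v)⁻¹ *
      (infinitesimal t ht w)⁻¹) = 1 + (s * t) • castForm R (v.1 * w.1 - w.1 * v.1) := by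
  rw [map_mul, map_mul, map_mul, ptForm_infinitesimal, ptForm_infinitesimal,
    ptForm_infinitesimal_inv, ptForm_infinitesimal_inv, map_sub, map_mul, map_mul]
  have hts : t * s = s * t := mul_comm _ _
  have h1 : s * t * s = 0 := by rw [mul_assoc, hts, ← mul_assoc, hs, zero_mul]
  have h2 : t * (s * t) = 0 := by rw [← hts, ← mul_assoc, ht, zero_mul]
  have h3 : s * t * t = 0 := by rw [mul_assoc, ht, mul_zero]
  have h4 : s * (s * t) = 0 := by rw [← mul_assoc, hs, zero_mul]
  have h5 : s * t * (s * t) = 0 := by rw [← mul_assoc, h1, zero_mul]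
  simp only [add_mul, mul_add, mul_sub, sub_mul, one_mul, mul_one, smul_mul_smul_comm, hs, ht,
    h1, h3, zero_smul, smul_sub, hts, zero_mul]
  abel

lemma lie_mem_lieDer_of_injective {s t : R} (hs : s * s = 0) (ht : t * t = 0)
    (hst : ∀ c : O, s * t * algebraMap O R c = 0 → c = 0) (v w : lie O A) :
    ⁅v, w⁆ ∈ lieDer O A := by
  have h := commutator_mem_derPts (infinitesimal _ hs v) (infinitesimal _ ht w)
  have hcomm := ptForm_commutator_infinitesimal hs ht v w
  intro a ha
  have h0 := h a ha
  rw [← ptForm_apply, hcomm] at h0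
  have h1 : ptForm (1 : Pts O A R) a = 0 := (derPts O A _).one_mem a ha
  rw [map_one] at h1
  rw [WithConv.ofConv_add, LinearMap.add_apply, h1, zero_add, WithConv.ofConv_smul,
    LinearMap.smul_apply, castForm_apply] at h0
  exact hst _ h0

/-- The commutator of the points `1 + ε v` and `1 + δ w` is `1 + ε δ [v, w]`, where
`ε² = δ² = 0`; therefore `[𝔤, 𝔤] ⊆ 𝔤^der`. -/
lemma lie_mem_lieDer (v w : lie O A) : ⁅v, w⁆ ∈ lieDer O A := by
  refine lie_mem_lieDer_of_injective (R := DualNumber (DualNumber O))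
    (s := TrivSqZeroExt.inl DualNumber.eps) (t := DualNumber.eps) ?_ DualNumber.eps_mul_eps ?_ v w
  · exact (TrivSqZeroExt.inl_mul _ _ _).symm.trans
      (by rw [DualNumber.eps_mul_eps, TrivSqZeroExt.inl_zero])
  · intro c hc
    have h2 := congrArg (fun z => TrivSqZeroExt.snd (TrivSqZeroExt.snd z)) hc
    have h3 : algebraMap O (DualNumber (DualNumber O)) c =
      TrivSqZeroExt.inl (TrivSqZeroExt.inl c) := rfl
    rw [h3] at h2
    simp only [TrivSqZeroExt.snd_mul, TrivSqZeroExt.fst_mul, TrivSqZeroExt.fst_inl,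
      TrivSqZeroExt.snd_inl, DualNumber.fst_eps, DualNumber.snd_eps, TrivSqZeroExt.snd_zero,
      smul_eq_mul, smul_zero, zero_add, mul_one,
      mul_zero, MulOpposite.smul_eq_mul_unop, MulOpposite.unop_op, one_mul, add_zero,
      MulOpposite.op_zero] at h2
    simpa using h2

end Derived

end GroupScheme

/-! ### Decomposition of the tangent space into weight spaces -/

namespace GroupScheme

section Weights

variable {O A M R : Type*} [CommRing O] [CommRing A] [HopfAlgebra O A] [AddCommGroup M]
  [CommRing R] [Algebra O R] (π : A →ₐc[O] AddMonoidAlgebra O M)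

/-- The point of `T(R) = Hom(M, Rˣ)` given by a character of `M`, as a point of `G`. -/
def torusPt : (Multiplicative M →* R) →* Pts O A R where
  toFun c := toConv ((AddMonoidAlgebra.lift O R M c).comp (π : A →ₐ[O] AddMonoidAlgebra O M))
  map_one' := by
    apply WithConv.ofConv_injective
    have h : AddMonoidAlgebra.lift O R M 1 =
        (Algebra.ofId O R).comp (Bialgebra.counitAlgHom O (AddMonoidAlgebra O M)) := by
      refine AddMonoidAlgebra.algHom_ext (fun m => ?_) (Subsingleton.elim _ _)
      simp
    change (AddMonoidAlgebra.lift O R M 1).comp (π : A →ₐ[O] AddMonoidAlgebra O M) = _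
    rw [h]
    ext a
    simp [AlgHom.convOne_def, Algebra.ofId_apply]
  map_mul' c d := by
    apply WithConv.ofConv_injective
    have h : AddMonoidAlgebra.lift O R M (c * d) =
        ((Algebra.TensorProduct.lmul' O (S := R)).comp (Algebra.TensorProduct.map
          (AddMonoidAlgebra.lift O R M c) (AddMonoidAlgebra.lift O R M d))).comp
          (Bialgebra.comulAlgHom O (AddMonoidAlgebra O M)) := by
      refine AddMonoidAlgebra.algHom_ext (fun m => ?_) (Subsingleton.elim _ _)
      simp
    change (AddMonoidAlgebra.lift O R M (c * d)).comp (π : A →ₐ[O] AddMonoidAlgebra O M) = _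
    rw [h]
    ext a
    have hc := CoalgHomClass.map_comp_comul_apply π a
    change Algebra.TensorProduct.lmul' O (S := R) (TensorProduct.map
      (AddMonoidAlgebra.lift O R M c).toLinearMap (AddMonoidAlgebra.lift O R M d).toLinearMap
      (Coalgebra.comul (R := O) (π a))) = Algebra.TensorProduct.lmul' O (S := R) (TensorProduct.map
      ((AddMonoidAlgebra.lift O R M c).toLinearMap ∘ₗ (π : A →ₗ[O] AddMonoidAlgebra O M))
      ((AddMonoidAlgebra.lift O R M d).toLinearMap ∘ₗ (π : A →ₗ[O] AddMonoidAlgebra O M))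
      (Coalgebra.comul (R := O) a))
    rw [← hc, ← LinearMap.comp_apply (TensorProduct.map _ _), ← TensorProduct.map_comp]

lemma torusPt_apply (c : Multiplicative M →* R) (a : A) :
    (torusPt π c).ofConv a = AddMonoidAlgebra.lift O R M c (π a) := rfl

/-- The adjoint action of a point of `G` on forms. -/
def conjForm (x : Pts O A R) (v : Form O A R) : Form O A R := ptForm x * v * ptForm x⁻¹

lemma conjForm_mul (x y : Pts O A R) (v : Form O A R) :
    conjForm (x * y) v = conjForm x (conjForm y v) := by
  simp only [conjForm, mul_inv_rev, map_mul, mul_assoc]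

lemma conjForm_one (v : Form O A R) : conjForm 1 v = v := by
  simp [conjForm]

lemma conjForm_mul_form (x : Pts O A R) (v w : Form O A R) :
    conjForm x (v * w) = conjForm x v * conjForm x w := by
  have h : conjForm x v * conjForm x w =
      ptForm x * v * (ptForm x⁻¹ * ptForm x) * w * ptForm x⁻¹ := by
    simp only [conjForm, mul_assoc]
  rw [h, ptForm_inv_mul, mul_one, conjForm, ← mul_assoc]

lemma conjForm_add (x : Pts O A R) (v w : Form O A R) :
    conjForm x (v + w) = conjForm x v + conjForm x w := by
  simp only [conjForm, mul_add, add_mul]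

lemma conjForm_sub (x : Pts O A R) (v w : Form O A R) :
    conjForm x (v - w) = conjForm x v - conjForm x w := by
  simp only [conjForm, mul_sub, sub_mul]

lemma conjForm_smul (x : Pts O A R) (c : R) (v : Form O A R) :
    conjForm x (c • v) = c • conjForm x v := by
  simp only [conjForm, mul_smul_comm, smul_mul_assoc]

lemma conjForm_sum {ι : Type*} (s : Finset ι) (x : Pts O A R) (v : ι → Form O A R) :
    conjForm x (∑ i ∈ s, v i) = ∑ i ∈ s, conjForm x (v i) := by
  simp only [conjForm, Finset.mul_sum, Finset.sum_mul]

lemma mapForm_conjForm {S : Type*} [CommRing S] [Algebra O S] (f : R →ₐ[O] S) (x : Pts O A R)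
    (v : Form O A R) : mapForm f (conjForm x v) = conjForm (mapPts A f x) (mapForm f v) := by
  simp only [conjForm, map_mul, mapForm_ptForm, map_inv]

/-- The tautological character `M → O[M]`, giving the universal point of `T`. -/
def univChar (O M : Type*) [CommRing O] [AddCommGroup M] :
    Multiplicative M →* AddMonoidAlgebra O M := AddMonoidAlgebra.of O M

lemma lift_univChar : AddMonoidAlgebra.lift O _ M (univChar O M) = AlgHom.id O _ := by
  refine AddMonoidAlgebra.algHom_ext (fun m => ?_) (Subsingleton.elim _ _)
  simp [univChar]

lemma adTorus_eq_conjForm (v : Dist O A) :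
    adTorus π v = conjForm (torusPt π (univChar O M)) (castForm _ v) := by
  have h : torusPt π (univChar O M) = toConv (π : A →ₐ[O] AddMonoidAlgebra O M) := by
    apply WithConv.ofConv_injective
    change (AddMonoidAlgebra.lift O _ M (univChar O M)).comp _ = _
    rw [lift_univChar]
    rfl
  rw [h]
  rfl

lemma mapForm_lift_adTorus (c : Multiplicative M →* R) (v : Dist O A) :
    mapForm (AddMonoidAlgebra.lift O R M c) (adTorus π v) =
      conjForm (torusPt π c) (castForm R v) := by
  rw [adTorus_eq_conjForm, mapForm_conjForm, mapForm_castForm]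
  congr 1
  apply WithConv.ofConv_injective
  ext a
  change AddMonoidAlgebra.lift O R M c (AddMonoidAlgebra.lift O _ M (univChar O M) (π a)) =
    AddMonoidAlgebra.lift O R M c (π a)
  rw [lift_univChar]
  rfl

lemma isDer_adTorus (v : lie O A) : IsDer (adTorus π v.1) := by
  rw [adTorus_eq_conjForm]
  exact (isDer_castForm v).conj _

/-- The component of weight `m` of an element of `𝔤`. -/
def wtComp (m : M) : lie O A →ₗ[O] lie O A where
  toFun v := ⟨toConv
    { toFun := fun a => (adTorus π v.1 a).coeff m
      map_add' := fun a b => by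
        rw [map_add, AddMonoidAlgebra.coeff_add, Finsupp.add_apply]
      map_smul' := fun c a => by
        rw [map_smul, AddMonoidAlgebra.coeff_smul, Finsupp.smul_apply]; rfl }, fun a b => by
      have h := isDer_iff.1 (isDer_adTorus π v) a b
      change (adTorus π v.1 (a * b)).coeff m = _ * (adTorus π v.1 b).coeff m +
        (adTorus π v.1 a).coeff m * _
      rw [h, mul_comm (adTorus π v.1 a), ← Algebra.smul_def, ← Algebra.smul_def,
        AddMonoidAlgebra.coeff_add, Finsupp.add_apply, AddMonoidAlgebra.coeff_smul,
        AddMonoidAlgebra.coeff_smul, Finsupp.smul_apply, Finsupp.smul_apply, smul_eq_mul,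
        smul_eq_mul, mul_comm ((adTorus π v.1 a).coeff m)]⟩
  map_add' v w := by
    apply Subtype.ext
    ext a
    have h : adTorus π (v + w).1 = adTorus π v.1 + adTorus π w.1 := by
      simp only [adTorus_eq_conjForm]
      rw [← conjForm_add, ← map_add]
      rfl
    change (adTorus π (v + w).1 a).coeff m = (adTorus π v.1 a).coeff m + (adTorus π w.1 a).coeff m
    rw [h]
    rfl
  map_smul' c v := by
    apply Subtype.ext
    ext a
    have h : adTorus π (c • v).1 = c • adTorus π v.1 := by
      simp only [adTorus_eq_conjForm]
      have hs : ∀ w : Form O A (AddMonoidAlgebra O M),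
          c • w = algebraMap O (AddMonoidAlgebra O M) c • w := fun w => by
        apply WithConv.ofConv_injective
        ext1 a
        exact Algebra.smul_def c (w a)
      rw [show (c • v).1 = c • v.1 from rfl, castForm_smul, hs, conjForm_smul, hs]
    change (adTorus π (c • v).1 a).coeff m = c * (adTorus π v.1 a).coeff m
    rw [h]
    rfl

lemma wtComp_apply (m : M) (v : lie O A) (a : A) :
    (wtComp π m v).1 a = (adTorus π v.1 a).coeff m := rfl

lemma mem_weightSpace_iff {m : M} {v : lie O A} : v ∈ weightSpace π m ↔
    adTorus π v.1 = AddMonoidAlgebra.single m (1 : O) • castForm _ v.1 := by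
  have h : ∀ a, (AddMonoidAlgebra.single m (1 : O) • castForm (AddMonoidAlgebra O M) v.1 :
      Form O A _) a = AddMonoidAlgebra.single m (v.1 a) := fun a => by
    change AddMonoidAlgebra.single m (1 : O) * algebraMap O _ (v.1 a) = _
    rw [mul_comm, ← Algebra.smul_def, AddMonoidAlgebra.smul_single, smul_eq_mul, mul_one]
  constructor
  · intro hv
    apply WithConv.ofConv_injective
    ext1 a
    rw [h]
    exact hv a
  · intro hv a
    rw [hv, h]

lemma conjForm_torusPt_of_mem {m : M} {v : lie O A} (hv : v ∈ weightSpace π m)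
    (c : Multiplicative M →* R) :
    conjForm (torusPt π c) (castForm R v.1) = c (Multiplicative.ofAdd m) • castForm R v.1 := by
  rw [← mapForm_lift_adTorus, (mem_weightSpace_iff π).1 hv, mapForm_smul, mapForm_castForm,
    AddMonoidAlgebra.lift_single, one_smul]

lemma wtComp_of_mem {m : M} {v : lie O A} (hv : v ∈ weightSpace π m) (n : M)
    [Decidable (m = n)] : wtComp π n v = if m = n then v else 0 := by
  apply Subtype.ext
  ext a
  rw [wtComp_apply, hv a, AddMonoidAlgebra.coeff_single, Finsupp.single_apply]
  split_ifs with h <;> rfl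

lemma lie_mem_weightSpace {m n : M} {v w : lie O A} (hv : v ∈ weightSpace π m)
    (hw : w ∈ weightSpace π n) : ⁅v, w⁆ ∈ weightSpace π (m + n) := by
  rw [mem_weightSpace_iff] at hv hw ⊢
  rw [adTorus_eq_conjForm] at hv hw ⊢
  rw [lie_val, map_sub, conjForm_sub, map_mul, map_mul, conjForm_mul_form, conjForm_mul_form, hv,
    hw, smul_mul_smul_comm, smul_mul_smul_comm, smul_sub, AddMonoidAlgebra.single_mul_single,
    AddMonoidAlgebra.single_mul_single, add_comm n m, one_mul]

/-- The pull-back of forms along the homomorphism `T → G`. -/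
def pullTorus : Form O (AddMonoidAlgebra O M) R →+* Form O A R where
  toFun v := toConv (v.ofConv ∘ₗ (π : A →ₗ[O] AddMonoidAlgebra O M))
  map_one' := by apply WithConv.ofConv_injective; ext a; simp
  map_mul' v w := by
    apply WithConv.ofConv_injective
    exact LinearMap.convMul_comp_coalgHom_distrib v w (π : A →ₗc[O] AddMonoidAlgebra O M)
  map_zero' := by apply WithConv.ofConv_injective; ext a; simp
  map_add' v w := by apply WithConv.ofConv_injective; ext a; simp

lemma castForm_toral (φ : M →+ O) : castForm R (toral π φ).1 =
    pullTorus π (castForm R (toConv (torusForm φ))) := rfl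

lemma ptForm_torusPt (c : Multiplicative M →* R) : ptForm (torusPt π c) =
    pullTorus π (toConv (AddMonoidAlgebra.lift O R M c).toLinearMap) := rfl

lemma toral_mem_weightSpace (φ : M →+ O) : toral π φ ∈ weightSpace π 0 := by
  have hc : castForm (AddMonoidAlgebra O M) (toral π φ).1 * ptForm (torusPt π (univChar O M)) =
      ptForm (torusPt π (univChar O M)) * castForm (AddMonoidAlgebra O M) (toral π φ).1 := by
    rw [castForm_toral, ptForm_torusPt, ← map_mul, mul_comm, map_mul]
  rw [mem_weightSpace_iff, adTorus_eq_conjForm, conjForm, ← hc, mul_assoc, ptForm_mul_inv, mul_one,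
    ← AddMonoidAlgebra.one_def, one_smul]

/-- The character `m ↦ 1 + φ m ε` of `M` with values in the dual numbers. -/
def dualChar (φ : M →+ O) : Multiplicative M →* DualNumber O where
  toFun m := 1 + TrivSqZeroExt.inr (φ m.toAdd)
  map_one' := by simp
  map_mul' m n := by
    rw [toAdd_mul, map_add, TrivSqZeroExt.inr_add, add_mul, mul_add, mul_add,
      TrivSqZeroExt.inr_mul_inr, one_mul, mul_one, one_mul]
    abel

lemma ptForm_dualChar (φ : M →+ O) : torusPt π (dualChar φ) =
    infinitesimal DualNumber.eps DualNumber.eps_mul_eps (toral π φ) := by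
  apply WithConv.ofConv_injective
  ext1 a
  rw [torusPt_apply]
  change _ = algebraMap O (DualNumber O) (Coalgebra.counit a) +
    DualNumber.eps * algebraMap O (DualNumber O) (torusForm φ (π a))
  have h : Coalgebra.counit (R := O) a = Coalgebra.counit (R := O) (π a) := by simp
  rw [h]
  have hal : ∀ c : O, algebraMap O (DualNumber O) c = TrivSqZeroExt.inl c := fun _ => rfl
  generalize π a = x
  induction x using AddMonoidAlgebra.induction_linear with
  | zero => simp
  | add x y hx hy => simp only [map_add, hx, hy, mul_add]; abel
  | single m c =>
    rw [AddMonoidAlgebra.lift_single, torusForm_single, AddMonoidAlgebra.counit_single]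
    rw [hal, hal]
    ext
    · simp [dualChar]
    · simp [dualChar]

lemma lie_toral_of_mem {m : M} {v : lie O A} (hv : v ∈ weightSpace π m) (φ : M →+ O) :
    ⁅toral π φ, v⁆ = φ m • v := by
  have h := conjForm_torusPt_of_mem π hv (dualChar φ)
  rw [conjForm, ptForm_dualChar, ptForm_infinitesimal, ptForm_infinitesimal_inv] at h
  have h2 : (DualNumber.eps : DualNumber O) • castForm (DualNumber O) (⁅toral π φ, v⁆ : lie O A).1 =
      (DualNumber.eps : DualNumber O) • φ m • castForm (DualNumber O) v.1 := by
    have h3 : dualChar φ (Multiplicative.ofAdd m) • castForm (DualNumber O) v.1 =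
        castForm (DualNumber O) v.1 + (DualNumber.eps : DualNumber O) • φ m •
          castForm (DualNumber O) v.1 := by
      apply WithConv.ofConv_injective
      ext1 a
      change dualChar φ (Multiplicative.ofAdd m) * algebraMap O (DualNumber O) (v.1 a) =
        algebraMap O (DualNumber O) (v.1 a) +
          DualNumber.eps * (φ m • algebraMap O (DualNumber O) (v.1 a))
      ext
      · simp [dualChar]
      · simp [dualChar]
    rw [h3] at h
    rw [lie_val, map_sub, map_mul, map_mul, smul_sub]
    simp only [add_mul, mul_sub, one_mul, mul_one, smul_mul_assoc, mul_smul_comm] at h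
    rw [sub_eq_iff_eq_add, add_assoc, add_right_inj] at h
    rw [sub_eq_iff_eq_add]
    simpa [mul_assoc, smul_smul] using h
  apply Subtype.ext
  apply WithConv.ofConv_injective
  ext1 a
  have h4 := congrArg (fun f : Form O A (DualNumber O) => TrivSqZeroExt.snd (f a)) h2
  change TrivSqZeroExt.snd (DualNumber.eps * algebraMap O (DualNumber O) _) =
    TrivSqZeroExt.snd (DualNumber.eps * (φ m • algebraMap O (DualNumber O) _)) at h4
  change _ = φ m * v.1 a
  have hal : ∀ c : O, algebraMap O (DualNumber O) c = TrivSqZeroExt.inl c := fun _ => rfl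
  rw [hal, hal] at h4
  simpa using h4

end Weights

section Decomposition

variable {O A M R : Type*} [CommRing O] [IsDomain O] [IsPrincipalIdealRing O] [CommRing A]
  [HopfAlgebra O A] [Algebra.FiniteType O A] [AddCommGroup M] [CommRing R] [Algebra O R]
  (π : A →ₐc[O] AddMonoidAlgebra O M)

instance : Module.IsTorsionFree O (AddMonoidAlgebra O M) :=
  Function.Injective.moduleIsTorsionFree AddMonoidAlgebra.coeff AddMonoidAlgebra.coeff_injective
    fun _ _ => rfl

open Classical in
/-- A finite set containing the weights of `v`. -/
def wtSupp (v : lie O A) : Finset M :=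
  Finset.univ.biUnion fun i => (adTorus π v.1 (tanFun O A i)).coeff.support

lemma wtComp_eq_zero {v : lie O A} {m : M} (hm : m ∉ wtSupp π v) : wtComp π m v = 0 := by
  rw [lie_eq_sum (wtComp π m v)]
  refine Finset.sum_eq_zero fun i _ => ?_
  simp only [wtSupp, Finset.mem_biUnion, Finset.mem_univ, true_and, not_exists] at hm
  rw [wtComp_apply, Finsupp.notMem_support_iff.1 (hm i), zero_smul]

lemma adTorus_eq_sum (v : lie O A) {s : Finset M} (hs : wtSupp π v ⊆ s) : adTorus π v.1 =
    ∑ m ∈ s, AddMonoidAlgebra.single m (1 : O) • castForm _ (wtComp π m v).1 := by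
  apply WithConv.ofConv_injective
  ext1 a
  rw [WithConv.ofConv_sum, LinearMap.sum_apply]
  apply AddMonoidAlgebra.coeff_injective
  ext n
  rw [AddMonoidAlgebra.coeff_sum, Finsupp.finsetSum_apply]
  have h : ∀ m : M, ((AddMonoidAlgebra.single m (1 : O) •
      castForm (AddMonoidAlgebra O M) (wtComp π m v).1 : Form O A _).ofConv a).coeff n =
      Finsupp.single m ((wtComp π m v).1 a) n := fun m => by
    change (AddMonoidAlgebra.single m (1 : O) * algebraMap O _ ((wtComp π m v).1 a)).coeff n = _
    rw [mul_comm, ← Algebra.smul_def, AddMonoidAlgebra.smul_single, smul_eq_mul, mul_one]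
    rfl
  rw [Finset.sum_congr rfl fun m _ => h m]
  classical
  simp only [Finsupp.single_apply, Finset.sum_ite_eq']
  split_ifs with hn
  · rfl
  · have := wtComp_eq_zero π (fun h' => hn (hs h') : n ∉ wtSupp π v)
    have h2 := wtComp_apply π n v a
    rw [this] at h2
    exact h2.symm

lemma conjForm_torusPt (c : Multiplicative M →* R) (v : lie O A) {s : Finset M}
    (hs : wtSupp π v ⊆ s) : conjForm (torusPt π c) (castForm R v.1) =
      ∑ m ∈ s, c (Multiplicative.ofAdd m) • castForm R (wtComp π m v).1 := by
  rw [← mapForm_lift_adTorus, adTorus_eq_sum π v hs, map_sum]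
  refine Finset.sum_congr rfl fun m _ => ?_
  rw [mapForm_smul, mapForm_castForm, AddMonoidAlgebra.lift_single, one_smul]

lemma sum_wtComp (v : lie O A) {s : Finset M} (hs : wtSupp π v ⊆ s) :
    ∑ m ∈ s, wtComp π m v = v := by
  have h := conjForm_torusPt π (1 : Multiplicative M →* O) v hs
  rw [map_one, conjForm_one] at h
  apply Subtype.ext
  apply WithConv.ofConv_injective
  ext1 a
  have h2 := congrArg (fun f : Form O A O => f a) h
  simp only [MonoidHom.one_apply, one_smul, castForm_apply, WithConv.ofConv_sum,
    LinearMap.sum_apply, Algebra.algebraMap_self, RingHom.id_apply] at h2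
  rw [h2, AddSubmonoidClass.coe_finsetSum, WithConv.ofConv_sum, LinearMap.sum_apply]

lemma wtComp_wtComp (m n : M) (v : lie O A) [Decidable (m = n)] :
    wtComp π m (wtComp π n v) = if m = n then wtComp π n v else 0 := by
  classical
  -- the points `(t, 1)`, `(1, t')` and `(t, t')` of `T × T`
  let c₁ : Multiplicative M →* AddMonoidAlgebra O (M × M) :=
    (AddMonoidAlgebra.of O (M × M)).comp (AddMonoidHom.inl M M).toMultiplicative
  let c₂ : Multiplicative M →* AddMonoidAlgebra O (M × M) :=
    (AddMonoidAlgebra.of O (M × M)).comp (AddMonoidHom.inr M M).toMultiplicative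
  obtain ⟨s, hs⟩ : ∃ s : Finset M, (wtSupp π v ⊆ s ∧ m ∈ s ∧ n ∈ s) ∧
      ∀ k ∈ wtSupp π v, wtSupp π (wtComp π k v) ⊆ s :=
    ⟨wtSupp π v ∪ {m, n} ∪ (wtSupp π v).biUnion fun k => wtSupp π (wtComp π k v),
      ⟨fun x hx => by simp [hx], by simp, by simp⟩, fun k hk x hx => by
        simp only [Finset.mem_union, Finset.mem_biUnion]
        exact Or.inr ⟨k, hk, hx⟩⟩
  have h1 := conjForm_torusPt π (c₁ * c₂) v hs.1.1
  rw [map_mul, conjForm_mul, conjForm_torusPt π c₂ v hs.1.1, conjForm_sum] at h1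
  have h2 : ∀ k : M, conjForm (torusPt π c₁) (c₂ (Multiplicative.ofAdd k) •
      castForm _ (wtComp π k v).1) = ∑ l ∈ s, AddMonoidAlgebra.single (l, k) (1 : O) •
        castForm _ (wtComp π l (wtComp π k v)).1 := fun k => by
    by_cases hk : k ∈ wtSupp π v
    · rw [conjForm_smul, conjForm_torusPt π c₁ _ (hs.2 k hk), Finset.smul_sum]
      refine Finset.sum_congr rfl fun l _ => ?_
      rw [smul_smul]
      congr 1
      simp [c₁, c₂, AddMonoidAlgebra.single_mul_single]
    · rw [wtComp_eq_zero π hk]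
      simp [conjForm]
  rw [Finset.sum_congr rfl fun k _ => h2 k] at h1
  apply Subtype.ext
  apply WithConv.ofConv_injective
  ext1 a
  have h3 := congrArg (fun f : Form O A (AddMonoidAlgebra O (M × M)) => (f a).coeff (m, n)) h1
  simp only [WithConv.ofConv_sum, LinearMap.sum_apply, AddMonoidAlgebra.coeff_sum,
    Finsupp.finsetSum_apply] at h3
  have h4 : ∀ (x : M × M) (w : lie O A), ((AddMonoidAlgebra.single x (1 : O) •
      castForm (AddMonoidAlgebra O (M × M)) w.1 : Form O A _).ofConv a).coeff (m, n) =
      if x = (m, n) then w.1 a else 0 := fun x w => by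
    change (AddMonoidAlgebra.single x (1 : O) * algebraMap O _ (w.1 a)).coeff (m, n) = _
    rw [mul_comm, ← Algebra.smul_def, AddMonoidAlgebra.smul_single, smul_eq_mul, mul_one,
      AddMonoidAlgebra.coeff_single, Finsupp.single_apply]
  have h5 : ∀ k : M, (c₁ * c₂) (Multiplicative.ofAdd k) =
      AddMonoidAlgebra.single (k, k) (1 : O) := fun k => by
    simp [c₁, c₂, AddMonoidAlgebra.single_mul_single]
  simp only [h5, h4, Prod.mk.injEq] at h3
  rw [Finset.sum_eq_single n (fun k _ hk => Finset.sum_eq_zero fun l _ =>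
    if_neg fun h => hk h.2) (fun h => absurd hs.1.2.2 h),
    Finset.sum_eq_single m (fun k _ hk => if_neg fun h => hk h.1)
      (fun h => absurd hs.1.2.1 h), if_pos ⟨rfl, rfl⟩] at h3
  rw [h3]
  split_ifs with hmn
  · subst hmn
    rw [Finset.sum_eq_single m (fun k _ hk => if_neg fun h => hk h.1)
      (fun h => absurd hs.1.2.1 h), if_pos ⟨rfl, rfl⟩]
  · rw [Finset.sum_eq_zero fun k _ => if_neg fun h => hmn (h.1.symm.trans h.2)]
    rfl

lemma mem_weightSpace_of_wtComp {m : M} {v : lie O A} (h : ∀ n, n ≠ m → wtComp π n v = 0) :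
    v ∈ weightSpace π m := by
  classical
  have hs : wtSupp π v ⊆ insert m (wtSupp π v) := Finset.subset_insert _ _
  have h1 : wtComp π m v = v := by
    have := sum_wtComp π v hs
    rwa [Finset.sum_eq_single m (fun k _ hk => h k hk) (fun h => absurd (by simp) h)] at this
  rw [mem_weightSpace_iff, adTorus_eq_sum π v hs,
    Finset.sum_eq_single m (fun k _ hk => by rw [h k hk]; simp) (fun h => absurd (by simp) h), h1]

lemma wtComp_mem (m : M) (v : lie O A) : wtComp π m v ∈ weightSpace π m := by
  classical
  refine mem_weightSpace_of_wtComp π fun n hn => ?_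
  rw [wtComp_wtComp, if_neg hn]

lemma isInternal_weightSpace [DecidableEq M] : DirectSum.IsInternal (weightSpace (A := A) π) := by
  rw [DirectSum.isInternal_submodule_iff_iSupIndep_and_iSup_eq_top]
  constructor
  · rw [iSupIndep_def]
    intro m
    rw [Submodule.disjoint_def]
    intro v hv hv'
    have h1 : wtComp π m v = v := by rw [wtComp_of_mem π hv, if_pos rfl]
    have h2 : (⨆ (j : M) (_ : j ≠ m), weightSpace (A := A) π j) ≤ LinearMap.ker (wtComp π m) := by
      refine iSup₂_le fun j hj w hw => ?_
      rw [LinearMap.mem_ker, wtComp_of_mem π hw, if_neg hj]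
    rw [← h1]
    exact h2 hv'
  · rw [eq_top_iff]
    rintro v -
    rw [← sum_wtComp π v subset_rfl]
    exact Submodule.sum_mem _ fun m _ => Submodule.mem_iSup_of_mem m (wtComp_mem π m v)

lemma finite_weights : {m | weightSpace (A := A) π m ≠ ⊥}.Finite := by
  classical
  exact WellFoundedGT.finite_ne_bot_of_iSupIndep
    (isInternal_weightSpace (A := A) π).submodule_iSupIndep

lemma finite_roots : (roots (A := A) π).Finite := (finite_weights π).subset fun _ h => h.2

end Decomposition

end GroupScheme

/-! ### Root strings and the Killing form -/

namespace GroupScheme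

section Roots

variable {O A M : Type*} [CommRing O] [IsDomain O] [IsPrincipalIdealRing O] [CommRing A]
  [HopfAlgebra O A] [Algebra.FiniteType O A] [AddCommGroup M]
  (π : A →ₐc[O] AddMonoidAlgebra O M)

lemma killingForm_eq_zero_of_add_ne_zero {m n : M} (hmn : m + n ≠ 0) {v w : lie O A}
    (hv : v ∈ weightSpace π m) (hw : w ∈ weightSpace π n) : killingForm O (lie O A) v w = 0 := by
  classical
  rw [LieModule.traceForm_apply_apply]
  refine LinearMap.trace_eq_zero_of_mapsTo_ne (isInternal_weightSpace π) (fun i => m + (n + i))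
    (fun i h => hmn ?_) fun i u hu => ?_
  · rw [← add_assoc] at h
    simpa using h
  · exact lie_mem_weightSpace π hv (lie_mem_weightSpace π hw hu)

variable {π} {Δ : Set M} (C : ChevalleyBasis π Δ)
include C

namespace ChevalleyBasis

omit [IsPrincipalIdealRing O] [Algebra.FiniteType O A] in
lemma X_ne_zero (α : roots π) : C.X α ≠ 0 := C.linearIndependent.ne_zero (Sum.inr α)

omit [IsDomain O] [IsPrincipalIdealRing O] [Algebra.FiniteType O A] in
lemma X_mem_weightSpace (α : roots π) : C.X α ∈ weightSpace π α := by
  rw [← C.span_X]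
  exact Submodule.mem_span_singleton_self _

omit [IsDomain O] [IsPrincipalIdealRing O] [Algebra.FiniteType O A] in
lemma exists_eq_smul_X (α : roots π) {v : lie O A} (hv : v ∈ weightSpace π α) :
    ∃ c : O, c • C.X α = v := by
  rwa [← C.span_X, Submodule.mem_span_singleton] at hv

omit C [IsDomain O] [IsPrincipalIdealRing O] [Algebra.FiniteType O A] in
lemma eq_zero_of_mem_weightSpace {m : M} (h0 : m ≠ 0) (hm : m ∉ roots π) {v : lie O A}
    (hv : v ∈ weightSpace π m) : v = 0 := by
  by_contra h
  exact hm ⟨h0, fun h' => h (by rwa [h', Submodule.mem_bot] at hv)⟩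

omit [IsDomain O] [IsPrincipalIdealRing O] [Algebra.FiniteType O A] in
lemma ne_zero (α : roots π) : (α : M) ≠ 0 := α.2.1

variable [CharZero O]

omit [IsDomain O] [IsPrincipalIdealRing O] [Algebra.FiniteType O A] in
lemma h_apply_ne_zero (α : roots π) : C.h α α ≠ 0 := by
  rw [C.h_self]; exact two_ne_zero

omit [IsPrincipalIdealRing O] [Algebra.FiniteType O A] in
lemma not_add_self_mem (α : roots π) : (α : M) + α ∉ roots π := fun h => by
  obtain ⟨h1, h2⟩ := C.lie_X_X α α ⟨_, h⟩ rfl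
  rw [lie_self, eq_comm, ← Int.cast_smul_eq_zsmul O, smul_eq_zero] at h1
  exact h1.elim (fun h => h2 (by exact_mod_cast h)) (C.X_ne_zero _)

omit [IsPrincipalIdealRing O] [Algebra.FiniteType O A] in
lemma toral_ne_zero (α : roots π) : toral π (C.h α) ≠ 0 := fun h => by
  have h1 := C.lie_H_X α α
  rw [h, zero_lie, eq_comm, smul_eq_zero] at h1
  exact h1.elim (C.h_apply_ne_zero α) (C.X_ne_zero α)

omit [IsPrincipalIdealRing O] [Algebra.FiniteType O A] in
lemma isSl2Triple {α α' : roots π} (h : (α' : M) = -α) :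
    IsSl2Triple (-toral π (C.h α)) (C.X α') (C.X α) where
  h_ne_zero := by simpa using C.toral_ne_zero α
  lie_e_f := by rw [← lie_skew, C.lie_X_neg α α' h]
  lie_h_e_nsmul := by
    rw [neg_lie, C.lie_H_X, h, map_neg, C.h_self, neg_smul, neg_neg, two_smul, two_nsmul]
  lie_h_f_nsmul := by
    rw [neg_lie, C.lie_H_X, C.h_self, two_smul, two_nsmul]

/-- If `α` has a positive pairing with the coroot of `β`, then `α - β` is a root: otherwise
`X α` would be a primitive vector with a negative weight for the triple `(X (-β), X β)`. -/
lemma sub_mem_roots {α β β' : roots π} (hβ : (β' : M) = -β) (hne : α ≠ β) {n : ℤ}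
    (hn : C.h β α = n) (hpos : 0 < n) : (α : M) - β ∈ roots π := by
  by_contra hnot
  have h0 : (α : M) + β' ≠ 0 := by
    rw [hβ, ← sub_eq_add_neg, sub_ne_zero]
    exact fun h => hne (Subtype.ext h)
  have hP : (C.isSl2Triple hβ).HasPrimitiveVectorWith (C.X α) (-(n : O)) :=
    { ne_zero := C.X_ne_zero α
      lie_h := by rw [neg_lie, C.lie_H_X, hn, neg_smul]
      lie_e := by
        rw [← lie_skew, C.lie_X_X_zero α β' h0 (by rwa [hβ, ← sub_eq_add_neg]), neg_zero] }
  obtain ⟨k, hk⟩ := hP.exists_nat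
  have h2 : (-n : ℤ) = k := by exact_mod_cast hk
  omega

lemma killingForm_toral (y z : M →+ O) : killingForm O (lie O A) (toral π y) (toral π z) =
    ∑ α ∈ (finite_roots (A := A) π).toFinset, y α * z α := by
  classical
  have hf : ∀ m : M, ∀ u ∈ weightSpace (A := A) π m,
      (LieModule.toEnd O (lie O A) (lie O A) (toral π y) ∘ₗ
        LieModule.toEnd O (lie O A) (lie O A) (toral π z)) u = (y m * z m) • u := by
    intro m u hu
    change ⁅toral π y, ⁅toral π z, u⁆⁆ = _
    rw [lie_toral_of_mem π hu, lie_smul, lie_toral_of_mem π hu, smul_smul, mul_comm]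
  rw [LieModule.traceForm_apply_apply, LinearMap.trace_eq_sum_trace_restrict'
    (isInternal_weightSpace π) (finite_weights π) (fun m u hu => by
      rw [SetLike.mem_coe, hf m u hu]
      exact Submodule.smul_mem _ _ hu)]
  have h1 : ∀ (m : M) (h : _), LinearMap.trace O (weightSpace (A := A) π m)
      ((LieModule.toEnd O (lie O A) (lie O A) (toral π y) ∘ₗ
        LieModule.toEnd O (lie O A) (lie O A) (toral π z)).restrict
        (p := weightSpace (A := A) π m) (q := weightSpace (A := A) π m) h) =
      (y m * z m) * Module.finrank O (weightSpace (A := A) π m) := by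
    intro m h
    have h2 : (LieModule.toEnd O (lie O A) (lie O A) (toral π y) ∘ₗ
        LieModule.toEnd O (lie O A) (lie O A) (toral π z)).restrict
        (p := weightSpace (A := A) π m) (q := weightSpace (A := A) π m) h =
        (y m * z m) • LinearMap.id := by
      ext u
      exact congrArg (fun x : lie O A => x.1 _) (hf m u.1 u.2)
    rw [h2, map_smul, LinearMap.trace_id, smul_eq_mul]
  rw [Finset.sum_congr rfl fun m _ => h1 m _]
  symm
  refine Finset.sum_subset_zero_on_sdiff (fun m hm => ?_) (fun m hm => ?_) fun m hm => ?_
  · rw [Set.Finite.mem_toFinset] at hm ⊢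
    exact hm.2
  · simp only [Finset.mem_sdiff, Set.Finite.mem_toFinset] at hm
    have : m = 0 := by
      by_contra h0
      exact hm.2 ⟨h0, hm.1⟩
    rw [this, map_zero, zero_mul, zero_mul]
  · rw [Set.Finite.mem_toFinset] at hm
    have h3 : Module.finrank O (weightSpace (A := A) π m) = 1 := by
      rw [← C.span_X ⟨m, hm⟩, ← (LinearEquiv.toSpanNonzeroSingleton O _ _
        (C.X_ne_zero ⟨m, hm⟩)).finrank_eq, Module.finrank_self]
    rw [h3, Nat.cast_one, mul_one]

lemma sum_h_mul {β β' : roots π} (hβ : (β' : M) = -β) (z : M →+ O) :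
    ∑ α ∈ (finite_roots (A := A) π).toFinset, C.h β α * z α =
      z β * killingForm O (lie O A) (C.X β) (C.X β') := by
  rw [← C.killingForm_toral, ← C.lie_X_neg β β' hβ, LieModule.traceForm_apply_lie_apply,
    ← lie_skew, map_neg, lie_toral_of_mem π (C.X_mem_weightSpace β'), map_smul, hβ, map_neg,
    smul_eq_mul]
  ring

/-- Up to the factor `∑ α, α(H β)² / 2`, the coroot `H β` represents `β` for the trace form
`∑ α, α(H) α(H')` on the torus. -/
lemma two_mul_sum {β β' : roots π} (hβ : (β' : M) = -β) (y : M →+ O) :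
    2 * ∑ α ∈ (finite_roots (A := A) π).toFinset, C.h β α * y α =
      (∑ α ∈ (finite_roots (A := A) π).toFinset, C.h β α ^ 2) * y β := by
  simp only [pow_two]
  rw [C.sum_h_mul hβ, C.sum_h_mul hβ, C.h_self]
  ring

omit [IsDomain O] [IsPrincipalIdealRing O] [Algebra.FiniteType O A] in
lemma sum_sq_ne_zero (α : roots π) (s : Finset M) (hα : (α : M) ∈ s)
    (hs : ∀ β ∈ s, β ∈ roots π) : ∑ β ∈ s, C.h α β ^ 2 ≠ 0 := by
  choose n hn using fun β : roots π => C.h_int β α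
  have h1 : ∑ β ∈ s, C.h α β ^ 2 = ((∑ β ∈ s.attach, n ⟨β, hs β β.2⟩ ^ 2 : ℤ) : O) := by
    rw [← Finset.sum_attach]
    push_cast
    exact Finset.sum_congr rfl fun β _ => by rw [← hn ⟨β, hs β β.2⟩]
  have h2 : n α = 2 := by
    have := hn α
    rw [C.h_self] at this
    exact_mod_cast this.symm
  have h3 : 0 < ∑ β ∈ s.attach, n ⟨β, hs β β.2⟩ ^ 2 := by
    refine Finset.sum_pos' (fun _ _ => sq_nonneg _) ⟨⟨α, hα⟩, Finset.mem_attach _ _, ?_⟩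
    change 0 < n α ^ 2
    rw [h2]; norm_num
  rw [h1]
  exact_mod_cast h3.ne'

lemma killingForm_X_ne_zero {β β' : roots π} (hβ : (β' : M) = -β) :
    killingForm O (lie O A) (C.X β) (C.X β') ≠ 0 := fun h => by
  refine C.sum_sq_ne_zero β (finite_roots (A := A) π).toFinset (by simp) (by simp) ?_
  simp only [pow_two]
  rw [C.sum_h_mul hβ, h, mul_zero]

end ChevalleyBasis

end Roots

end GroupScheme

/-! ### The trace form after extension of scalars -/

namespace GroupScheme

section TraceForm

variable {O A R : Type*} [CommRing O] [CommRing A] [HopfAlgebra O A] [CommRing R] [Algebra O R]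

/-- The commutator of forms, `adForm v w = v * w - w * v`. -/
def adForm : Form O A R →ₗ[R] Module.End R (Form O A R) :=
  LinearMap.mul R (Form O A R) - (LinearMap.mul R (Form O A R)).flip

lemma adForm_apply (v w : Form O A R) : adForm v w = v * w - w * v := rfl

lemma IsDer.adForm {v w : Form O A R} (hv : IsDer v) (hw : IsDer w) : IsDer (adForm v w) :=
  hv.lie hw

lemma adForm_castForm (v w : lie O A) :
    adForm (castForm R v.1) (castForm R w.1) = castForm R (⁅v, w⁆ : lie O A).1 := by
  rw [lie_val, map_sub, map_mul, map_mul, adForm_apply]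

lemma conjForm_adForm (x : Pts O A R) (v w : Form O A R) :
    conjForm x (adForm v w) = adForm (conjForm x v) (conjForm x w) := by
  simp only [adForm_apply, conjForm_sub, conjForm_mul_form]

lemma conjForm_inv_conjForm (x : Pts O A R) (v : Form O A R) : conjForm x⁻¹ (conjForm x v) = v := by
  rw [← conjForm_mul, inv_mul_cancel, conjForm_one]

lemma conjForm_conjForm_inv (x : Pts O A R) (v : Form O A R) : conjForm x (conjForm x⁻¹ v) = v := by
  rw [← conjForm_mul, mul_inv_cancel, conjForm_one]

variable [IsDomain O] [IsPrincipalIdealRing O] [Algebra.FiniteType O A]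

variable (O A R) in
/-- The trace of an operator on the space of derivations at the identity. -/
def derTrace : Module.End R (Form O A R) →ₗ[R] R where
  toFun F := ∑ i, F (castForm R (tanVec O A i).1) (tanFun O A i)
  map_add' F G := by rw [← Finset.sum_add_distrib]; rfl
  map_smul' c F := by rw [RingHom.id_apply, smul_eq_mul, Finset.mul_sum]; rfl

lemma derTrace_mul_comm [Module.IsTorsionFree O R] {F G : Module.End R (Form O A R)}
    (hF : ∀ v, IsDer v → IsDer (F v)) (hG : ∀ v, IsDer v → IsDer (G v)) :
    derTrace O A R (F * G) = derTrace O A R (G * F) := by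
  have h : ∀ F G : Module.End R (Form O A R), (∀ v, IsDer v → IsDer (G v)) →
      derTrace O A R (F * G) = ∑ i, ∑ j, G (castForm R (tanVec O A i).1) (tanFun O A j) *
        F (castForm R (tanVec O A j).1) (tanFun O A i) := by
    intro F G hG
    refine Finset.sum_congr rfl fun i _ => ?_
    rw [Module.End.mul_apply]
    conv_lhs => rw [(hG _ (isDer_castForm (tanVec O A i))).eq_sum]
    rw [map_sum, WithConv.ofConv_sum, LinearMap.sum_apply]
    refine Finset.sum_congr rfl fun j _ => ?_
    rw [map_smul]
    rfl
  rw [h F G hG, h G F hF, Finset.sum_comm]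
  simp only [mul_comm]

/-- The Killing form of `R ⊗ 𝔤`. -/
def kil (v w : Form O A R) : R := derTrace O A R (adForm v * adForm w)

lemma kil_add_left (v v' w : Form O A R) : kil (v + v') w = kil v w + kil v' w := by
  simp only [kil, map_add, add_mul]

lemma kil_smul_left (c : R) (v w : Form O A R) : kil (c • v) w = c * kil v w := by
  simp only [kil, map_smul, smul_mul_assoc, smul_eq_mul]

lemma kil_sum_left {ι : Type*} (s : Finset ι) (v : ι → Form O A R) (w : Form O A R) :
    kil (∑ i ∈ s, v i) w = ∑ i ∈ s, kil (v i) w := by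
  simp only [kil, map_sum, Finset.sum_mul]

lemma kil_castForm (v w : lie O A) :
    kil (castForm R v.1) (castForm R w.1) = algebraMap O R (killingForm O (lie O A) v w) := by
  classical
  let e : lie O A ≃ₗ[O] (TanIdx O A → O) :=
    { toFun := fun v i => v.1 (tanFun O A i)
      map_add' := fun _ _ => rfl
      map_smul' := fun _ _ => rfl
      invFun := fun c => ∑ i, c i • tanVec O A i
      left_inv := fun v => (lie_eq_sum v).symm
      right_inv := fun c => by
        funext j
        change (∑ i, c i • tanVec O A i : lie O A).1 (tanFun O A j) = c j
        rw [AddSubmonoidClass.coe_finsetSum, WithConv.ofConv_sum, LinearMap.sum_apply,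
          Finset.sum_eq_single j]
        · change c j * (tanVec O A j).1 (tanFun O A j) = _
          rw [tanVec_tanFun, if_pos rfl, mul_one]
        · intro i _ hij
          change c i * (tanVec O A i).1 (tanFun O A j) = _
          rw [tanVec_tanFun, if_neg hij, mul_zero]
        · simp }
  have he : ∀ i, Module.Basis.ofEquivFun e i = tanVec O A i := fun i => by
    rw [Module.Basis.coe_ofEquivFun]
    change ∑ j, (Pi.single i 1 : TanIdx O A → O) j • tanVec O A j = _
    simp [Pi.single_apply]
  rw [LieModule.traceForm_apply_apply,
    LinearMap.trace_eq_matrix_trace O (Module.Basis.ofEquivFun e),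
    Matrix.trace, map_sum]
  refine Finset.sum_congr rfl fun i _ => ?_
  rw [Matrix.diag_apply, LinearMap.toMatrix_apply, he, Module.End.mul_apply, adForm_castForm,
    adForm_castForm]
  rfl

variable [Module.IsTorsionFree O R]

lemma kil_conjForm (x : Pts O A R) {v w : Form O A R} (hv : IsDer v) (hw : IsDer w) :
    kil (conjForm x v) (conjForm x w) = kil v w := by
  let c : Pts O A R → Module.End R (Form O A R) := fun x =>
    { toFun := conjForm x
      map_add' := conjForm_add x
      map_smul' := conjForm_smul x }
  have h1 : adForm (conjForm x v) * adForm (conjForm x w) =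
      c x * (adForm v * adForm w * c x⁻¹) := by
    ext1 u
    change adForm (conjForm x v) (adForm (conjForm x w) u) =
      conjForm x (adForm v (adForm w (conjForm x⁻¹ u)))
    rw [conjForm_adForm, conjForm_adForm, conjForm_conjForm_inv]
  have h2 : adForm v * adForm w * c x⁻¹ * c x = adForm v * adForm w := by
    ext1 u
    change adForm v (adForm w (conjForm x⁻¹ (conjForm x u))) = _
    rw [conjForm_inv_conjForm]
    rfl
  rw [kil, h1, derTrace_mul_comm (F := c x) (G := adForm v * adForm w * c x⁻¹)
    (fun u hu => hu.conj x) (fun u hu => hv.adForm (hw.adForm (hu.conj x⁻¹))), h2, kil]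

lemma kil_adForm {z v w : Form O A R} (hz : IsDer z) (hv : IsDer v) (hw : IsDer w) :
    kil (adForm z v) w = -kil v (adForm z w) := by
  have h : ∀ a b : Form O A R, adForm (adForm a b) = adForm a * adForm b - adForm b * adForm a := by
    intro a b
    ext1 u
    simp only [LinearMap.sub_apply, Module.End.mul_apply, adForm_apply, mul_sub, sub_mul, mul_assoc]
    abel
  rw [kil, kil, h, h, sub_mul, mul_sub, map_sub, map_sub, mul_assoc,
    derTrace_mul_comm (F := adForm z) (G := adForm v * adForm w) (fun u hu => hz.adForm hu)
      (fun u hu => hv.adForm (hw.adForm hu)), neg_sub]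
  simp only [mul_assoc]

end TraceForm

end GroupScheme

/-! ### The abelian ideal attached to an asymmetric root system -/

namespace GroupScheme

section CastSpan

variable {O A M R : Type*} [CommRing O] [CommRing A] [HopfAlgebra O A] [CommRing R] [Algebra O R]

variable (R) in
/-- The `R`-span of a subset of `𝔤`. -/
def castSpan (W : Set (lie O A)) : Submodule R (Form O A R) :=
  Submodule.span R ((fun v : lie O A => castForm R v.1) '' W)

lemma castForm_mem_castSpan {W : Set (lie O A)} {v : lie O A} (hv : v ∈ W) :
    castForm R v.1 ∈ castSpan R W := Submodule.subset_span ⟨v, hv, rfl⟩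

lemma castSpan_le {W : Set (lie O A)} {T : Submodule R (Form O A R)} :
    castSpan R W ≤ T ↔ ∀ v ∈ W, castForm R v.1 ∈ T := by
  rw [castSpan, Submodule.span_le]
  exact Set.forall_mem_image

lemma castSpan_mono {W W' : Set (lie O A)} (h : W ⊆ W') : castSpan R W ≤ castSpan R W' :=
  castSpan_le.2 fun _ hv => castForm_mem_castSpan (h hv)

lemma castForm_smul' (c : O) (v : Dist O A) :
    castForm R (c • v) = algebraMap O R c • castForm R v := by
  apply WithConv.ofConv_injective
  ext1 a
  exact map_mul (algebraMap O R) c (v a)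

lemma castForm_mem_of_smul {c : O} (hc : IsUnit (algebraMap O R c)) {v : lie O A}
    {T : Submodule R (Form O A R)} (h : castForm R (c • v : lie O A).1 ∈ T) :
    castForm R v.1 ∈ T := by
  obtain ⟨u, hu⟩ := hc
  have h1 : castForm R v.1 = (↑u⁻¹ : R) • castForm R (c • v : lie O A).1 := by
    apply WithConv.ofConv_injective
    ext1 a
    change algebraMap O R (v.1 a) = ↑u⁻¹ * algebraMap O R (c * v.1 a)
    rw [map_mul, ← hu, Units.inv_mul_cancel_left]
  rw [h1]
  exact T.smul_mem _ h

lemma conjForm_mem_of_smul {x : Pts O A R} {c : O} (hc : IsUnit (algebraMap O R c)) {v : lie O A}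
    {T : Submodule R (Form O A R)} (h : conjForm x (castForm R (c • v : lie O A).1) ∈ T) :
    conjForm x (castForm R v.1) ∈ T :=
  castForm_mem_of_smul (T := T.comap ({ toFun := conjForm x
                                        map_add' := conjForm_add x
                                        map_smul' := conjForm_smul x } :
    Form O A R →ₗ[R] Form O A R)) hc h

lemma adForm_mem_of_forall {W W' : Set (lie O A)} {T : Submodule R (Form O A R)}
    (h : ∀ z ∈ W, ∀ w ∈ W', castForm R (⁅z, w⁆ : lie O A).1 ∈ T) {z v : Form O A R}
    (hz : z ∈ castSpan R W) (hv : v ∈ castSpan R W') : adForm z v ∈ T := by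
  have h1 : castSpan R W ≤ T.comap ((adForm (O := O) (A := A)).flip v) := by
    refine castSpan_le.2 fun z hz => ?_
    have h2 : castSpan R W' ≤ T.comap (adForm (castForm R z.1)) := by
      refine castSpan_le.2 fun w hw => ?_
      rw [Submodule.mem_comap, adForm_castForm]
      exact h z hz w hw
    exact h2 hv
  exact h1 hz

lemma kil_eq_zero_of_mem_castSpan [IsDomain O] [IsPrincipalIdealRing O] [Algebra.FiniteType O A]
    {W : Set (lie O A)} {w : Form O A R} (h : ∀ u ∈ W, kil (castForm R u.1) w = 0)
    {v : Form O A R} (hv : v ∈ castSpan R W) : kil v w = 0 := by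
  have h1 : castSpan R W ≤ LinearMap.ker
      ({ toFun := fun v => kil v w
         map_add' := fun v v' => kil_add_left v v' w
         map_smul' := fun c v => kil_smul_left c v w } : Form O A R →ₗ[R] R) := castSpan_le.2 h
  exact h1 hv

end CastSpan

namespace ChevalleyBasis

variable {O A M : Type*} [CommRing O] [IsDomain O] [IsPrincipalIdealRing O] [CharZero O]
  [CommRing A] [HopfAlgebra O A] [Algebra.FiniteType O A] [AddCommGroup M]
  {π : A →ₐc[O] AddMonoidAlgebra O M} {Δ : Set M} (C : ChevalleyBasis π Δ)

include C in
omit [IsPrincipalIdealRing O] [Algebra.FiniteType O A] in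
/-- The weight zero part of the Lie algebra is nilpotent of class two: brackets lie in the derived
Lie algebra, a multiple of such a bracket of weight zero is toral, and toral elements commute with
everything of weight zero. -/
lemma lie_lie_weightSpace_zero {u v w : lie O A} (hu : u ∈ weightSpace π 0)
    (hv : v ∈ weightSpace π 0) (hw : w ∈ weightSpace π 0) : ⁅u, ⁅v, w⁆⁆ = 0 := by
  classical
  obtain ⟨n, hn, h⟩ := C.span_der _ (lie_mem_lieDer v w)
  have hle : Submodule.span O (Set.range (Sum.elim
      (fun β : {β : roots π // (β : M) ∈ Δ} => toral π (C.h β)) C.X)) ≤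
      LinearMap.ker (LieModule.toEnd O (lie O A) (lie O A) u ∘ₗ wtComp π 0) := by
    rw [Submodule.span_le]
    rintro _ ⟨β | α, rfl⟩
    · change ⁅u, wtComp π 0 (toral π (C.h β))⁆ = 0
      rw [wtComp_of_mem π (toral_mem_weightSpace π _), if_pos rfl, ← lie_skew,
        lie_toral_of_mem π hu, map_zero, zero_smul, neg_zero]
    · change ⁅u, wtComp π 0 (C.X α)⁆ = 0
      rw [wtComp_of_mem π (C.X_mem_weightSpace α), if_neg (C.ne_zero α), lie_zero]
  have h0 : ⁅v, w⁆ ∈ weightSpace π 0 := by simpa using lie_mem_weightSpace π hv hw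
  have h1 := hle h
  rw [LinearMap.mem_ker, LinearMap.comp_apply, map_zsmul, wtComp_of_mem π h0, if_pos rfl,
    map_zsmul, ← Int.cast_smul_eq_zsmul O, smul_eq_zero] at h1
  exact h1.resolve_left (by exact_mod_cast hn)

variable (π) in
omit [IsDomain O] [IsPrincipalIdealRing O] [CharZero O] [Algebra.FiniteType O A] in
/-- The roots whose negative is not a root. -/
def asymRoots : Set (roots (A := A) π) := {α | -(α : M) ∉ roots (A := A) π}

/-- The span of the asymmetric root spaces is stable under brackets with weight vectors. -/
lemma lie_X_mem_of_asym {m : M} {z : lie O A} (hz : z ∈ weightSpace π m) {γ : roots π}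
    (hγ : γ ∈ asymRoots π) : ⁅z, C.X γ⁆ = 0 ∨
      ∃ δ ∈ asymRoots π, (δ : M) = m + γ ∧ ∃ c : O, c • C.X δ = ⁅z, C.X γ⁆ := by
  have h1 := lie_mem_weightSpace π hz (C.X_mem_weightSpace γ)
  by_cases h0 : m + γ = 0
  · left
    have hm : m = -γ := eq_neg_of_add_eq_zero_left h0
    rw [eq_zero_of_mem_weightSpace (by rw [hm]; simpa using C.ne_zero γ) (by rw [hm]; exact hγ) hz,
      zero_lie]
  by_cases hr : m + γ ∈ roots (A := A) π
  swap
  · exact Or.inl (eq_zero_of_mem_weightSpace h0 hr h1)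
  obtain ⟨c, hc⟩ := C.exists_eq_smul_X ⟨_, hr⟩ h1
  by_cases hδ : -(m + γ) ∈ roots (A := A) π
  swap
  · exact Or.inr ⟨⟨_, hr⟩, hδ, rfl, c, hc⟩
  left
  have h2 : ⁅z, C.X ⟨_, hδ⟩⁆ = 0 := by
    have h3 := lie_mem_weightSpace π hz (C.X_mem_weightSpace ⟨_, hδ⟩)
    have h4 : m + -(m + γ) = -γ := by abel
    rw [h4] at h3
    exact eq_zero_of_mem_weightSpace (by simpa using C.ne_zero γ) hγ h3
  have h5 : killingForm O (lie O A) ⁅z, C.X γ⁆ (C.X ⟨_, hδ⟩) = 0 := by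
    rw [← lie_skew, map_neg, LinearMap.neg_apply, LieModule.traceForm_apply_lie_apply, h2, map_zero,
      neg_zero]
  rw [← hc, map_smul, LinearMap.smul_apply, smul_eq_mul, mul_eq_zero] at h5
  rw [← hc, h5.resolve_right (C.killingForm_X_ne_zero rfl), zero_smul]

omit [CharZero O] in
lemma killingForm_X_of_asym {γ : roots π} (hγ : γ ∈ asymRoots π) (w : lie O A) :
    killingForm O (lie O A) (C.X γ) w = 0 := by
  rw [← sum_wtComp π w subset_rfl, map_sum]
  refine Finset.sum_eq_zero fun m _ => ?_
  by_cases h0 : (γ : M) + m = 0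
  · have hm : m = -γ := by rw [add_comm] at h0; exact eq_neg_of_add_eq_zero_left h0
    rw [eq_zero_of_mem_weightSpace (by rw [hm]; simpa using C.ne_zero γ) (by rw [hm]; exact hγ)
      (wtComp_mem π m w), map_zero]
  · exact killingForm_eq_zero_of_add_ne_zero π h0 (C.X_mem_weightSpace γ) (wtComp_mem π m w)

omit [IsDomain O] [IsPrincipalIdealRing O] [CharZero O] [Algebra.FiniteType O A] in
variable (π) in
/-- The roots occurring in the derived series of the ideal spanned by the asymmetric root
spaces. -/
def derRoots : ℕ → Set (roots (A := A) π)
  | 0 => asymRoots π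
  | k + 1 => {γ | ∃ α ∈ derRoots k, ∃ β ∈ derRoots k, (γ : M) = α + β}

include C in
lemma derRoots_subset (k : ℕ) : derRoots (A := A) π k ⊆ asymRoots π := by
  induction k with
  | zero => exact subset_rfl
  | succ k ih =>
    rintro γ ⟨α, hα, β, hβ, h⟩
    obtain ⟨h1, h2⟩ := C.lie_X_X α β γ h
    rcases C.lie_X_mem_of_asym (C.X_mem_weightSpace α) (ih hβ) with h3 | ⟨δ, hδ, h4, -⟩
    · rw [h3, eq_comm, ← Int.cast_smul_eq_zsmul O, smul_eq_zero] at h1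
      exact (h1.elim (fun h => h2 (by exact_mod_cast h)) (C.X_ne_zero γ)).elim
    · rwa [Subtype.ext (h.trans h4.symm)]

/-- The asymmetric root vectors are orthogonal to everything for the Killing form, hence lie in the
radical, so that `derRoots` is eventually empty. -/
lemma exists_smul_X_mem_derivedSeries (k : ℕ) : ∀ γ ∈ derRoots (A := A) π k, ∃ c : O, c ≠ 0 ∧
    c • C.X γ ∈ LieAlgebra.derivedSeriesOfIdeal O (lie O A) k
      (LieAlgebra.radical O (lie O A)) := by
  induction k with
  | zero =>
    intro γ hγ
    refine ⟨1, one_ne_zero, ?_⟩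
    rw [one_smul, LieAlgebra.derivedSeriesOfIdeal_zero]
    refine LieAlgebra.killingCompl_top_le_radical O (lie O A) ?_
    rw [LieIdeal.mem_killingCompl]
    intro y _
    rw [LieModule.traceForm_comm]
    exact C.killingForm_X_of_asym hγ y
  | succ k ih =>
    rintro γ ⟨α, hα, β, hβ, h⟩
    obtain ⟨c, hc, hc'⟩ := ih α hα
    obtain ⟨d, hd, hd'⟩ := ih β hβ
    obtain ⟨h1, h2⟩ := C.lie_X_X α β γ h
    refine ⟨c * d * (C.N α β : O), mul_ne_zero (mul_ne_zero hc hd) (by exact_mod_cast h2), ?_⟩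
    rw [LieAlgebra.derivedSeriesOfIdeal_succ]
    have h3 : (c * d * (C.N α β : O)) • C.X γ = ⁅c • C.X α, d • C.X β⁆ := by
      rw [smul_lie, lie_smul, h1, ← Int.cast_smul_eq_zsmul O, smul_smul, smul_smul, mul_assoc]
    rw [h3]
    exact LieSubmodule.lie_mem_lie hc' hd'

include C in
lemma exists_derRoots_eq_empty : ∃ k, derRoots (A := A) π k = ∅ := by
  obtain ⟨k, hk⟩ := (LieAlgebra.isSolvable_iff O
    (LieAlgebra.radical O (lie O A))).1 inferInstance
  rw [LieIdeal.derivedSeries_eq_bot_iff] at hk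
  refine ⟨k, Set.eq_empty_of_forall_notMem fun γ hγ => ?_⟩
  obtain ⟨c, hc, hc'⟩ := C.exists_smul_X_mem_derivedSeries k γ hγ
  rw [hk, LieSubmodule.mem_bot, smul_eq_zero] at hc'
  exact hc'.elim hc (C.X_ne_zero γ)

section Scalars

variable {R : Type*} [CommRing R] [Algebra O R] (hR : ∀ c : O, c ≠ 0 → IsUnit (algebraMap O R c))
include hR

variable (O) in
omit [IsPrincipalIdealRing O] [CharZero O] in
lemma isTorsionFree_of_isUnit : Module.IsTorsionFree O R := by
  refine ⟨fun n hn => ?_⟩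
  intro x y hxy
  change n • x = n • y at hxy
  rw [Algebra.smul_def, Algebra.smul_def] at hxy
  exact (hR n hn.ne_zero).mul_left_cancel hxy

/-- All weight vectors. -/
def wtVecs (π : A →ₐc[O] AddMonoidAlgebra O M) : Set (lie O A) := {v | ∃ m, v ∈ weightSpace π m}

omit [CharZero O] in
lemma mem_castSpan_wtVecs {v : Form O A R} (hv : IsDer v) : v ∈ castSpan R (wtVecs π) := by
  have := isTorsionFree_of_isUnit O hR
  rw [hv.eq_sum]
  refine Submodule.sum_mem _ fun i _ => Submodule.smul_mem _ _ ?_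
  rw [← sum_wtComp π (tanVec O A i) subset_rfl, AddSubmonoidClass.coe_finsetSum, map_sum]
  exact Submodule.sum_mem _ fun m _ => castForm_mem_castSpan ⟨m, wtComp_mem π m _⟩

omit [IsDomain O] [IsPrincipalIdealRing O] [CharZero O] [Algebra.FiniteType O A] hR in
lemma castForm_mem_of_root {m : M} (hm : m ≠ 0) {v : lie O A} (hv : v ∈ weightSpace π m) :
    castForm R v.1 ∈ castSpan R (Set.range C.X) := by
  by_cases hr : m ∈ roots (A := A) π
  · obtain ⟨c, rfl⟩ := C.exists_eq_smul_X ⟨m, hr⟩ hv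
    change castForm R (c • (C.X ⟨m, hr⟩).1) ∈ _
    rw [castForm_smul']
    exact Submodule.smul_mem _ _ (castForm_mem_castSpan ⟨_, rfl⟩)
  · rw [eq_zero_of_mem_weightSpace hm hr hv]
    change castForm R (0 : Dist O A) ∈ _
    rw [map_zero]
    exact Submodule.zero_mem _

/-- The orthogonal of everything for the Killing form has no component in a root space whose
negative is also a root space. -/
lemma mem_castSpan_asym {v₀ v₁ : Form O A R}
    (h₀ : v₀ ∈ castSpan R (weightSpace (A := A) π 0 : Set _))
    (h₁ : v₁ ∈ castSpan R (Set.range C.X)) (h : ∀ w : Form O A R, IsDer w → kil (v₀ + v₁) w = 0) :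
    v₁ ∈ castSpan R (C.X '' asymRoots π) := by
  classical
  have := (finite_roots (A := A) π).fintype
  rw [castSpan, ← Set.range_comp, Submodule.mem_span_range_iff_exists_fun] at h₁
  obtain ⟨r, rfl⟩ := h₁
  refine Submodule.sum_mem _ fun α _ => ?_
  by_cases hα : α ∈ asymRoots (A := A) π
  · exact Submodule.smul_mem _ _ (castForm_mem_castSpan ⟨α, hα, rfl⟩)
  have hα' : -(α : M) ∈ roots (A := A) π := not_not.1 hα
  have h1 := h (castForm R (C.X ⟨_, hα'⟩).1) (isDer_castForm _)
  have h2 : kil v₀ (castForm R (C.X ⟨_, hα'⟩).1) = 0 := by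
    refine kil_eq_zero_of_mem_castSpan (fun u hu => ?_) h₀
    rw [kil_castForm, killingForm_eq_zero_of_add_ne_zero π _ hu (C.X_mem_weightSpace _), map_zero]
    simpa using C.ne_zero α
  have h3 : r α * algebraMap O R (killingForm O (lie O A) (C.X α) (C.X ⟨_, hα'⟩)) = 0 := by
    rw [kil_add_left, h2, zero_add, kil_sum_left, Finset.sum_eq_single α] at h1
    · rw [kil_smul_left] at h1
      rwa [← kil_castForm]
    · intro β _ hβ
      rw [kil_smul_left]
      change r β * kil (castForm R (C.X β).1) _ = 0
      rw [kil_castForm, killingForm_eq_zero_of_add_ne_zero π _ (C.X_mem_weightSpace β)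
        (C.X_mem_weightSpace _), map_zero, mul_zero]
      rw [← sub_eq_add_neg, sub_ne_zero]
      exact fun h => hβ (Subtype.ext h)
    · simp
  rw [(hR _ (C.killingForm_X_ne_zero rfl)).mul_left_eq_zero.1 h3, zero_smul]
  exact Submodule.zero_mem _

omit [CharZero O] in
/-- After extension of scalars the Lie algebra is the sum of its weight zero part and the root
spaces. -/
lemma exists_eq_add_of_isDer {v : Form O A R} (hv : IsDer v) :
    ∃ v₀ ∈ castSpan R (weightSpace (A := A) π 0 : Set _),
    ∃ v₁ ∈ castSpan R (Set.range C.X), v = v₀ + v₁ := by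
  have h : castSpan R (wtVecs π) ≤ castSpan R (weightSpace (A := A) π 0 : Set (lie O A)) ⊔
      castSpan R (Set.range C.X) := by
    refine castSpan_le.2 ?_
    rintro v ⟨m, hm⟩
    by_cases h0 : m = 0
    · subst h0
      exact Submodule.mem_sup_left (castForm_mem_castSpan hm)
    · exact Submodule.mem_sup_right (C.castForm_mem_of_root h0 hm)
  obtain ⟨v₀, h₀, v₁, h₁, h2⟩ := Submodule.mem_sup.1 (h (mem_castSpan_wtVecs hR hv))
  exact ⟨v₀, h₀, v₁, h₁, h2.symm⟩

lemma adForm_mem_castSpan_asym {z v : Form O A R} (hz : IsDer z)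
    (hv : v ∈ castSpan R (C.X '' asymRoots π)) : adForm z v ∈ castSpan R (C.X '' asymRoots π) := by
  refine adForm_mem_of_forall ?_ (mem_castSpan_wtVecs (π := π) hR hz) hv
  rintro z ⟨m, hm⟩ _ ⟨γ, hγ, rfl⟩
  rcases C.lie_X_mem_of_asym hm hγ with h | ⟨δ, hδ, -, c, hc⟩
  · rw [h]
    change castForm R (0 : Dist O A) ∈ _
    rw [map_zero]
    exact Submodule.zero_mem _
  · rw [← hc]
    change castForm R (c • (C.X δ).1) ∈ _
    rw [castForm_smul']
    exact Submodule.smul_mem _ _ (castForm_mem_castSpan ⟨δ, hδ, rfl⟩)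

/-- If `N` is the orthogonal of everything for the Killing form, then `[𝔤, [𝔤, N]]` is contained
in the span of the root spaces whose negative is not a root space. -/
lemma adForm_adForm_mem {y z v : Form O A R} (hy : IsDer y) (hz : IsDer z) (hv : IsDer v)
    (h : ∀ w : Form O A R, IsDer w → kil v w = 0) :
    adForm y (adForm z v) ∈ castSpan R (C.X '' asymRoots π) := by
  have := isTorsionFree_of_isUnit O hR
  have hN : ∀ {y v : Form O A R}, IsDer y → IsDer v → (∀ w : Form O A R, IsDer w → kil v w = 0) →
      ∀ w : Form O A R, IsDer w → kil (adForm y v) w = 0 := by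
    intro y v hy hv h w hw
    rw [kil_adForm hy hv hw, h _ (hy.adForm hw), neg_zero]
  have hle : castSpan R (C.X '' asymRoots π) ≤ castSpan R (Set.range C.X) :=
    castSpan_mono (Set.image_subset_range _ _)
  obtain ⟨v₀, h₀, v₁, h₁, rfl⟩ := C.exists_eq_add_of_isDer hR hv
  have h₁' := C.mem_castSpan_asym hR h₀ h₁ h
  -- the brackets `[u, v]` of elements of weight zero
  set W : Set (lie O A) := {x | ∃ u ∈ weightSpace π 0, ∃ v ∈ weightSpace π 0, x = ⁅u, v⁆}
  have hW : W ⊆ (weightSpace (A := A) π 0 : Set (lie O A)) := by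
    rintro _ ⟨u, hu, v, hv, rfl⟩
    simpa using lie_mem_weightSpace π hu hv
  have h2 : adForm z v₀ ∈ castSpan R W ⊔ castSpan R (Set.range C.X) := by
    refine adForm_mem_of_forall ?_ (mem_castSpan_wtVecs (π := π) hR hz) h₀
    rintro z ⟨m, hm⟩ u hu
    by_cases hm0 : m = 0
    · subst hm0
      exact Submodule.mem_sup_left (castForm_mem_castSpan ⟨z, hm, u, hu, rfl⟩)
    · refine Submodule.mem_sup_right
        (C.castForm_mem_of_root (m := m + 0) (by simpa using hm0) ?_)
      exact lie_mem_weightSpace π hm hu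
  obtain ⟨u₀, hu₀, u₁, hu₁, hu⟩ := Submodule.mem_sup.1 h2
  have h3 : adForm z (v₀ + v₁) = u₀ + (u₁ + adForm z v₁) := by
    rw [map_add, ← hu, add_assoc]
  have h4 := C.mem_castSpan_asym hR (castSpan_mono hW hu₀)
    (add_mem hu₁ (hle (C.adForm_mem_castSpan_asym hR hz h₁'))) (by
      rw [← h3]
      exact hN hz hv h)
  have h5 : adForm y u₀ ∈ castSpan R (Set.range C.X) := by
    refine adForm_mem_of_forall ?_ (mem_castSpan_wtVecs (π := π) hR hy) hu₀
    rintro z ⟨m, hm⟩ _ ⟨u, hu, v, hv, rfl⟩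
    by_cases hm0 : m = 0
    · subst hm0
      rw [C.lie_lie_weightSpace_zero hm hu hv]
      change castForm R (0 : Dist O A) ∈ _
      rw [map_zero]
      exact Submodule.zero_mem _
    · refine C.castForm_mem_of_root (m := m + (0 + 0)) (by simpa using hm0) ?_
      exact lie_mem_weightSpace π hm (lie_mem_weightSpace π hu hv)
  have h6 := C.mem_castSpan_asym hR (Submodule.zero_mem _) (add_mem h5
    (hle (C.adForm_mem_castSpan_asym hR hy h4))) (by
      rw [zero_add, ← map_add, ← h3]
      exact hN hy (hz.adForm hv) (hN hz hv h))
  rw [h3, map_add]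
  exact h6

/-- Each stage of the derived series is stable under `G`. The root spaces of stage `0` are contained
in `[𝔤, [𝔤, N]]`, where `N` is the orthogonal of everything for the Killing form, and conjugation
preserves `N`; the root spaces of a later stage are brackets of those of the stage before it. -/
lemma conjForm_X_mem (x : Pts O A R) (k : ℕ) : ∀ γ ∈ derRoots (A := A) π k,
    conjForm x (castForm R (C.X γ).1) ∈ castSpan R (C.X '' derRoots π k) := by
  have := isTorsionFree_of_isUnit O hR
  induction k with
  | zero =>
    intro γ hγ
    have h1 : ((2 : O) * 2) • C.X γ = ⁅toral π (C.h γ), ⁅toral π (C.h γ), C.X γ⁆⁆ := by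
      rw [C.lie_H_X, C.h_self, lie_smul, C.lie_H_X, C.h_self, smul_smul]
    have h2 := C.adForm_adForm_mem hR ((isDer_castForm (toral π (C.h γ))).conj x)
      ((isDer_castForm (toral π (C.h γ))).conj x) ((isDer_castForm (C.X γ)).conj x) (by
        intro w hw
        have h3 := kil_conjForm x (isDer_castForm (R := R) (C.X γ)) (hw.conj x⁻¹)
        change kil (conjForm x _) (conjForm x (conjForm x⁻¹ w)) = kil _ (conjForm x⁻¹ w) at h3
        rw [conjForm_conjForm_inv] at h3
        refine h3.trans ?_
        have h4 := hw.conj x⁻¹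
        change IsDer (conjForm x⁻¹ w) at h4
        rw [h4.eq_sum]
        have h5 : ∀ i, kil (castForm R (C.X γ).1) (castForm R (tanVec O A i).1) = 0 := fun i => by
          rw [kil_castForm, C.killingForm_X_of_asym hγ, map_zero]
        simp only [kil, map_sum, map_smul, Finset.mul_sum, mul_smul_comm]
        refine Finset.sum_eq_zero fun i _ => ?_
        have h6 := h5 i
        rw [kil] at h6
        rw [h6, smul_zero])
    change adForm (conjForm x _) (adForm (conjForm x _) (conjForm x _)) ∈ _ at h2
    rw [← conjForm_adForm, ← conjForm_adForm, adForm_castForm, adForm_castForm, ← h1] at h2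
    change conjForm x (castForm R ((2 * 2 : O) • (C.X γ).1)) ∈ _ at h2
    exact conjForm_mem_of_smul (hR _ (mul_ne_zero two_ne_zero two_ne_zero)) h2
  | succ k ih =>
    rintro γ ⟨α, hα, β, hβ, h⟩
    obtain ⟨h1, h2⟩ := C.lie_X_X α β γ h
    have h3 : adForm (conjForm x (castForm R (C.X α).1)) (conjForm x (castForm R (C.X β).1)) ∈
        castSpan R (C.X '' derRoots π (k + 1)) := by
      refine adForm_mem_of_forall ?_ (ih α hα) (ih β hβ)
      rintro _ ⟨δ, hδ, rfl⟩ _ ⟨ε, hε, rfl⟩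
      rcases C.lie_X_mem_of_asym (C.X_mem_weightSpace δ) (C.derRoots_subset k hε) with
        h | ⟨ζ, -, h4, c, hc⟩
      · rw [h]
        change castForm R (0 : Dist O A) ∈ _
        rw [map_zero]
        exact Submodule.zero_mem _
      · rw [← hc]
        change castForm R (c • (C.X ζ).1) ∈ _
        rw [castForm_smul']
        exact Submodule.smul_mem _ _ (castForm_mem_castSpan ⟨ζ, ⟨δ, hδ, ε, hε, h4⟩, rfl⟩)
    rw [← conjForm_adForm, adForm_castForm, h1, ← Int.cast_smul_eq_zsmul O] at h3
    exact conjForm_mem_of_smul (hR _ (by exact_mod_cast h2)) h3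

end Scalars

/-- If some root has no negative, then there is a nonempty set of roots spanning an abelian ideal
which is stable under `G`: the last nonzero term of the derived series of an ideal defined through
the Killing form. -/
lemma exists_stable_abelian (h : (asymRoots (A := A) π).Nonempty) : ∃ S : Set (roots (A := A) π),
    S.Nonempty ∧ (∀ α ∈ S, ∀ β ∈ S, ⁅C.X α, C.X β⁆ = 0) ∧
    ∀ (R : Type _) [CommRing R] [Algebra O R], (∀ c : O, c ≠ 0 → IsUnit (algebraMap O R c)) →
      ∀ (x : Pts O A R), ∀ γ ∈ S, conjForm x (castForm R (C.X γ).1) ∈ castSpan R (C.X '' S) := by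
  classical
  have h1 := C.exists_derRoots_eq_empty
  obtain ⟨k, hk⟩ : ∃ k, Nat.find h1 = k + 1 := Nat.exists_eq_succ_of_ne_zero fun h0 => by
    have := Nat.find_spec h1
    rw [h0] at this
    exact h.ne_empty this
  refine ⟨derRoots π k, Set.nonempty_iff_ne_empty.2 (Nat.find_min h1 (by omega)), ?_,
    fun R _ _ hR x γ hγ => C.conjForm_X_mem hR x k γ hγ⟩
  intro α hα β hβ
  rcases C.lie_X_mem_of_asym (C.X_mem_weightSpace α) (C.derRoots_subset k hβ) with h | ⟨ζ, -, h4, -⟩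
  · exact h
  · have h5 : ζ ∈ derRoots (A := A) π (k + 1) := ⟨α, hα, β, hβ, h4⟩
    have h6 := Nat.find_spec h1
    rw [hk] at h6
    rw [h6] at h5
    exact h5.elim

end ChevalleyBasis

end GroupScheme

/-! ### Subalgebras of polynomial rings stable under differentiation -/

namespace MvPolynomial

section

variable {σ k : Type*} [Field k] [CharZero k]

lemma eq_C_of_pderiv_eq_zero {h : MvPolynomial σ k} (hh : ∀ i, pderiv i h = 0) :
    h = C (constantCoeff h) := by
  classical
  ext m
  rw [coeff_C]
  split_ifs with hm
  · rw [← hm]; rfl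
  · obtain ⟨i, hi⟩ : ∃ i, m i ≠ 0 := by
      by_contra! h0
      exact hm (Finsupp.ext fun i => (h0 i).symm)
    have h1 := congrArg (coeff (m - Finsupp.single i 1)) (hh i)
    have h2 : m - Finsupp.single i 1 + Finsupp.single i 1 = m :=
      tsub_add_cancel_of_le (by simpa [Nat.one_le_iff_ne_zero] using hi)
    rw [coeff_pderiv, h2, coeff_zero, mul_eq_zero] at h1
    exact h1.resolve_right (Nat.cast_add_one_ne_zero _)

/-- All monomials of `h` have degree less than `n`. -/
def DegLT (n : ℕ) (h : MvPolynomial σ k) : Prop := ∀ m : σ →₀ ℕ, n ≤ m.degree → coeff m h = 0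

omit [CharZero k] in
lemma degLT_totalDegree (h : MvPolynomial σ k) : DegLT (h.totalDegree + 1) h := fun m hm => by
  by_contra h0
  have h1 : m.degree ≤ h.totalDegree := le_totalDegree (mem_support_iff.2 h0)
  omega

omit [CharZero k] in
lemma DegLT.pderiv {n : ℕ} {h : MvPolynomial σ k} (hh : DegLT (n + 1) h) (i : σ) :
    DegLT n (pderiv i h) := fun m hm => by
  rw [coeff_pderiv, hh, zero_mul]
  simpa using hm

omit [CharZero k] in
lemma DegLT.eq_zero {h : MvPolynomial σ k} (hh : DegLT 0 h) : h = 0 := by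
  ext m
  rw [hh m (Nat.zero_le _), coeff_zero]

variable [Fintype σ]

/-- The differential of a polynomial at the origin. -/
def diffZero (f : MvPolynomial σ k) (i : σ) : k := constantCoeff (pderiv i f)

/-- The derivative in the direction of a vector. -/
def dirDeriv (c : σ → k) : MvPolynomial σ k →ₗ[k] MvPolynomial σ k :=
  ∑ i, c i • (pderiv i).toLinearMap

omit [CharZero k] in
lemma dirDeriv_apply (c : σ → k) (f : MvPolynomial σ k) :
    dirDeriv c f = ∑ i, c i • pderiv i f := by
  simp [dirDeriv]

omit [CharZero k] in
lemma constantCoeff_dirDeriv (c : σ → k) (f : MvPolynomial σ k) :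
    constantCoeff (dirDeriv c f) = ∑ i, c i * diffZero f i := by
  rw [dirDeriv_apply, map_sum]
  simp [diffZero, smul_eq_C_mul]

omit [CharZero k] in
lemma pderiv_dirDeriv (c : σ → k) (f : MvPolynomial σ k) (j : σ) :
    pderiv j (dirDeriv c f) = dirDeriv c (pderiv j f) := by
  have h : ∀ i, pderiv j (pderiv i f) = pderiv i (pderiv j f) := fun i => by
    ext m
    simp only [coeff_pderiv]
    by_cases hij : i = j
    · subst hij; rfl
    · rw [add_right_comm]
      simp [hij, Ne.symm hij]
      ring
  rw [dirDeriv_apply, dirDeriv_apply, map_sum]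
  exact Finset.sum_congr rfl fun i _ => by rw [Derivation.map_smul, h]

/-- A linear form as a polynomial. -/
def linPoly : (σ → k) →ₗ[k] MvPolynomial σ k := Fintype.linearCombination k X

omit [CharZero k] in
lemma pderiv_linPoly (l : σ → k) (i : σ) : pderiv i (linPoly l) = C (l i) := by
  classical
  rw [linPoly, Fintype.linearCombination_apply, map_sum, Finset.sum_eq_single i]
  · rw [Derivation.map_smul, pderiv_X_self, smul_eq_C_mul, mul_one]
  · intro j _ hj
    rw [Derivation.map_smul, pderiv_X_of_ne hj, smul_zero]
  · simp

omit [CharZero k] in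
lemma pderiv_aeval_linPoly (p : σ → σ → k) (h : MvPolynomial σ k) (j : σ) :
    pderiv j (aeval (fun i => linPoly (p i)) h) =
      ∑ i, p i j • aeval (fun i => linPoly (p i)) (pderiv i h) := by
  classical
  induction h using MvPolynomial.induction_on with
  | C a => simp [algebraMap_eq]
  | add f g hf hg => simp only [map_add, hf, hg, smul_add, Finset.sum_add_distrib]
  | mul_X f l hf =>
    rw [map_mul, aeval_X, Derivation.leibniz, hf, pderiv_linPoly]
    simp only [Derivation.leibniz, pderiv_X, map_add, smul_eq_mul, map_mul, smul_add,
      Finset.sum_add_distrib, aeval_X]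
    have h1 : ∑ x, p x j • (aeval (fun i => linPoly (p i)) f *
        aeval (R := k) (fun i => linPoly (p i))
          (Pi.single (M := fun _ => MvPolynomial σ k) x 1 l)) =
        p l j • aeval (fun i => linPoly (p i)) f := by
      rw [Finset.sum_eq_single l]
      · simp
      · intro i _ hi
        rw [Pi.single_eq_of_ne hi.symm, map_zero, mul_zero, smul_zero]
      · simp
    rw [h1, smul_eq_C_mul, mul_comm (C (p l j)), Finset.mul_sum]
    simp only [mul_smul_comm]

/-- A polynomial is a function of the linear forms in `L` if its derivatives along the orthogonal
of `L` vanish; here `p` is a projector onto `L`. -/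
lemma aeval_linPoly_eq (p : σ → σ → k) (n : ℕ) : ∀ h : MvPolynomial σ k, DegLT n h →
    (∀ j, pderiv j h = ∑ i, p i j • pderiv i h) → aeval (fun i => linPoly (p i)) h = h := by
  induction n with
  | zero =>
    intro h hh _
    rw [hh.eq_zero, map_zero]
  | succ n ih =>
    intro h hh hp
    have h1 : ∀ i, aeval (fun i => linPoly (p i)) (pderiv i h) = pderiv i h := fun i => by
      refine ih _ (hh.pderiv i) fun j => ?_
      have h2 : ∀ l, pderiv i (pderiv l h) = pderiv l (pderiv i h) := fun l => by
        classical
        have := pderiv_dirDeriv (Pi.single l 1) h i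
        simpa [dirDeriv_apply, Pi.single_apply] using this
      rw [← h2, hp j, map_sum]
      exact Finset.sum_congr rfl fun l _ => by rw [Derivation.map_smul, h2]
    have h3 : aeval (fun i => linPoly (p i)) h - h =
        C (constantCoeff (aeval (fun i => linPoly (p i)) h - h)) := by
      refine eq_C_of_pderiv_eq_zero fun j => ?_
      rw [map_sub, pderiv_aeval_linPoly, hp j]
      simp only [h1, sub_self]
    have h4 : constantCoeff (aeval (fun i => linPoly (p i)) h) = constantCoeff h := by
      have h5 : (constantCoeff (σ := σ) (R := k)).comp
          (aeval (R := k) fun i => linPoly (p i)).toRingHom = constantCoeff := by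
        refine MvPolynomial.ringHom_ext (fun r => by simp) fun i => ?_
        simp [linPoly, Fintype.linearCombination_apply, smul_eq_C_mul]
      exact congrArg (fun f : MvPolynomial σ k →+* k => f h) h5
    rw [map_sub, h4, sub_self, C_0, sub_eq_zero] at h3
    exact h3

/-- A subalgebra of a polynomial ring in characteristic zero that is stable under the partial
derivatives is everything if it separates tangent vectors at the origin. In geometric terms: an
infinitesimally injective homomorphism from a vector group is a closed immersion. -/
theorem eq_top_of_pderiv_mem (S : Subalgebra k (MvPolynomial σ k))
    (hS : ∀ f ∈ S, ∀ i, pderiv i f ∈ S)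
    (hsep : ∀ c : σ → k, (∀ f ∈ S, ∑ i, c i * diffZero f i = 0) → c = 0) : S = ⊤ := by
  classical
  -- the linear forms contained in `S`
  let L : Submodule k (σ → k) := S.toSubmodule.comap linPoly
  have hL : ∀ l, l ∈ L ↔ linPoly l ∈ S := fun l => Iff.rfl
  have key : ∀ n, (∀ F ∈ S, DegLT n F → diffZero F ∈ L) → ∀ h ∈ S, DegLT n h →
      ∀ c : σ → k, (∀ l ∈ L, ∑ i, c i * l i = 0) → dirDeriv c h = 0 := by
    intro n
    induction n with
    | zero =>
      intro _ h _ hh c _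
      rw [hh.eq_zero, map_zero]
    | succ n ih =>
      intro hF h hhS hh c hc
      have h1 : ∀ j, pderiv j (dirDeriv c h) = 0 := fun j => by
        rw [pderiv_dirDeriv]
        exact ih (fun F hFS hFn => hF F hFS fun m hm => hFn m (by omega)) _ (hS h hhS j)
          (hh.pderiv j) c hc
      rw [eq_C_of_pderiv_eq_zero h1, constantCoeff_dirDeriv, hc _ (hF h hhS hh), C_0]
  obtain ⟨q, hq⟩ := L.exists_isCompl
  let P : (σ → k) →ₗ[k] (σ → k) := L.subtype ∘ₗ Submodule.projectionOnto L q hq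
  have hPL : ∀ l, P l ∈ L := fun l => Subtype.mem _
  have hPid : ∀ l ∈ L, P l = l := fun l hl => by
    change ((Submodule.projectionOnto L q hq l : L) : σ → k) = l
    rw [Submodule.projectionOnto_apply_left hq ⟨l, hl⟩]
  let p : σ → σ → k := fun i => P (Pi.single i 1)
  have hp : ∀ l ∈ L, ∀ j, ∑ i, l i * p i j = l j := fun l hl j => by
    have h1 : l = ∑ i, l i • (Pi.single i 1 : σ → k) := by
      ext j; simp [Pi.single_apply]
    have h2 := hPid l hl
    conv_lhs at h2 => rw [h1, map_sum]
    have h3 := congrFun h2 j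
    simpa [p] using h3
  have main : ∀ n, ∀ f ∈ S, DegLT n f → diffZero f ∈ L := by
    intro n
    induction n with
    | zero =>
      intro f _ hf
      have : diffZero f = 0 := by
        funext i
        simp [diffZero, hf.eq_zero]
      rw [this]
      exact L.zero_mem
    | succ n ih =>
      intro f hfS hf
      set g := f - linPoly (diffZero f) with hg
      have hgi : ∀ i, pderiv i g = pderiv i f - C (diffZero f i) := fun i => by
        rw [hg, map_sub, pderiv_linPoly]
      have hg0 : diffZero g = 0 := by
        funext i
        rw [diffZero, hgi, map_sub, constantCoeff_C, diffZero, sub_self, Pi.zero_apply]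
      have hgc : ∀ c : σ → k, (∀ l ∈ L, ∑ i, c i * l i = 0) → dirDeriv c g = 0 := by
        intro c hc
        have h1 : ∀ j, pderiv j (dirDeriv c g) = 0 := fun j => by
          rw [pderiv_dirDeriv, hgi, map_sub, key n ih _ (hS f hfS j) (hf.pderiv j) c hc,
            dirDeriv_apply]
          simp
        rw [eq_C_of_pderiv_eq_zero h1, constantCoeff_dirDeriv, hg0]
        simp
      have h2 : aeval (fun i => linPoly (p i)) g = g := by
        refine aeval_linPoly_eq p _ g (degLT_totalDegree g) fun j => ?_
        have h3 := hgc (Pi.single j 1 - fun i => p i j) fun l hl => by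
          simp only [Pi.sub_apply, sub_mul, Finset.sum_sub_distrib]
          rw [sub_eq_zero]
          have := hp l hl j
          simp only [mul_comm (l _)] at this
          rw [this]
          simp [Pi.single_apply]
        rw [dirDeriv_apply] at h3
        simp only [Pi.sub_apply, sub_smul, Finset.sum_sub_distrib, sub_eq_zero] at h3
        rw [← h3]
        simp [Pi.single_apply]
      have h4 : g ∈ S := by
        rw [← h2]
        have h5 : (aeval (R := k) fun i => linPoly (p i)).range ≤ S := by
          rw [← Algebra.adjoin_range_eq_range_aeval, Algebra.adjoin_le_iff]
          rintro _ ⟨i, rfl⟩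
          exact (hL _).1 (hPL _)
        exact h5 ⟨g, rfl⟩
      rw [hL]
      have h6 : linPoly (diffZero f) = f - g := by rw [hg]; abel
      rw [h6]
      exact S.sub_mem hfS h4
  have hLtop : L = ⊤ := by
    by_contra hne
    obtain ⟨φ, hφ0, hφ⟩ := Submodule.exists_le_ker_of_lt_top L (lt_top_iff_ne_top.2 hne)
    refine hφ0 ?_
    have h1 : ∀ l, φ l = ∑ i, φ (Pi.single i 1) * l i := fun l => by
      have h1 : l = ∑ i, l i • (Pi.single i 1 : σ → k) := by
        ext j; simp [Pi.single_apply]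
      conv_lhs => rw [h1, map_sum]
      simp [mul_comm]
    have h2 := hsep (fun i => φ (Pi.single i 1)) fun f hf => by
      rw [← h1]
      exact hφ (main _ f hf (degLT_totalDegree f))
    ext i
    simpa using congrFun h2 i
  rw [eq_top_iff, ← MvPolynomial.adjoin_range_X, Algebra.adjoin_le_iff]
  rintro _ ⟨i, rfl⟩
  have h1 : linPoly (Pi.single i 1 : σ → k) ∈ S := (hL _).1 (by rw [hLtop]; trivial)
  simpa [linPoly, Fintype.linearCombination_apply, Pi.single_apply] using h1

end

end MvPolynomial

/-! ### Exponentials of locally nilpotent derivations -/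

namespace GroupScheme

section Exp

variable {O A R S : Type*} [CommRing O] [CommRing A] [HopfAlgebra O A] [CommRing R] [Algebra O R]
  [CommRing S] [Algebra O S]

/-- Strong local nilpotency of a form for convolution. -/
def LNil (X : Form O A R) : Prop :=
  ∀ a, ∃ N, ∀ n, N ≤ n → ∀ u w : Form O A R, (u * X ^ n * w) a = 0

lemma LNil.pow_apply {X : Form O A R} (hX : LNil X) (a : A) : ∃ N, ∀ n, N ≤ n → (X ^ n) a = 0 := by
  obtain ⟨N, hN⟩ := hX a
  refine ⟨N, fun n hn => ?_⟩
  simpa using hN n hn 1 1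

lemma lNil_zero : LNil (0 : Form O A R) := fun a => ⟨1, fun n hn u w => by
  rw [zero_pow (by omega), mul_zero, zero_mul]
  rfl⟩

lemma LNil.smul {X : Form O A R} (hX : LNil X) (r : R) : LNil (r • X) := fun a => by
  obtain ⟨N, hN⟩ := hX a
  refine ⟨N, fun n hn u w => ?_⟩
  rw [smul_pow, mul_smul_comm, smul_mul_assoc, WithConv.ofConv_smul, LinearMap.smul_apply, hN n hn,
    smul_zero]

lemma LNil.add {X Y : Form O A R} (hX : LNil X) (hY : LNil Y) (h : Commute X Y) : LNil (X + Y) :=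
  fun a => by
    obtain ⟨N, hN⟩ := hX a
    obtain ⟨K, hK⟩ := hY a
    refine ⟨N + K, fun n hn u w => ?_⟩
    rw [h.add_pow, Finset.mul_sum, Finset.sum_mul, WithConv.ofConv_sum, LinearMap.sum_apply]
    refine Finset.sum_eq_zero fun m _ => ?_
    by_cases hm : N ≤ m
    · have := hN m hm u (Y ^ (n - m) * (n.choose m : Form O A R) * w)
      simpa only [mul_assoc] using this
    · rw [(h.pow_pow m (n - m)).eq]
      have := hK (n - m) (by omega) u (X ^ m * (n.choose m : Form O A R) * w)
      simpa only [mul_assoc] using this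

lemma LNil.sum {ι : Type*} {s : Finset ι} {X : ι → Form O A R} (hX : ∀ i ∈ s, LNil (X i))
    (h : ∀ i j, Commute (X i) (X j)) : LNil (∑ i ∈ s, X i) := by
  classical
  induction s using Finset.induction_on with
  | empty => simpa using lNil_zero
  | insert i s hi ih =>
    rw [Finset.sum_insert hi]
    exact (hX i (by simp)).add (ih fun j hj => hX j (by simp [hj]))
      (Commute.sum_right _ _ _ fun j _ => h i j)

lemma IsDer.conjForm {v : Form O A R} (hv : IsDer v) (x : Pts O A R) : IsDer (conjForm x v) :=
  hv.conj x

lemma conjForm_pow (x : Pts O A R) (v : Form O A R) (n : ℕ) :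
    conjForm x (v ^ n) = conjForm x v ^ n := by
  induction n with
  | zero => rw [pow_zero, pow_zero, conjForm, mul_one, ptForm_mul_inv]
  | succ n ih => rw [pow_succ, pow_succ, conjForm_mul_form, ih]

lemma LNil.conj {X : Form O A R} (hX : LNil X) (x : Pts O A R) : LNil (conjForm x X) := fun a => by
  obtain ⟨N, hN⟩ := hX a
  refine ⟨N, fun n hn u w => ?_⟩
  rw [← conjForm_pow]
  simpa only [conjForm, mul_assoc] using hN n hn (u * ptForm x) (ptForm x⁻¹ * w)

lemma IsDer.pullMul_pow {X : Form O A R} (hX : IsDer X) (n : ℕ) (a b : A) :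
    (X ^ n) (a * b) =
      ∑ m ∈ Finset.range (n + 1), (n.choose m : R) * ((X ^ m) a * (X ^ (n - m)) b) := by
  have h1 : Commute (box X (1 : Form O A R)) (box 1 X) := by
    rw [Commute, SemiconjBy, box_mul_box, box_mul_box, one_mul, mul_one]
  have h2 : ∀ (v w : Form O A R) (m : ℕ), box v w ^ m = box (v ^ m) (w ^ m) := by
    intro v w m
    induction m with
    | zero => rw [pow_zero, pow_zero, pow_zero, box_one_one]
    | succ m ih => rw [pow_succ, pow_succ, pow_succ, ih, box_mul_box]
  have h3 : pullMul (X ^ n) =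
      ∑ m ∈ Finset.range (n + 1), (n.choose m : R) • box (X ^ m) (X ^ (n - m)) := by
    rw [map_pow, hX, h1.add_pow]
    refine Finset.sum_congr rfl fun m _ => ?_
    rw [h2, h2, box_mul_box, one_pow, one_pow, one_mul, mul_one, ← nsmul_eq_mul',
      Nat.cast_smul_eq_nsmul]
  rw [← pullMul_tmul, h3, WithConv.ofConv_sum, LinearMap.sum_apply]
  rfl

variable [Algebra ℚ R] [Algebra ℚ S]

variable (R) in
/-- The element `1 / n!`. -/
def invFact (n : ℕ) : R := algebraMap ℚ R (n.factorial : ℚ)⁻¹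

lemma invFact_zero : invFact R 0 = 1 := by simp [invFact]

lemma invFact_mul_choose {n m : ℕ} (h : m ≤ n) :
    invFact R n * (n.choose m : R) = invFact R m * invFact R (n - m) := by
  rw [invFact, invFact, invFact, ← map_natCast (algebraMap ℚ R), ← map_mul, ← map_mul,
    Nat.cast_choose ℚ h]
  congr 1
  have := Nat.factorial_ne_zero n
  field_simp

lemma succ_mul_invFact (n : ℕ) : ((n + 1 : ℕ) : R) * invFact R (n + 1) = invFact R n := by
  rw [invFact, invFact, ← map_natCast (algebraMap ℚ R), ← map_mul, Nat.factorial_succ]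
  congr 1
  have := Nat.factorial_ne_zero n
  push_cast
  field_simp

lemma map_invFact (f : R →ₐ[O] S) (n : ℕ) : f (invFact R n) = invFact S n :=
  congrArg (fun g : ℚ →+* S => g (n.factorial : ℚ)⁻¹)
    (Subsingleton.elim ((f : R →+* S).comp (algebraMap ℚ R)) (algebraMap ℚ S))

lemma exists_expPoly {X : Form O A R} (hX : LNil X) (a : A) :
    ∃ P : Polynomial R, ∀ n, P.coeff n = invFact R n * (X ^ n) a := by
  obtain ⟨N, hN⟩ := hX.pow_apply a
  refine ⟨∑ n ∈ Finset.range N, Polynomial.monomial n (invFact R n * (X ^ n) a), fun n => ?_⟩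
  simp only [Polynomial.finsetSum_coeff, Polynomial.coeff_monomial, Finset.sum_ite_eq',
    Finset.mem_range]
  split_ifs with h
  · rfl
  · rw [hN n (by omega), mul_zero]

lemma invFact_mul_pow_one {X : Form O A R} (hd : IsDer X) (n : ℕ) :
    invFact R n * (X ^ n) 1 = if n = 0 then 1 else 0 := by
  split_ifs with h0
  · subst h0
    rw [invFact_zero, pow_zero, one_mul]
    change algebraMap O R (Coalgebra.counit (1 : A)) = 1
    simp
  · have h1 : ∀ v w : Form O A R, (v * w) 1 = v 1 * w 1 := fun v w => by
      rw [mul_apply_eq_box, Bialgebra.comul_one, Algebra.TensorProduct.one_def, box_tmul]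
    obtain ⟨m, rfl⟩ := Nat.exists_eq_succ_of_ne_zero h0
    rw [pow_succ, h1, hd.apply_one, mul_zero, mul_zero]

/-- The one-parameter group `s ↦ exp (s X)` as a homomorphism from `A` to `R[s]`. -/
def expPoly {X : Form O A R} (hd : IsDer X) (hX : LNil X) : A →ₐ[O] Polynomial R where
  toFun a := (exists_expPoly hX a).choose
  map_one' := by
    ext n
    rw [(exists_expPoly hX 1).choose_spec, Polynomial.coeff_one, invFact_mul_pow_one hd]
  map_mul' a b := by
    ext n
    rw [(exists_expPoly hX (a * b)).choose_spec, Polynomial.coeff_mul, hd.pullMul_pow,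
      Finset.Nat.sum_antidiagonal_eq_sum_range_succ_mk, Finset.mul_sum]
    refine Finset.sum_congr rfl fun m hm => ?_
    rw [(exists_expPoly hX a).choose_spec, (exists_expPoly hX b).choose_spec, ← mul_assoc,
      invFact_mul_choose (by simpa [Nat.lt_succ_iff] using hm)]
    ring
  map_zero' := by
    ext n
    rw [(exists_expPoly hX 0).choose_spec, map_zero, mul_zero, Polynomial.coeff_zero]
  map_add' a b := by
    ext n
    rw [(exists_expPoly hX (a + b)).choose_spec, Polynomial.coeff_add,
      (exists_expPoly hX a).choose_spec, (exists_expPoly hX b).choose_spec, map_add, mul_add]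
  commutes' c := by
    ext n
    rw [(exists_expPoly hX _).choose_spec, Algebra.algebraMap_eq_smul_one, map_smul,
      Algebra.algebraMap_eq_smul_one, Polynomial.coeff_smul, Polynomial.coeff_one, mul_smul_comm,
      invFact_mul_pow_one hd]

lemma coeff_expPoly {X : Form O A R} (hd : IsDer X) (hX : LNil X) (a : A) (n : ℕ) :
    (expPoly hd hX a).coeff n = invFact R n * (X ^ n) a := (exists_expPoly hX a).choose_spec n

/-- The point `exp X` of `G`. -/
def expPt {X : Form O A R} (hd : IsDer X) (hX : LNil X) : Pts O A R :=
  toConv (((Polynomial.aeval (1 : R)).restrictScalars O).comp (expPoly hd hX))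

lemma expPt_apply {X : Form O A R} (hd : IsDer X) (hX : LNil X) {a : A} {N : ℕ}
    (hN : ∀ n, N ≤ n → (X ^ n) a = 0) :
    (expPt hd hX).ofConv a = ∑ n ∈ Finset.range N, invFact R n * (X ^ n) a := by
  have h : expPoly hd hX a =
      ∑ n ∈ Finset.range N, Polynomial.monomial n (invFact R n * (X ^ n) a) := by
    ext n
    simp only [Polynomial.finsetSum_coeff, Polynomial.coeff_monomial, Finset.sum_ite_eq',
      Finset.mem_range, coeff_expPoly]
    split_ifs with h
    · rfl
    · rw [hN n (by omega), mul_zero]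
  change Polynomial.aeval (1 : R) (expPoly hd hX a) = _
  rw [h, map_sum]
  simp [Polynomial.aeval_monomial]

/-- The expansion of the exponential inside a product, with a bound on the number of terms that
does not depend on the other factors. -/
lemma exists_mul_expPt_mul {X : Form O A R} (hd : IsDer X) (hX : LNil X) (a : A) :
    ∃ L, ∀ N, L ≤ N → ∀ u w : Form O A R, (u * ptForm (expPt hd hX) * w) a =
      ∑ m ∈ Finset.range N, invFact R m * (u * X ^ m * w) a := by
  have h1 : ∀ t : A ⊗[O] A, ∃ L, ∀ N, L ≤ N → ∀ w : Form O A R,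
      box (ptForm (expPt hd hX)) w t = ∑ m ∈ Finset.range N, invFact R m * box (X ^ m) w t := by
    intro t
    induction t using TensorProduct.induction_on with
    | zero => exact ⟨0, fun N _ w => by simp⟩
    | tmul b c =>
      obtain ⟨L, hL⟩ := hX.pow_apply b
      refine ⟨L, fun N hN w => ?_⟩
      rw [box_tmul, ptForm_apply, expPt_apply hd hX (fun n hn => hL n (hN.trans hn)),
        Finset.sum_mul]
      exact Finset.sum_congr rfl fun m _ => by rw [box_tmul, mul_assoc]
    | add x y hx hy =>
      obtain ⟨L, hL⟩ := hx
      obtain ⟨K, hK⟩ := hy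
      refine ⟨max L K, fun N hN w => ?_⟩
      simp only [map_add, mul_add, Finset.sum_add_distrib]
      rw [hL N ((le_max_left _ _).trans hN), hK N ((le_max_right _ _).trans hN)]
  have h2 : ∀ t : A ⊗[O] A, ∃ L, ∀ N, L ≤ N → ∀ u w : Form O A R,
      box u (ptForm (expPt hd hX) * w) t =
        ∑ m ∈ Finset.range N, invFact R m * box u (X ^ m * w) t := by
    intro t
    induction t using TensorProduct.induction_on with
    | zero => exact ⟨0, fun N _ u w => by simp⟩
    | tmul b c =>
      obtain ⟨L, hL⟩ := h1 (Coalgebra.comul (R := O) c)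
      refine ⟨L, fun N hN u w => ?_⟩
      rw [box_tmul, mul_apply_eq_box, hL N hN, Finset.mul_sum]
      exact Finset.sum_congr rfl fun m _ => by rw [box_tmul, mul_apply_eq_box, mul_left_comm]
    | add x y hx hy =>
      obtain ⟨L, hL⟩ := hx
      obtain ⟨K, hK⟩ := hy
      refine ⟨max L K, fun N hN u w => ?_⟩
      simp only [map_add, mul_add, Finset.sum_add_distrib]
      rw [hL N ((le_max_left _ _).trans hN), hK N ((le_max_right _ _).trans hN)]
  obtain ⟨L, hL⟩ := h2 (Coalgebra.comul (R := O) a)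
  refine ⟨L, fun N hN u w => ?_⟩
  simp only [mul_assoc]
  rw [mul_apply_eq_box, hL N hN]
  rfl

lemma expPt_congr {X Y : Form O A R} (hd : IsDer X) (hX : LNil X) (hd' : IsDer Y) (hY : LNil Y)
    (h : X = Y) : expPt hd hX = expPt hd' hY := by
  subst h; rfl

lemma mul_expPt_mul_inv {X : Form O A R} (hd : IsDer X) (hX : LNil X) (x : Pts O A R) :
    x * expPt hd hX * x⁻¹ = expPt (hd.conjForm x) (hX.conj x) := by
  apply ptForm_injective
  apply WithConv.ofConv_injective
  ext1 a
  obtain ⟨L, hL⟩ := exists_mul_expPt_mul hd hX a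
  obtain ⟨K, hK⟩ := (hX.conj x).pow_apply a
  rw [map_mul, map_mul, hL (max L K) (le_max_left _ _), ptForm_apply,
    expPt_apply (N := max L K) _ _ fun n hn => hK n ((le_max_right _ _).trans hn)]
  refine Finset.sum_congr rfl fun m _ => ?_
  change invFact R m * (conjForm x (X ^ m)) a = invFact R m * (conjForm x X ^ m) a
  rw [conjForm_pow]

lemma expPt_zero : expPt (isDer_zero : IsDer (0 : Form O A R)) lNil_zero = 1 := by
  apply WithConv.ofConv_injective
  ext1 a
  rw [expPt_apply (N := 1) _ _ fun n hn => by
    rw [zero_pow (by omega)]; rfl]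
  rw [Finset.sum_range_one, invFact_zero, one_mul, pow_zero]
  rfl

lemma mapPts_expPt {X : Form O A R} (hd : IsDer X) (hX : LNil X) (f : R →ₐ[O] S)
    (hX' : LNil (mapForm f X)) : mapPts A f (expPt hd hX) = expPt (hd.map f) hX' := by
  apply WithConv.ofConv_injective
  ext1 a
  obtain ⟨L, hL⟩ := hX.pow_apply a
  have h : ∀ n, (mapForm f X ^ n) a = f ((X ^ n) a) := fun n => by rw [← map_pow]; rfl
  rw [expPt_apply (N := L) _ _ fun n hn => by rw [h, hL n hn, map_zero]]
  change f ((expPt hd hX).ofConv a) = _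
  rw [expPt_apply hd hX hL, map_sum]
  exact Finset.sum_congr rfl fun m _ => by rw [map_mul, map_invFact, h]

lemma sum_range_range_eq {G : Type*} [AddCommMonoid G] {N : ℕ} (f : ℕ → ℕ → G)
    (h1 : ∀ m l, N ≤ m → f m l = 0) (h2 : ∀ m l, N ≤ l → f m l = 0) :
    ∑ m ∈ Finset.range N, ∑ l ∈ Finset.range N, f m l =
      ∑ n ∈ Finset.range (2 * N), ∑ m ∈ Finset.range (n + 1), f m (n - m) := by
  rw [← Finset.sum_product', ← Finset.sum_fiberwise_of_maps_to
    (s := Finset.range N ×ˢ Finset.range N) (t := Finset.range (2 * N)) (g := fun x => x.1 + x.2)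
    (fun x hx => by simp at hx ⊢; omega)]
  refine Finset.sum_congr rfl fun n _ => ?_
  rw [← Finset.Nat.sum_antidiagonal_eq_sum_range_succ f]
  refine Finset.sum_subset (fun x hx => ?_) fun x hx hx' => ?_
  · simp at hx ⊢
    exact hx.2
  · simp at hx hx'
    by_cases hN : N ≤ x.1
    · exact h1 _ _ hN
    by_cases hN' : N ≤ x.2
    · exact h2 _ _ hN'
    · exact (hx' (by omega) (by omega) hx).elim

lemma expPt_add {X Y : Form O A R} (hd : IsDer X) (hX : LNil X) (hd' : IsDer Y) (hY : LNil Y)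
    (h : Commute X Y) : expPt (hd.add hd') (hX.add hY h) = expPt hd hX * expPt hd' hY := by
  apply ptForm_injective
  apply WithConv.ofConv_injective
  ext1 a
  obtain ⟨L₁, h₁⟩ := exists_mul_expPt_mul hd hX a
  obtain ⟨L₂, h₂⟩ := exists_mul_expPt_mul hd' hY a
  obtain ⟨L₃, h₃⟩ := (hX.add hY h).pow_apply a
  obtain ⟨L₄, h₄⟩ := hX a
  obtain ⟨L₅, h₅⟩ := hY a
  set N := L₁ + L₂ + L₃ + L₄ + L₅
  have e1 : ptForm (expPt hd hX * expPt hd' hY) a = ∑ m ∈ Finset.range N, ∑ l ∈ Finset.range N,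
      invFact R m * invFact R l * (X ^ m * Y ^ l) a := by
    rw [map_mul, ← one_mul (ptForm (expPt hd hX)), h₁ N (by omega)]
    refine Finset.sum_congr rfl fun m _ => ?_
    have := h₂ N (by omega) (X ^ m) 1
    rw [mul_one] at this
    rw [one_mul, this, Finset.mul_sum]
    exact Finset.sum_congr rfl fun l _ => by rw [mul_one, mul_assoc]
  rw [e1, sum_range_range_eq (fun m l => invFact R m * invFact R l * (X ^ m * Y ^ l) a)
    (fun m l hm => by
      have := h₄ m (by omega) 1 (Y ^ l)
      rw [one_mul] at this
      rw [this, mul_zero]) (fun m l hl => by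
      have := h₅ l (by omega) (X ^ m) 1
      rw [mul_one] at this
      rw [this, mul_zero]), ptForm_apply, expPt_apply (N := 2 * N) _ _ fun n hn => h₃ n (by omega)]
  refine Finset.sum_congr rfl fun n _ => ?_
  rw [h.add_pow, WithConv.ofConv_sum, LinearMap.sum_apply, Finset.mul_sum]
  refine Finset.sum_congr rfl fun m hm => ?_
  rw [← invFact_mul_choose (by simpa [Nat.lt_succ_iff] using hm),
    show X ^ m * Y ^ (n - m) * ((n.choose m : ℕ) : Form O A R) =
    n.choose m • (X ^ m * Y ^ (n - m)) from (nsmul_eq_mul' _ _).symm, WithConv.ofConv_smul,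
    LinearMap.smul_apply, nsmul_eq_mul, mul_assoc]

/-- `exp X - 1` is locally nilpotent. -/
lemma exists_mul_expPt_sub_one_pow {X : Form O A R} (hd : IsDer X) (hX : LNil X) (a : A) :
    ∃ N : ℕ, ∀ n, N ≤ n → ∀ u : Form O A R, (u * (ptForm (expPt hd hX) - 1) ^ n) a = 0 := by
  obtain ⟨N, hN⟩ := hX a
  obtain ⟨L, hL⟩ := exists_mul_expPt_mul hd hX a
  have key : ∀ j n : ℕ, N ≤ n + j → ∀ u w : Form O A R,
      (u * X ^ n * (ptForm (expPt hd hX) - 1) ^ j * w) a = 0 := by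
    intro j
    induction j with
    | zero =>
      intro n hn u w
      rw [pow_zero, mul_one]
      exact hN n hn u w
    | succ j ih =>
      intro n hn u w
      have h1 : u * X ^ n * (ptForm (expPt hd hX) - 1) ^ (j + 1) * w =
          u * X ^ n * ptForm (expPt hd hX) * ((ptForm (expPt hd hX) - 1) ^ j * w) -
          u * X ^ n * ((ptForm (expPt hd hX) - 1) ^ j * w) := by
        rw [pow_succ']
        simp only [mul_sub, sub_mul, mul_assoc, one_mul]
      rw [h1, WithConv.ofConv_sub, LinearMap.sub_apply, hL (L + 1) (by omega),
        Finset.sum_range_succ', pow_zero, mul_one, invFact_zero, one_mul, add_sub_cancel_right]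
      refine Finset.sum_eq_zero fun m _ => ?_
      have := ih (n + (m + 1)) (by omega) u w
      rw [pow_add] at this
      simp only [mul_assoc] at this ⊢
      rw [this, mul_zero]
  refine ⟨N, fun n hn u => ?_⟩
  have := key n 0 (by omega) u 1
  simpa using this

end Exp

end GroupScheme

/-! ### Vector groups spanned by commuting root vectors -/

namespace GroupScheme

section WeightNilpotent

variable {O A M R : Type*} [CommRing O] [CommRing A] [HopfAlgebra O A] [AddCommGroup M]
  [CommRing R] [Algebra O R] (π : A →ₐc[O] AddMonoidAlgebra O M)

/-- The form `u * t * w`, where `t` is the universal point of `T`. -/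
def torusMul (u w : Form O A R) : Form O A (AddMonoidAlgebra R M) :=
  mapForm (IsScalarTower.toAlgHom O R (AddMonoidAlgebra R M)) u *
    ptForm (torusPt π (AddMonoidAlgebra.of R M)) *
    mapForm (IsScalarTower.toAlgHom O R (AddMonoidAlgebra R M)) w

/-- The characters of `T` occurring in the value of `u * t * w` at a given function are bounded
independently of `u` and `w`. -/
lemma exists_finset_torusMul (a : A) : ∃ F : Finset M, ∀ (u w : Form O A R), ∀ m ∉ F,
    (torusMul π u w a).coeff m = 0 := by
  classical
  have h0 : ∀ (r : R) (x : AddMonoidAlgebra R M) (m : M), x.coeff m = 0 →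
      (x * IsScalarTower.toAlgHom O R (AddMonoidAlgebra R M) r).coeff m = 0 := by
    intro r x m hx
    rw [mul_comm, IsScalarTower.coe_toAlgHom', ← Algebra.smul_def, AddMonoidAlgebra.coeff_smul,
      Finsupp.smul_apply, hx, smul_zero]
  set τ := ptForm (torusPt π (AddMonoidAlgebra.of R M))
  have h1 : ∀ t : A ⊗[O] A, ∃ F : Finset M, ∀ w : Form O A R, ∀ m ∉ F,
      (box τ (mapForm (IsScalarTower.toAlgHom O R (AddMonoidAlgebra R M)) w) t).coeff m = 0 := by
    intro t
    induction t using TensorProduct.induction_on with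
    | zero => exact ⟨∅, fun w m _ => by simp⟩
    | tmul b c =>
      refine ⟨(τ b).coeff.support, fun w m hm => ?_⟩
      rw [box_tmul, mapForm_apply]
      exact h0 _ _ _ (Finsupp.notMem_support_iff.1 hm)
    | add x y hx hy =>
      obtain ⟨F, hF⟩ := hx
      obtain ⟨G, hG⟩ := hy
      refine ⟨F ∪ G, fun w m hm => ?_⟩
      rw [Finset.mem_union, not_or] at hm
      rw [map_add, AddMonoidAlgebra.coeff_add, Finsupp.add_apply, hF w m hm.1, hG w m hm.2,
        add_zero]
  have h2 : ∀ t : A ⊗[O] A, ∃ F : Finset M, ∀ u w : Form O A R, ∀ m ∉ F,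
      (box (mapForm (IsScalarTower.toAlgHom O R (AddMonoidAlgebra R M)) u)
        (τ * mapForm (IsScalarTower.toAlgHom O R (AddMonoidAlgebra R M)) w) t).coeff m = 0 := by
    intro t
    induction t using TensorProduct.induction_on with
    | zero => exact ⟨∅, fun u w m _ => by simp⟩
    | tmul b c =>
      obtain ⟨F, hF⟩ := h1 (Coalgebra.comul (R := O) c)
      refine ⟨F, fun u w m hm => ?_⟩
      rw [box_tmul, mapForm_apply, mul_comm]
      exact h0 _ _ _ (hF w m hm)
    | add x y hx hy =>
      obtain ⟨F, hF⟩ := hx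
      obtain ⟨G, hG⟩ := hy
      refine ⟨F ∪ G, fun u w m hm => ?_⟩
      rw [Finset.mem_union, not_or] at hm
      rw [map_add, AddMonoidAlgebra.coeff_add, Finsupp.add_apply, hF u w m hm.1, hG u w m hm.2,
        add_zero]
  obtain ⟨F, hF⟩ := h2 (Coalgebra.comul (R := O) a)
  refine ⟨F, fun u w m hm => ?_⟩
  rw [torusMul, mul_assoc, mul_apply_eq_box]
  exact hF u w m hm

lemma mapForm_torusMul (u w : Form O A R) :
    mapForm ((AddMonoidAlgebra.lift R R M 1).restrictScalars O) (torusMul π u w) = u * w := by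
  have h1 : ∀ v : Form O A R, mapForm ((AddMonoidAlgebra.lift R R M 1).restrictScalars O)
      (mapForm (IsScalarTower.toAlgHom O R (AddMonoidAlgebra R M)) v) = v := fun v => by
    apply WithConv.ofConv_injective
    ext1 a
    exact (AddMonoidAlgebra.lift R R M 1).commutes (v a)
  have h2 : mapPts A ((AddMonoidAlgebra.lift R R M 1).restrictScalars O)
      (torusPt π (AddMonoidAlgebra.of R M)) = 1 := by
    rw [← map_one (torusPt π)]
    apply WithConv.ofConv_injective
    have h3 : ((AddMonoidAlgebra.lift R R M 1).restrictScalars O).comp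
        (AddMonoidAlgebra.lift O _ M (AddMonoidAlgebra.of R M)) = AddMonoidAlgebra.lift O R M 1 :=
      AddMonoidAlgebra.algHom_ext (fun m => by simp) (Subsingleton.elim _ _)
    ext1 a
    exact congrArg (fun f : AddMonoidAlgebra O M →ₐ[O] R => f (π a)) h3
  rw [torusMul, map_mul, map_mul, h1, h1, mapForm_ptForm, h2, map_one, mul_one]

/-- A root vector is locally nilpotent for convolution: conjugation by the universal point of the
torus multiplies its `n`-th power by the character `n γ`, whereas the weights occurring in the
value at a given function are bounded. -/
lemma lNil_castForm [IsAddTorsionFree M] {γ : M} (hγ : γ ≠ 0) {v : lie O A}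
    (hv : v ∈ weightSpace π γ) : LNil (castForm R v.1) := by
  classical
  intro a
  obtain ⟨F, hF⟩ := exists_finset_torusMul (R := R) π a
  have hinj : Function.Injective fun n : ℕ => n • γ := fun m n h => by
    have h' : (m : ℤ) • γ = (n : ℤ) • γ := by simpa only [natCast_zsmul] using h
    exact_mod_cast smul_left_injective ℤ hγ h'
  have hfin : ({n : ℕ | ∃ f ∈ F, ∃ g ∈ F, n • γ = f - g}).Finite := by
    refine Set.Finite.subset (Set.Finite.preimage hinj.injOn
      ((F ×ˢ F).image fun x => x.1 - x.2).finite_toSet) ?_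
    rintro n ⟨f, hf, g, hg, h⟩
    simp only [Set.mem_preimage, Finset.coe_image, Set.mem_image]
    exact ⟨(f, g), by simp [hf, hg], h.symm⟩
  obtain ⟨N, hN⟩ := hfin.bddAbove
  refine ⟨N + 1, fun n hn u w => ?_⟩
  set ι := IsScalarTower.toAlgHom O R (AddMonoidAlgebra R M)
  set τ := torusPt π (AddMonoidAlgebra.of R M : Multiplicative M →* AddMonoidAlgebra R M)
  set V := castForm (AddMonoidAlgebra R M) v.1
  have h1 : ptForm τ * V ^ n = (AddMonoidAlgebra.single (n • γ) (1 : R)) • (V ^ n * ptForm τ) := by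
    have h2 := conjForm_pow τ V n
    rw [conjForm_torusPt_of_mem π hv, smul_pow] at h2
    have h3 : AddMonoidAlgebra.of R M (Multiplicative.ofAdd γ) ^ n =
        AddMonoidAlgebra.single (n • γ) (1 : R) := by
      rw [AddMonoidAlgebra.of_apply, AddMonoidAlgebra.single_pow, one_pow]
      rfl
    rw [h3] at h2
    rw [← smul_mul_assoc, ← h2, conjForm, mul_assoc, ptForm_inv_mul, mul_one]
  have h4 : torusMul π u (castForm R v.1 ^ n * w) =
      AddMonoidAlgebra.single (n • γ) (1 : R) • torusMul π (u * castForm R v.1 ^ n) w := by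
    have h5 : mapForm ι (castForm R v.1) = V := mapForm_castForm _ _
    simp only [torusMul, map_mul, map_pow]
    change mapForm ι u * ptForm τ * (mapForm ι (castForm R v.1) ^ n * mapForm ι w) =
      _ • (mapForm ι u * mapForm ι (castForm R v.1) ^ n * ptForm τ * mapForm ι w)
    rw [h5]
    calc mapForm ι u * ptForm τ * (V ^ n * mapForm ι w)
        = mapForm ι u * (ptForm τ * V ^ n) * mapForm ι w := by simp only [mul_assoc]
      _ = _ := by rw [h1]; simp only [mul_smul_comm, smul_mul_assoc, mul_assoc]
  have h6 : torusMul π u (castForm R v.1 ^ n * w) a = 0 := by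
    apply AddMonoidAlgebra.coeff_injective
    ext m
    by_cases hm : m ∈ F
    · rw [h4]
      change (AddMonoidAlgebra.single (n • γ) (1 : R) *
        torusMul π (u * castForm R v.1 ^ n) w a).coeff m = 0
      have h7 : -(n • γ) + m ∉ F := fun h8 => by
        have := hN (show n ∈ {n : ℕ | ∃ f ∈ F, ∃ g ∈ F, n • γ = f - g} from
          ⟨m, hm, -(n • γ) + m, h8, by abel⟩)
        omega
      rw [AddMonoidAlgebra.coeff_single_mul_apply, hF (u * castForm R v.1 ^ n) w _ h7, mul_zero]
    · exact hF _ _ m hm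
  have h10 := mapForm_torusMul π u (castForm R v.1 ^ n * w)
  rw [mul_assoc, ← h10, mapForm_apply, h6, map_zero]

end WeightNilpotent

end GroupScheme

namespace GroupScheme

section DerForm

variable {O A R : Type*} [CommRing O] [CommRing A] [HopfAlgebra O A] [CommRing R] [Algebra O R]

/-- Post-composition of forms with a derivation of the ring of values. -/
def derForm (D : Derivation O R R) (v : Form O A R) : Form O A R :=
  toConv (D.toLinearMap ∘ₗ v.ofConv)

@[simp] lemma derForm_apply (D : Derivation O R R) (v : Form O A R) (a : A) :
    derForm D v a = D (v a) := rfl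

lemma derForm_mul (D : Derivation O R R) (v w : Form O A R) :
    derForm D (v * w) = derForm D v * w + v * derForm D w := by
  have key : ∀ t : A ⊗[O] A, D (box v w t) = box (derForm D v) w t + box v (derForm D w) t := by
    intro t
    induction t using TensorProduct.induction_on with
    | zero => simp
    | add x y hx hy => simp only [map_add, hx, hy]; ring
    | tmul b c =>
      simp only [box_tmul, derForm_apply, Derivation.leibniz, smul_eq_mul]
      ring
  apply WithConv.ofConv_injective
  ext1 a
  exact key (Coalgebra.comul (R := O) a)

lemma derForm_one (D : Derivation O R R) : derForm D (1 : Form O A R) = 0 := by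
  apply WithConv.ofConv_injective
  ext1 a
  exact D.map_algebraMap _

lemma derForm_pow (D : Derivation O R R) {X Z : Form O A R} (hZ : derForm D X = Z)
    (h : Commute Z X) (n : ℕ) : derForm D (X ^ (n + 1)) = (n + 1) • (Z * X ^ n) := by
  induction n with
  | zero => simp [hZ]
  | succ n ih =>
    have h1 := (h.pow_right (n + 1)).eq
    rw [pow_succ X (n + 1), derForm_mul, ih, hZ, smul_mul_assoc, mul_assoc, ← pow_succ, ← h1]
    simp only [add_smul, one_smul]

/-- The derivative of the exponential. -/
lemma derForm_expPt [Algebra ℚ R] (D : Derivation O R R) {X Z : Form O A R} (hd : IsDer X)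
    (hX : LNil X) (hZ : derForm D X = Z) (h : Commute Z X) :
    derForm D (ptForm (expPt hd hX)) = Z * ptForm (expPt hd hX) := by
  apply WithConv.ofConv_injective
  ext1 a
  obtain ⟨L, hL⟩ := exists_mul_expPt_mul hd hX a
  have h1 := hL L le_rfl Z 1
  have h2 := hL (L + 1) (by omega) 1 1
  rw [mul_one] at h1
  simp only [mul_one, one_mul] at h2
  have h3 : ∀ (n : ℕ) (x : R), D (invFact R n * x) = invFact R n * D x := fun n x => by
    rw [invFact, ← Algebra.smul_def, ← Algebra.smul_def]
    exact map_rat_smul D _ x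
  change D (ptForm (expPt hd hX) a) = (Z * ptForm (expPt hd hX)) a
  rw [h1, h2, map_sum, Finset.sum_range_succ', pow_zero]
  have h4 : D (invFact R 0 * (1 : Form O A R) a) = 0 := by
    rw [h3]
    have := congrArg (fun f : Form O A R => f a) (derForm_one (A := A) D)
    change D ((1 : Form O A R) a) = 0 at this
    rw [this, mul_zero]
  rw [h4, add_zero]
  refine Finset.sum_congr rfl fun m _ => ?_
  rw [h3, ← derForm_apply, derForm_pow D hZ h, mul_one]
  change invFact R (m + 1) * ((m + 1) • (Z * X ^ m) a) = _
  rw [nsmul_eq_mul, ← mul_assoc, mul_comm (invFact R (m + 1)), succ_mul_invFact]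

end DerForm

section VectorGroup

variable {O A M : Type*} [CommRing O] [CommRing A] [HopfAlgebra O A] [AddCommGroup M]

/-- A family of commuting root vectors, of distinct weights. -/
structure CommutingFamily (π : A →ₐc[O] AddMonoidAlgebra O M) (ι : Type*) where
  vec : ι → lie O A
  wt : ι → M
  wt_ne_zero : ∀ i, wt i ≠ 0
  wt_injective : Function.Injective wt
  vec_ne_zero : ∀ i, vec i ≠ 0
  vec_mem : ∀ i, vec i ∈ weightSpace π (wt i)
  lie_vec : ∀ i j, ⁅vec i, vec j⁆ = 0

namespace CommutingFamily

variable {π : A →ₐc[O] AddMonoidAlgebra O M} {ι : Type*} [Fintype ι] (F : CommutingFamily π ι)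
  {R S : Type*} [CommRing R] [Algebra O R] [CommRing S] [Algebra O S]

/-- The linear combination of a family of vectors with given coefficients. -/
def lin (r : ι → R) : Form O A R := ∑ i, r i • castForm R (F.vec i).1

omit [Fintype ι] in
lemma commute_vec (i j : ι) : Commute (castForm R (F.vec i).1) (castForm R (F.vec j).1) := by
  have h := congrArg Subtype.val (F.lie_vec i j)
  rw [lie_val, ZeroMemClass.coe_zero, sub_eq_zero] at h
  rw [Commute, SemiconjBy, ← map_mul, ← map_mul, h]

omit [Fintype ι] in
lemma commute_smul_vec (i j : ι) (r s : R) :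
    Commute (r • castForm R (F.vec i).1) (s • castForm R (F.vec j).1) := by
  rw [Commute, SemiconjBy]
  simp only [smul_mul_assoc, mul_smul_comm, (F.commute_vec i j).eq]
  rw [smul_comm]

lemma commute_lin (r s : ι → R) : Commute (F.lin r) (F.lin s) :=
  Commute.sum_left _ _ _ fun i _ => Commute.sum_right _ _ _ fun j _ => F.commute_smul_vec i j _ _

lemma isDer_lin (r : ι → R) : IsDer (F.lin r) :=
  IsDer.sum fun i _ => (isDer_castForm (F.vec i)).smul (r i)

lemma lNil_lin [IsAddTorsionFree M] (r : ι → R) : LNil (F.lin r) :=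
  LNil.sum (fun i _ => (lNil_castForm π (F.wt_ne_zero i) (F.vec_mem i)).smul (r i))
    fun i j => F.commute_smul_vec i j _ _

lemma lin_add (r s : ι → R) : F.lin (r + s) = F.lin r + F.lin s := by
  simp only [lin, Pi.add_apply, add_smul, Finset.sum_add_distrib]

lemma lin_zero : F.lin (0 : ι → R) = 0 := by
  simp only [lin, Pi.zero_apply, zero_smul, Finset.sum_const_zero]

lemma mapForm_lin (f : R →ₐ[O] S) (r : ι → R) : mapForm f (F.lin r) = F.lin (f ∘ r) := by
  simp only [lin, map_sum, mapForm_smul, mapForm_castForm, Function.comp_apply]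

lemma derForm_lin (D : Derivation O R R) (r : ι → R) : derForm D (F.lin r) = F.lin (D ∘ r) := by
  apply WithConv.ofConv_injective
  ext1 a
  have h : ∀ s : ι → R, F.lin s a = ∑ i, s i * algebraMap O R ((F.vec i).1 a) := fun s => by
    rw [lin, WithConv.ofConv_sum, LinearMap.sum_apply]
    rfl
  change D (F.lin r a) = F.lin (D ∘ r) a
  rw [h, h, map_sum]
  refine Finset.sum_congr rfl fun i _ => ?_
  rw [D.leibniz, D.map_algebraMap, smul_zero, zero_add, smul_eq_mul, mul_comm]
  rfl

lemma exists_lin_eq {v : Form O A R} (hv : v ∈ castSpan R (Set.range F.vec)) :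
    ∃ r, v = F.lin r := by
  induction hv using Submodule.span_induction with
  | mem x hx =>
    classical
    obtain ⟨_, ⟨i, rfl⟩, rfl⟩ := hx
    exact ⟨Pi.single i 1, by simp [lin, Pi.single_apply]⟩
  | zero => exact ⟨0, F.lin_zero.symm⟩
  | add x y _ _ hx hy =>
    obtain ⟨r, rfl⟩ := hx
    obtain ⟨s, rfl⟩ := hy
    exact ⟨r + s, (F.lin_add r s).symm⟩
  | smul c x _ hx =>
    obtain ⟨r, rfl⟩ := hx
    refine ⟨c • r, ?_⟩
    simp only [lin, Finset.smul_sum, smul_smul, Pi.smul_apply, smul_eq_mul]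

/-- Root vectors of distinct weights remain independent after an injective extension of scalars:
the torus acts on them through distinct characters. -/
lemma eq_zero_of_lin_eq_zero [IsDomain R] (hR : Function.Injective (algebraMap O R)) {c : ι → R}
    (hc : F.lin c = 0) : c = 0 := by
  classical
  funext i
  by_contra hi
  apply F.vec_ne_zero i
  apply Subtype.ext
  apply WithConv.ofConv_injective
  ext1 a
  have h1 := congrArg (mapForm (IsScalarTower.toAlgHom O R (AddMonoidAlgebra R M))) hc
  rw [map_zero, mapForm_lin] at h1
  have h2 : conjForm (torusPt π (AddMonoidAlgebra.of R M))
      (F.lin (IsScalarTower.toAlgHom O R (AddMonoidAlgebra R M) ∘ c)) a = 0 := by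
    rw [h1, conjForm, mul_zero, zero_mul]
    rfl
  rw [lin, conjForm_sum, WithConv.ofConv_sum, LinearMap.sum_apply] at h2
  have h3 : ∀ j, conjForm (torusPt π (AddMonoidAlgebra.of R M))
      ((IsScalarTower.toAlgHom O R (AddMonoidAlgebra R M) ∘ c) j •
        castForm (AddMonoidAlgebra R M) (F.vec j).1) a =
      AddMonoidAlgebra.single (F.wt j) (c j * algebraMap O R ((F.vec j).1 a)) := fun j => by
    rw [conjForm_smul, conjForm_torusPt_of_mem π (F.vec_mem j), AddMonoidAlgebra.of_apply]
    change algebraMap R (AddMonoidAlgebra R M) (c j) * (AddMonoidAlgebra.single (F.wt j) 1 *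
      algebraMap O (AddMonoidAlgebra R M) ((F.vec j).1 a)) = _
    rw [IsScalarTower.algebraMap_apply O R (AddMonoidAlgebra R M)]
    simp [AddMonoidAlgebra.single_mul_single]
  rw [Finset.sum_congr rfl fun j _ => h3 j] at h2
  have h4 := congrArg (fun f : AddMonoidAlgebra R M => f.coeff (F.wt i)) h2
  simp only [AddMonoidAlgebra.coeff_sum, Finsupp.finsetSum_apply, AddMonoidAlgebra.coeff_single,
    Finsupp.single_apply, F.wt_injective.eq_iff, Finset.sum_ite_eq', Finset.mem_univ, if_true,
    AddMonoidAlgebra.coeff_zero, Finsupp.zero_apply] at h4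
  have h5 := (mul_eq_zero.1 h4).resolve_left hi
  exact hR (h5.trans (map_zero _).symm)

variable [IsAddTorsionFree M] [Algebra ℚ R] [Algebra ℚ S]

/-- The point `exp (∑ rᵢ vᵢ)`. -/
def exp (r : ι → R) : Pts O A R := expPt (F.isDer_lin r) (F.lNil_lin r)

lemma exp_add (r s : ι → R) : F.exp (r + s) = F.exp r * F.exp s := by
  rw [exp, exp, exp, ← expPt_add _ _ _ _ (F.commute_lin r s)]
  exact expPt_congr _ _ _ _ (F.lin_add r s)

lemma exp_zero : F.exp (0 : ι → R) = 1 := by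
  rw [← expPt_zero]
  exact expPt_congr _ _ _ _ F.lin_zero

lemma exp_neg (r : ι → R) : F.exp (-r) = (F.exp r)⁻¹ := by
  rw [eq_inv_iff_mul_eq_one, ← exp_add, neg_add_cancel, exp_zero]

lemma mapPts_exp (f : R →ₐ[O] S) (r : ι → R) : mapPts A f (F.exp r) = F.exp (f ∘ r) := by
  rw [exp, mapPts_expPt _ _ f (by rw [mapForm_lin]; exact F.lNil_lin _)]
  exact expPt_congr _ _ _ _ (F.mapForm_lin f r)

lemma mul_exp_mul_inv {x : Pts O A R} {r s : ι → R} (h : conjForm x (F.lin r) = F.lin s) :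
    x * F.exp r * x⁻¹ = F.exp s := by
  rw [exp, mul_expPt_mul_inv]
  exact expPt_congr _ _ _ _ h

lemma derForm_exp (D : Derivation O R R) (r : ι → R) :
    derForm D (ptForm (F.exp r)) = F.lin (D ∘ r) * ptForm (F.exp r) :=
  derForm_expPt D _ _ (F.derForm_lin D r) (F.commute_lin _ _)

end CommutingFamily

end VectorGroup

end GroupScheme

/-! ### Extension of the base field -/

namespace GroupScheme

section BaseChange

variable {O k A R S : Type*} [CommRing O] [CommRing A] [HopfAlgebra O A] [Field k] [Algebra O k]
  [CommRing R] [Algebra O R] [Algebra k R] [IsScalarTower O k R]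
  [CommRing S] [Algebra O S] [Algebra k S] [IsScalarTower O k S]

/-- The restriction of forms on the coordinate ring of a base change to the original coordinate
ring. -/
def resForm : Form k (k ⊗[O] A) R →+* Form O A R where
  toFun v := toConv ((v.ofConv.restrictScalars O) ∘ₗ
    (Algebra.TensorProduct.includeRight : A →ₐ[O] k ⊗[O] A).toLinearMap)
  map_one' := by
    apply WithConv.ofConv_injective
    ext1 a
    change algebraMap k R (Coalgebra.counit (R := k) ((1 : k) ⊗ₜ[O] a)) =
      algebraMap O R (Coalgebra.counit (R := O) a)
    rw [TensorProduct.counit_tmul, IsScalarTower.algebraMap_apply O k R]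
    simp [Algebra.algebraMap_eq_smul_one]
  map_mul' v w := by
    apply WithConv.ofConv_injective
    ext1 a
    have h := congrArg (fun f : A →+* (k ⊗[O] A) ⊗[k] (k ⊗[O] A) => f a)
      (Bialgebra.comul_includeRight (R := O) (A := k) (B := A))
    have h' : Coalgebra.comul (R := k) ((1 : k) ⊗ₜ[O] a) = Algebra.TensorProduct.mapRingHom
        (algebraMap O k) (RingHomClass.toRingHom (Algebra.TensorProduct.includeRight (A := k)))
        (RingHomClass.toRingHom (Algebra.TensorProduct.includeRight (A := k)))
        (by simp [← IsScalarTower.algebraMap_eq]) (by simp [← IsScalarTower.algebraMap_eq])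
        (Coalgebra.comul (R := O) a) := h
    change box v w (Coalgebra.comul (R := k) ((1 : k) ⊗ₜ[O] a)) = _
    rw [h', mul_apply_eq_box]
    generalize Coalgebra.comul (R := O) a = t
    induction t using TensorProduct.induction_on with
    | zero => simp
    | add x y hx hy => rw [map_add, map_add, map_add, hx, hy]
    | tmul b c =>
      rw [Algebra.TensorProduct.mapRingHom_tmul]
      rfl
  map_zero' := rfl
  map_add' v w := rfl

lemma resForm_apply (v : Form k (k ⊗[O] A) R) (a : A) : resForm v a = v (1 ⊗ₜ a) := rfl

/-- The restriction of points of a base change to points of the original group. -/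
def resPts : Pts k (k ⊗[O] A) R →* Pts O A R where
  toFun x := toConv ((x.ofConv.restrictScalars O).comp Algebra.TensorProduct.includeRight)
  map_one' := by
    apply ptForm_injective
    rw [map_one]
    exact map_one (resForm : Form k (k ⊗[O] A) R →+* Form O A R)
  map_mul' x y := by
    apply ptForm_injective
    rw [map_mul]
    exact map_mul (resForm : Form k (k ⊗[O] A) R →+* Form O A R) (ptForm x) (ptForm y)

lemma resForm_ptForm (x : Pts k (k ⊗[O] A) R) : resForm (ptForm x) = ptForm (resPts x) := rfl

lemma resPts_injective :
    Function.Injective (resPts : Pts k (k ⊗[O] A) R → Pts O A R) := fun x y h => by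
  apply WithConv.ofConv_injective
  refine Algebra.TensorProduct.ext (Subsingleton.elim _ _) (AlgHom.ext fun a => ?_)
  exact congrArg (fun z : Pts O A R => z.ofConv a) h

lemma mapPts_resPts (f : R →ₐ[k] S) (x : Pts k (k ⊗[O] A) R) :
    resPts (mapPts _ f x) = mapPts A (f.restrictScalars O) (resPts x) := rfl

variable (k) in
/-- The extension of a point to the base change. -/
def extPts (x : Pts O A R) : Pts k (k ⊗[O] A) R :=
  toConv (Algebra.TensorProduct.lift (Algebra.ofId k R) x.ofConv fun _ _ => Commute.all _ _)

@[simp] lemma resPts_extPts (x : Pts O A R) : resPts (extPts k x) = x := by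
  apply WithConv.ofConv_injective
  ext a
  simp [resPts, extPts]

end BaseChange

section Translation

variable {k B : Type*} [Field k] [CommRing B] [HopfAlgebra k B]

/-- The powers of `f ↦ (x ↦ f (x g) - f x)` in terms of convolution. -/
lemma rightTranslation_sub_one_pow (g : B →ₐ[k] k) (n : ℕ) (f : B) :
    ((rightTranslation g - 1) ^ n) f = (ptForm (toConv (AlgHom.id k B)) *
      castForm B (ptForm (toConv g) - 1) ^ n : Form k B B) f := by
  set u : Form k B B := ptForm (toConv (AlgHom.id k B))
  have h1 : ∀ (h : Module.End k B) (v : Form k B B) (w : Dist k B),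
      toConv (h ∘ₗ v.ofConv) * castForm B w = toConv (h ∘ₗ (v * castForm B w).ofConv) := by
    intro h v w
    have key : ∀ t : B ⊗[k] B, box (toConv (h ∘ₗ v.ofConv)) (castForm B w) t =
        h (box v (castForm B w) t) := by
      intro t
      induction t using TensorProduct.induction_on with
      | zero => simp
      | add x y hx hy => simp only [map_add, hx, hy]
      | tmul b c =>
        change h (v b) * algebraMap k B (w c) = h (v b * algebraMap k B (w c))
        rw [mul_comm, mul_comm (v b), ← Algebra.smul_def, ← Algebra.smul_def, map_smul]
    apply WithConv.ofConv_injective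
    ext1 b
    exact key _
  have h2 : toConv (rightTranslation g - 1) = u * castForm B (ptForm (toConv g) - 1) := by
    rw [map_sub, map_one, mul_sub, mul_one]
    rfl
  induction n generalizing f with
  | zero => simp only [pow_zero, mul_one]; rfl
  | succ n ih =>
    rw [pow_succ', pow_succ' (castForm B _), ← mul_assoc, ← h2, ← map_pow]
    have h3 := congrArg (fun v : Form k B B => v f)
      (h1 (rightTranslation g - 1) u ((ptForm (toConv g) - 1) ^ n))
    change _ = (toConv ((rightTranslation g - 1) ∘ₗ u.ofConv) * _ : Form k B B) f
    refine Eq.trans ?_ h3.symm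
    change (rightTranslation g - 1) (((rightTranslation g - 1) ^ n) f) = _
    rw [ih, ← map_pow]
    rfl

end Translation

/-! ### The image of a vector group -/

namespace CommutingFamily

open MvPolynomial

variable {O A M : Type*} [CommRing O] [CommRing A] [HopfAlgebra O A] [AddCommGroup M]
  [IsAddTorsionFree M] {π : A →ₐc[O] AddMonoidAlgebra O M} {ι : Type*} [Fintype ι]
  (F : CommutingFamily π ι) (k : Type*) [Field k] [CharZero k] [Algebra O k]

/-- The homomorphism from the vector group with coordinates indexed by `ι` to the group, on
coordinate rings: the exponential of the generic linear combination. -/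
def gen : k ⊗[O] A →ₐ[k] MvPolynomial ι k := (extPts k (F.exp X)).ofConv

lemma gen_tmul (a : A) : F.gen k (1 ⊗ₜ a) = (F.exp (X : ι → MvPolynomial ι k)).ofConv a := by
  change ((resPts (extPts k (F.exp X))).ofConv a : MvPolynomial ι k) = _
  rw [resPts_extPts]

section

variable {k} {R : Type*} [CommRing R] [Algebra O R] [Algebra k R] [IsScalarTower O k R]
  [Algebra ℚ R]

lemma extPts_exp (r : ι → R) : (extPts k (F.exp r)).ofConv = (aeval r).comp (F.gen k) := by
  have h : extPts k (F.exp r) = mapPts _ (aeval r) (toConv (F.gen k)) := by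
    apply resPts_injective
    rw [mapPts_resPts, resPts_extPts, gen, WithConv.toConv_ofConv, resPts_extPts, mapPts_exp]
    congr 1
    funext i
    simp
  rw [h]
  rfl

/-- A point of `G` expressed as an exponential lies on the image of the vector group. -/
lemma apply_eq_zero_of_resPts_eq {x : Pts k (k ⊗[O] A) R} {r : ι → R} (hx : resPts x = F.exp r)
    {f : k ⊗[O] A} (hf : F.gen k f = 0) : x.ofConv f = 0 := by
  have h : x = extPts k (F.exp r) := resPts_injective (hx.trans (resPts_extPts _).symm)
  rw [h, extPts_exp, AlgHom.comp_apply, hf, map_zero]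

end

/-- The homomorphism from the vector group is a closed immersion: the image on coordinate rings is
stable under the partial derivatives, and separates tangent vectors at the origin because the
root vectors are independent. -/
lemma gen_surjective (hO : Function.Injective (algebraMap O k)) :
    Function.Surjective (F.gen k) := by
  classical
  rw [← AlgHom.range_eq_top]
  set e : Pts O A (MvPolynomial ι k) := F.exp X
  have h0 : ∀ (a : A) (c : k), c • (e.ofConv a : MvPolynomial ι k) ∈ (F.gen k).range := fun a c =>
    Subalgebra.smul_mem _ ((F.gen k).mem_range.2 ⟨1 ⊗ₜ a, F.gen_tmul k a⟩) c
  have hD : ∀ (i : ι) (a : A), pderiv i (e.ofConv a) =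
      (castForm _ (F.vec i).1 * ptForm e : Form O A (MvPolynomial ι k)) a := fun i a => by
    have h1 := congrArg (fun v : Form O A (MvPolynomial ι k) => v a)
      (F.derForm_exp ((pderiv i : Derivation k _ _).restrictScalars O)
        (X : ι → MvPolynomial ι k))
    have h2 : F.lin ((pderiv i : Derivation k _ _).restrictScalars O ∘
        (X : ι → MvPolynomial ι k)) = castForm _ (F.vec i).1 := by
      rw [lin, Finset.sum_eq_single i]
      · simp
      · intro j _ hj
        simp [pderiv_X_of_ne hj]
      · simp
    rw [h2] at h1
    exact h1
  refine eq_top_of_pderiv_mem _ ?_ ?_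
  · rintro _ ⟨f, rfl⟩ i
    induction f using TensorProduct.induction_on with
    | zero => simp
    | add x y hx hy =>
      simp only [map_add]
      exact Subalgebra.add_mem _ hx hy
    | tmul c a =>
      have h1 : c ⊗ₜ[O] a = c • ((1 : k) ⊗ₜ[O] a) := by simp [TensorProduct.smul_tmul']
      have h2 : ∀ t : A ⊗[O] A, box (castForm (MvPolynomial ι k) (F.vec i).1) (ptForm e) t ∈
          (F.gen k).range := by
        intro t
        induction t using TensorProduct.induction_on with
        | zero => simp
        | add x y hx hy =>
          rw [map_add]
          exact Subalgebra.add_mem _ hx hy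
        | tmul b d =>
          rw [box_tmul, castForm_apply, IsScalarTower.algebraMap_apply O k, ← Algebra.smul_def]
          exact h0 d _
      change pderiv i (F.gen k (c ⊗ₜ[O] a)) ∈ _
      rw [h1, map_smul, Derivation.map_smul, gen_tmul, hD]
      exact Subalgebra.smul_mem _ (h2 _) c
  · intro c hc
    refine F.eq_zero_of_lin_eq_zero hO ?_
    apply WithConv.ofConv_injective
    ext1 a
    have h1 : ∑ i, c i * diffZero (e.ofConv a) i = 0 :=
      hc _ ((F.gen k).mem_range.2 ⟨1 ⊗ₜ a, F.gen_tmul k a⟩)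
    let ev : MvPolynomial ι k →ₐ[O] k := (aeval (0 : ι → k)).restrictScalars O
    have h2 : ∀ i, diffZero (e.ofConv a) i = algebraMap O k ((F.vec i).1 a) := fun i => by
      have h3 : mapPts A ev e = 1 := by
        rw [mapPts_exp, ← F.exp_zero]
        congr 1
        funext j
        simp [ev]
      have h4 := congrArg (fun v : Form O A k => v a) (congrArg₂ (· * ·)
        (mapForm_castForm ev (F.vec i).1)
        ((mapForm_ptForm ev e).trans (congrArg ptForm h3)))
      simp only [← map_mul, map_one, mul_one, mapForm_apply, castForm_apply] at h4
      rw [← h4, diffZero, hD]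
      simp [ev, aeval_zero]
    rw [Finset.sum_congr rfl fun i _ => by rw [h2]] at h1
    rw [lin, WithConv.ofConv_sum, LinearMap.sum_apply]
    exact h1

end CommutingFamily

end GroupScheme

/-! ### Vector groups in reductive groups -/

namespace GroupScheme

namespace CommutingFamily

open MvPolynomial

variable {O A M : Type*} [CommRing O] [CommRing A] [HopfAlgebra O A] [AddCommGroup M]
  [IsAddTorsionFree M] {π : A →ₐc[O] AddMonoidAlgebra O M} {ι : Type*} [Fintype ι]
  (F : CommutingFamily π ι) (k : Type*) [Field k] [CharZero k] [Algebra O k]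

/-- The ideal of the image of the vector group in the geometric fibre. -/
def genIdeal : Ideal (k ⊗[O] A) := RingHom.ker (F.gen k)

variable {k}

lemma mem_genIdeal {f : k ⊗[O] A} : f ∈ F.genIdeal k ↔ F.gen k f = 0 := RingHom.mem_ker

/-- The points of the image of the vector group are the exponentials. -/
lemma exists_resPts_eq (hO : Function.Injective (algebraMap O k)) {R : Type*} [CommRing R]
    [Algebra O R] [Algebra k R] [IsScalarTower O k R] [Algebra ℚ R] (x : Pts k (k ⊗[O] A) R)
    (hx : ∀ f ∈ F.genIdeal k, x.ofConv f = 0) : ∃ r, resPts x = F.exp r := by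
  let q := Ideal.Quotient.liftₐ (RingHom.ker (F.gen k)) x.ofConv hx
  let s := Ideal.quotientKerAlgEquivOfSurjective (F.gen_surjective k hO)
  refine ⟨fun i => q (s.symm (X i)), ?_⟩
  suffices hx' : x = extPts k (F.exp fun i => q (s.symm (X i))) by
    rw [hx', resPts_extPts]
  apply WithConv.ofConv_injective
  rw [extPts_exp]
  have h1 : aeval (fun i => q (s.symm (X i))) = q.comp s.symm.toAlgHom := by
    ext i
    simp
  rw [h1]
  refine AlgHom.ext fun f => ?_
  have h2 : s.symm (F.gen k f) = Ideal.Quotient.mk _ f := by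
    rw [AlgEquiv.symm_apply_eq]
    rfl
  change x.ofConv f = q (s.symm (F.gen k f))
  rw [h2]
  rfl

lemma isHopfIdeal_genIdeal : (F.genIdeal k).IsHopfIdeal k where
  counit_eq_zero f hf := by
    have hf' : F.gen k f = 0 := hf
    exact F.apply_eq_zero_of_resPts_eq (R := k) (x := 1) (r := 0)
      (by rw [map_one, exp_zero]) hf'
  map_mkQ_comul_eq_zero f hf := by
    have hf' : F.gen k f = 0 := hf
    set I := (F.genIdeal k).restrictScalars k
    let j : (k ⊗[O] A ⧸ I) →ₗ[k] MvPolynomial ι k := I.liftQ (F.gen k).toLinearMap fun g hg => hg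
    have hj : Function.Injective j := by
      rw [← LinearMap.ker_eq_bot]
      exact Submodule.ker_liftQ_eq_bot _ _ _ fun g hg => hg
    apply TensorProduct.map_injective_of_flat_flat j j hj hj
    rw [map_zero, ← LinearMap.comp_apply, ← TensorProduct.map_comp]
    have h1 : j ∘ₗ I.mkQ = (F.gen k).toLinearMap := Submodule.liftQ_mkQ _ _ _
    rw [h1]
    let P2 := MvPolynomial ι k ⊗[k] MvPolynomial ι k
    let iL : MvPolynomial ι k →ₐ[k] P2 := Algebra.TensorProduct.includeLeft
    let iR : MvPolynomial ι k →ₐ[k] P2 := Algebra.TensorProduct.includeRight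
    let : Algebra ℚ P2 := ((algebraMap k P2).comp (algebraMap ℚ k)).toAlgebra
    let x : Pts k (k ⊗[O] A) P2 :=
      mapPts _ iL (toConv (F.gen k)) * mapPts _ iR (toConv (F.gen k))
    have h2 : x.ofConv f = TensorProduct.map (F.gen k).toLinearMap (F.gen k).toLinearMap
        (Coalgebra.comul (R := k) f) := by
      change box (ptForm (mapPts _ iL (toConv (F.gen k))))
        (ptForm (mapPts _ iR (toConv (F.gen k)))) (Coalgebra.comul (R := k) f) = _
      generalize Coalgebra.comul (R := k) f = t
      induction t using TensorProduct.induction_on with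
      | zero => simp
      | add x y hx hy => rw [map_add, map_add, hx, hy]
      | tmul b c =>
        change (F.gen k b ⊗ₜ[k] 1) * (1 ⊗ₜ[k] F.gen k c) = F.gen k b ⊗ₜ[k] F.gen k c
        rw [Algebra.TensorProduct.tmul_mul_tmul, mul_one, one_mul]
    rw [← h2]
    refine F.apply_eq_zero_of_resPts_eq (r := iL ∘ X + iR ∘ X) ?_ hf'
    rw [map_mul, mapPts_resPts, mapPts_resPts, gen, WithConv.toConv_ofConv, resPts_extPts,
      mapPts_exp, mapPts_exp, ← exp_add]
    rfl
  antipode_mem f hf := by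
    have hf' : F.gen k f = 0 := hf
    refine F.apply_eq_zero_of_resPts_eq (x := (toConv (F.gen k))⁻¹) (r := -X) ?_ hf'
    rw [map_inv, gen, WithConv.toConv_ofConv, resPts_extPts, exp_neg]

/-- The image of the vector group is normal as soon as conjugation preserves the span of the
root vectors. -/
lemma univConj_genIdeal (hO : Function.Injective (algebraMap O k))
    (h : ∀ (x : Pts O A ((k ⊗[O] A) ⊗[k] ((k ⊗[O] A) ⧸ F.genIdeal k))) i,
      conjForm x (castForm _ (F.vec i).1) ∈ castSpan _ (Set.range F.vec)) :
    ∀ f ∈ F.genIdeal k, (univConj (k := k) (F.genIdeal k)).ofConv f = 0 := by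
  intro f hf
  let B := k ⊗[O] A
  let R := B ⊗[k] (B ⧸ F.genIdeal k)
  let : Algebra ℚ R := ((algebraMap k R).comp (algebraMap ℚ k)).toAlgebra
  let x : Pts k B R := toConv Algebra.TensorProduct.includeLeft
  let n : Pts k B R :=
    toConv (Algebra.TensorProduct.includeRight.comp (Ideal.Quotient.mkₐ k (F.genIdeal k)))
  obtain ⟨r, hr⟩ := F.exists_resPts_eq hO n fun g hg => by
    have h0 : Ideal.Quotient.mkₐ k (F.genIdeal k) g = 0 := Ideal.Quotient.eq_zero_iff_mem.2 hg
    change Algebra.TensorProduct.includeRight (Ideal.Quotient.mkₐ k (F.genIdeal k) g) = (0 : R)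
    rw [h0, map_zero]
  obtain ⟨s, hs⟩ : ∃ s, conjForm (resPts x) (F.lin r) = F.lin s := by
    apply F.exists_lin_eq
    rw [lin, conjForm_sum]
    refine Submodule.sum_mem _ fun i _ => ?_
    rw [conjForm_smul]
    exact Submodule.smul_mem _ _ (h _ i)
  refine F.apply_eq_zero_of_resPts_eq (x := x * n * x⁻¹) (r := s) ?_ hf
  rw [map_mul, map_mul, map_inv, hr, F.mul_exp_mul_inv hs]

/-- Points in the image of the vector group are exponentials of locally nilpotent derivations. -/
lemma isUnipotentPoint_of_genIdeal (hO : Function.Injective (algebraMap O k))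
    (g : k ⊗[O] A →ₐ[k] k) (hg : ∀ f ∈ F.genIdeal k, g f = 0) : IsUnipotentPoint g := by
  obtain ⟨r, hr⟩ := F.exists_resPts_eq hO (toConv g) hg
  let B := k ⊗[O] A
  let : Algebra ℚ B := ((algebraMap k B).comp (algebraMap ℚ k)).toAlgebra
  have key : ∀ f : B, ∃ N, ∀ n, N ≤ n → (ptForm (toConv (AlgHom.id k B)) *
      castForm B (ptForm (toConv g) - 1) ^ n : Form k B B) f = 0 := by
    intro f
    induction f using TensorProduct.induction_on with
    | zero => exact ⟨0, fun n _ => map_zero _⟩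
    | add x y hx hy =>
      obtain ⟨N, hN⟩ := hx
      obtain ⟨K, hK⟩ := hy
      refine ⟨max N K, fun n hn => ?_⟩
      rw [map_add, hN n ((le_max_left _ _).trans hn), hK n ((le_max_right _ _).trans hn), add_zero]
    | tmul c a =>
      obtain ⟨N, hN⟩ := exists_mul_expPt_sub_one_pow (F.isDer_lin (R := B) (algebraMap k B ∘ r))
        (F.lNil_lin _) a
      refine ⟨N, fun n hn => ?_⟩
      have h1 : c ⊗ₜ[O] a = c • ((1 : k) ⊗ₜ[O] a) := by simp [TensorProduct.smul_tmul']
      have h2 : resForm (castForm B (ptForm (toConv g) - 1)) =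
          ptForm (F.exp (algebraMap k B ∘ r)) - 1 := by
        have h3 : castForm B (ptForm (toConv g)) =
            ptForm (mapPts _ (Algebra.ofId k B) (toConv g)) := rfl
        rw [map_sub, map_one, map_sub, map_one, h3, resForm_ptForm, mapPts_resPts, hr, mapPts_exp]
        rfl
      rw [h1, map_smul, ← resForm_apply, map_mul, map_pow, h2]
      exact (congrArg (c • ·) (hN n hn _)).trans (smul_zero c)
  intro f
  obtain ⟨N, hN⟩ := key f
  exact ⟨N, (rightTranslation_sub_one_pow g N f).trans (hN N le_rfl)⟩

/-- A connected reductive group contains no normal vector group spanned by root vectors. -/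
theorem isEmpty_of_isConnectedReductive (hO : Function.Injective (algebraMap O k))
    (hG : IsConnectedReductive k (k ⊗[O] A))
    (h : ∀ (x : Pts O A ((k ⊗[O] A) ⊗[k] ((k ⊗[O] A) ⧸ F.genIdeal k))) i,
      conjForm x (castForm _ (F.vec i).1) ∈ castSpan _ (Set.range F.vec)) : IsEmpty ι := by
  let e := Ideal.quotientKerAlgEquivOfSurjective (F.gen_surjective k hO)
  have : Algebra.Smooth k (MvPolynomial ι k) := ⟨inferInstance, inferInstance⟩
  have hsm : Algebra.Smooth k (k ⊗[O] A ⧸ F.genIdeal k) := Algebra.Smooth.of_equiv e.symm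
  have : IsDomain (k ⊗[O] A ⧸ F.genIdeal k) := e.toMulEquiv.isDomain _
  have hcon : ConnectedSpace (PrimeSpectrum (k ⊗[O] A ⧸ F.genIdeal k)) :=
    haveI := PrimeSpectrum.irreducibleSpace (R := k ⊗[O] A ⧸ F.genIdeal k)
    IrreducibleSpace.connectedSpace _
  have h1 := hG.radical (F.genIdeal k) F.isHopfIdeal_genIdeal hsm hcon
    (F.univConj_genIdeal hO h) (F.isUnipotentPoint_of_genIdeal hO)
  refine ⟨fun i => ?_⟩
  obtain ⟨f, hf⟩ := F.gen_surjective k hO (X i)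
  have h2 : f - algebraMap k _ (Coalgebra.counit (R := k) f) ∈ F.genIdeal k := by
    rw [h1, RingHom.mem_ker, map_sub, AlgHom.commutes]
    exact sub_self _
  rw [mem_genIdeal, map_sub, hf, AlgHom.commutes, sub_eq_zero] at h2
  have h3 := congrArg (pderiv i) h2
  rw [pderiv_X_self, Derivation.map_algebraMap] at h3
  exact one_ne_zero h3

end CommutingFamily

end GroupScheme

/-! ### Roots are stable under negation -/

namespace GroupScheme

namespace ChevalleyBasis

variable {O A M : Type*} [CommRing O] [IsDomain O] [IsPrincipalIdealRing O] [CharZero O]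
  [CommRing A] [HopfAlgebra O A] [Algebra.FiniteType O A] [AddCommGroup M] [IsAddTorsionFree M]
  {π : A →ₐc[O] AddMonoidAlgebra O M} {Δ : Set M} (C : ChevalleyBasis π Δ)
  (k : Type*) [Field k] [Algebra O k]

include C in
/-- The roots of a group with a reductive geometric fibre are stable under negation. -/
theorem neg_mem_roots (hO : Function.Injective (algebraMap O k))
    (hG : IsConnectedReductive k (k ⊗[O] A)) (α : roots π) : -(α : M) ∈ roots π := by
  classical
  have : CharZero k := charZero_of_injective_algebraMap hO
  by_contra hα
  obtain ⟨S, ⟨γ, hγ⟩, hcomm, hS⟩ := C.exists_stable_abelian ⟨α, hα⟩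
  have : Finite (roots π) := (finite_roots (A := A) π).to_subtype
  let : Fintype S := Fintype.ofFinite S
  let F : CommutingFamily π S :=
    { vec := fun α => C.X α.1
      wt := fun α => α.1.1
      wt_ne_zero := fun α => C.ne_zero α.1
      wt_injective := fun α β h => Subtype.ext (Subtype.ext h)
      vec_ne_zero := fun α => C.X_ne_zero α.1
      vec_mem := fun α => C.X_mem_weightSpace α.1
      lie_vec := fun α β => hcomm _ α.2 _ β.2 }
  have h1 : Set.range F.vec = C.X '' S := by
    ext v
    simp [F]
  refine (F.isEmpty_of_isConnectedReductive hO hG fun x i => ?_).false ⟨γ, hγ⟩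
  rw [h1]
  refine hS _ (fun c hc => ?_) x _ i.2
  rw [IsScalarTower.algebraMap_apply O k]
  exact (IsUnit.mk0 _ ((map_ne_zero_iff _ hO).2 hc)).map _

end ChevalleyBasis

end GroupScheme

/-! ### Combinatorics of roots and coroots -/

namespace GroupScheme

/-- A finite system of roots `rt i` and coroots `co i`. The axioms are the properties of roots of a
split reductive group that enter the estimates below, rather than the usual stability under
reflections: `exists_sub` is a piece of the root string property, and `trace` says that for the form
`∑ γ(x) γ(y)`, summed over the roots `γ`, the coroot `co j` represents `rt j` up to a factor. -/
structure CorootSystem (ι M : Type*) [Fintype ι] [AddCommGroup M] where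
  rt : ι → M
  co : ι → M →+ ℤ
  neg : ι → ι
  rt_neg : ∀ i, rt (neg i) = -rt i
  rt_injective : Function.Injective rt
  co_self : ∀ i, co i (rt i) = 2
  exists_sub : ∀ i j, i ≠ j → 0 < co j (rt i) → ∃ l, rt l = rt i - rt j
  trace : ∀ j (y : M →+ ℤ),
    2 * ∑ i, co j (rt i) * y (rt i) = (∑ i, co j (rt i) ^ 2) * y (rt j)
  rt_ne_double : ∀ i j, rt i ≠ rt j + rt j

namespace CorootSystem

variable {ι M : Type*} [Fintype ι] [AddCommGroup M] (D : CorootSystem ι M)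

/-- The value of the invariant form at a coroot. -/
def norm (j : ι) : ℤ := ∑ i, D.co j (D.rt i) ^ 2

lemma norm_pos (j : ι) : 0 < D.norm j := by
  refine Finset.sum_pos' (fun i _ => sq_nonneg _) ⟨j, Finset.mem_univ j, ?_⟩
  rw [D.co_self]
  norm_num

lemma two_mul_sum_co (i j : ι) :
    2 * ∑ l, D.co i (D.rt l) * D.co j (D.rt l) = D.norm i * D.co j (D.rt i) := D.trace i (D.co j)

lemma norm_mul_co (i j : ι) : D.norm i * D.co j (D.rt i) = D.norm j * D.co i (D.rt j) := by
  rw [← two_mul_sum_co, ← two_mul_sum_co]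
  simp only [mul_comm]

lemma co_pos {i j : ι} (h : 0 < D.co j (D.rt i)) : 0 < D.co i (D.rt j) := by
  have h1 := D.norm_mul_co i j
  have h2 : 0 < D.norm i * D.co j (D.rt i) := mul_pos (D.norm_pos i) h
  rw [h1] at h2
  exact pos_of_mul_pos_right h2 (D.norm_pos j).le

/-- Bessel's inequality for a family of coroots at pairwise non-acute angles. -/
lemma sum_sq_le (j : ι) (F : Finset ι) (hF : ∀ i ∈ F, 0 < D.co j (D.rt i))
    (hF' : ∀ i ∈ F, ∀ l ∈ F, i ≠ l → D.co l (D.rt i) ≤ 0) :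
    ∑ m, (2 * D.co j (D.rt m) - ∑ i ∈ F, D.co j (D.rt i) * D.co i (D.rt m)) ^ 2 ≤
      D.norm j * (4 - ∑ i ∈ F, D.co j (D.rt i) * D.co i (D.rt j)) := by
  classical
  set f : ι → ι → ℤ := fun i m => D.co i (D.rt m)
  have hB : ∀ a b, 2 * ∑ m, f a m * f b m = D.norm a * f b a := fun a b => D.two_mul_sum_co a b
  have hS : ∀ a b, D.norm a * f b a = D.norm b * f a b := fun a b => D.norm_mul_co a b
  have e1 : ∑ m, (2 * f j m - ∑ i ∈ F, f j i * f i m) ^ 2 =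
      4 * ∑ m, f j m * f j m - 4 * ∑ i ∈ F, f j i * ∑ m, f j m * f i m +
        ∑ i ∈ F, ∑ l ∈ F, f j i * f j l * ∑ m, f i m * f l m := by
    have e2 : ∀ m, (2 * f j m - ∑ i ∈ F, f j i * f i m) ^ 2 = 4 * (f j m * f j m) -
        4 * ∑ i ∈ F, f j i * (f j m * f i m) +
        ∑ i ∈ F, ∑ l ∈ F, f j i * f j l * (f i m * f l m) := fun m => by
      have e3 : ∑ i ∈ F, ∑ l ∈ F, f j i * f j l * (f i m * f l m) =
          (∑ i ∈ F, f j i * f i m) * ∑ l ∈ F, f j l * f l m := by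
        rw [Finset.sum_mul_sum]
        exact Finset.sum_congr rfl fun i _ => Finset.sum_congr rfl fun l _ => by ring
      have e4 : ∑ i ∈ F, f j i * (f j m * f i m) = f j m * ∑ i ∈ F, f j i * f i m := by
        rw [Finset.mul_sum]
        exact Finset.sum_congr rfl fun i _ => by ring
      rw [e3, e4]
      ring
    have e14 : ∑ m, ∑ i ∈ F, f j i * (f j m * f i m) = ∑ i ∈ F, f j i * ∑ m, f j m * f i m := by
      rw [Finset.sum_comm]
      simp only [Finset.mul_sum]
    have e15 : ∑ m, ∑ i ∈ F, ∑ l ∈ F, f j i * f j l * (f i m * f l m) =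
        ∑ i ∈ F, ∑ l ∈ F, f j i * f j l * ∑ m, f i m * f l m := by
      rw [Finset.sum_comm]
      refine Finset.sum_congr rfl fun i _ => ?_
      rw [Finset.sum_comm]
      simp only [Finset.mul_sum]
    rw [Finset.sum_congr rfl fun m _ => e2 m, Finset.sum_add_distrib, Finset.sum_sub_distrib,
      ← Finset.mul_sum, ← Finset.mul_sum, e14, e15]
  have e5 : ∑ i ∈ F, ∑ l ∈ F, f j i * f j l * (2 * ∑ m, f i m * f l m) ≤
      ∑ i ∈ F, f j i * (2 * (D.norm j * f i j)) := by
    refine Finset.sum_le_sum fun i hi => ?_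
    rw [← Finset.add_sum_erase F _ hi]
    have e6 : ∑ l ∈ F.erase i, f j i * f j l * (2 * ∑ m, f i m * f l m) ≤ 0 := by
      refine Finset.sum_nonpos fun l hl => ?_
      obtain ⟨hl1, hl2⟩ := Finset.mem_erase.1 hl
      rw [hB]
      exact mul_nonpos_of_nonneg_of_nonpos (mul_nonneg (hF i hi).le (hF l hl2).le)
        (mul_nonpos_of_nonneg_of_nonpos (D.norm_pos i).le (hF' i hi l hl2 hl1.symm))
    have e7 : f j i * f j i * (2 * ∑ m, f i m * f i m) = f j i * (2 * (D.norm j * f i j)) := by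
      have h2 : f i i = 2 := D.co_self i
      rw [hB, h2, hS j i]
      ring
    rw [e7]
    linarith
  have e8 : ∑ i ∈ F, f j i * (2 * ∑ m, f j m * f i m) = ∑ i ∈ F, f j i * (D.norm j * f i j) :=
    Finset.sum_congr rfl fun i _ => by rw [hB]
  have e9 : ∑ i ∈ F, f j i * (2 * (D.norm j * f i j)) =
      2 * (D.norm j * ∑ i ∈ F, f j i * f i j) := by
    simp only [Finset.mul_sum]
    exact Finset.sum_congr rfl fun i _ => by ring
  have e10 : ∑ i ∈ F, f j i * (D.norm j * f i j) = D.norm j * ∑ i ∈ F, f j i * f i j := by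
    simp only [Finset.mul_sum]
    exact Finset.sum_congr rfl fun i _ => by ring
  have e11 : ∑ m, f j m * f j m = D.norm j := Finset.sum_congr rfl fun m _ => (sq _).symm
  have e12 : ∑ i ∈ F, f j i * (2 * ∑ m, f j m * f i m) =
      2 * ∑ i ∈ F, f j i * ∑ m, f j m * f i m := by
    rw [Finset.mul_sum]
    exact Finset.sum_congr rfl fun i _ => by ring
  have e13 : ∑ i ∈ F, ∑ l ∈ F, f j i * f j l * (2 * ∑ m, f i m * f l m) =
      2 * ∑ i ∈ F, ∑ l ∈ F, f j i * f j l * ∑ m, f i m * f l m := by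
    simp only [Finset.mul_sum]
    exact Finset.sum_congr rfl fun i _ => Finset.sum_congr rfl fun l _ =>
      Finset.sum_congr rfl fun m _ => by ring
  change ∑ m, (2 * f j m - ∑ i ∈ F, f j i * f i m) ^ 2 ≤ D.norm j * (4 - ∑ i ∈ F, f j i * f i j)
  rw [e1, e11]
  rw [e13, e9] at e5
  rw [e8, e10] at e12
  linarith

lemma sum_co_mul_co_le (j : ι) (F : Finset ι) (hF : ∀ i ∈ F, 0 < D.co j (D.rt i))
    (hF' : ∀ i ∈ F, ∀ l ∈ F, i ≠ l → D.co l (D.rt i) ≤ 0) :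
    ∑ i ∈ F, D.co j (D.rt i) * D.co i (D.rt j) ≤ 4 := by
  have h1 := D.sum_sq_le j F hF hF'
  have h2 := (Finset.sum_nonneg fun m _ => sq_nonneg _).trans h1
  have h3 := nonneg_of_mul_nonneg_right h2 (D.norm_pos j)
  linarith

/-- Cartan integers are at most `3`: the value `4` would make one root twice the other. -/
lemma co_le_three [Module.Free ℤ M] {i j : ι} (hpos : 0 < D.co j (D.rt i)) :
    D.co j (D.rt i) ≤ 3 := by
  have hF : ∀ l ∈ ({i} : Finset ι), 0 < D.co j (D.rt l) := fun l hl => by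
    rw [Finset.mem_singleton.1 hl]; exact hpos
  have hF' : ∀ l ∈ ({i} : Finset ι), ∀ m ∈ ({i} : Finset ι), l ≠ m → D.co m (D.rt l) ≤ 0 :=
    fun l hl m hm hlm => (hlm ((Finset.mem_singleton.1 hl).trans
      (Finset.mem_singleton.1 hm).symm)).elim
  have h1 := D.sum_co_mul_co_le j {i} hF hF'
  have h1' := D.sum_sq_le j {i} hF hF'
  simp only [Finset.sum_singleton] at h1 h1'
  have h2 := D.co_pos hpos
  by_contra! h3
  have h4 : D.co i (D.rt j) = 1 := by nlinarith
  have h5 : D.co j (D.rt i) = 4 := by rw [h4] at h1; omega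
  rw [h4, h5] at h1'
  have h6 : ∀ m, D.co j (D.rt m) = 2 * D.co i (D.rt m) := fun m => by
    have h7 := (Finset.sum_eq_zero_iff_of_nonneg fun m _ => sq_nonneg _).1
      (le_antisymm (by simpa using h1') (Finset.sum_nonneg fun m _ => sq_nonneg
        (2 * D.co j (D.rt m) - 4 * D.co i (D.rt m)))) m (Finset.mem_univ m)
    have h8 := pow_eq_zero_iff (two_ne_zero) |>.1 h7
    omega
  have h9 : D.norm j = 4 * D.norm i := by
    rw [norm, norm, Finset.mul_sum]
    exact Finset.sum_congr rfl fun m _ => by rw [h6]; ring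
  refine D.rt_ne_double i j ?_
  have h10 : ∀ y : M →+ ℤ, y (D.rt i) = y (D.rt j + D.rt j) := fun y => by
    have h11 := D.trace j y
    have h12 := D.trace i y
    change _ = D.norm j * _ at h11
    change _ = D.norm i * _ at h12
    simp only [h6, mul_assoc, ← Finset.mul_sum] at h11
    rw [h12, h9] at h11
    have h13 := (D.norm_pos i).ne'
    rw [map_add]
    have h14 : D.norm i * y (D.rt i) = D.norm i * (y (D.rt j) + y (D.rt j)) := by linarith
    exact mul_left_cancel₀ h13 h14
  let b := Module.Free.chooseBasis ℤ M
  refine b.ext_elem fun l => ?_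
  exact h10 ((Finsupp.lapply l ∘ₗ (b.repr : M →ₗ[ℤ] _)).toAddMonoidHom)

variable {D} in
lemma sum_sq_le_twelve [Module.Free ℤ M] {j : ι} {F : Finset ι}
    (hF : ∀ i ∈ F, 0 < D.co j (D.rt i))
    (hF' : ∀ i ∈ F, ∀ l ∈ F, i ≠ l → D.co l (D.rt i) ≤ 0) :
    ∑ i ∈ F, D.co j (D.rt i) ^ 2 ≤ 12 := by
  have h1 := D.sum_co_mul_co_le j F hF hF'
  calc ∑ i ∈ F, D.co j (D.rt i) ^ 2 ≤ ∑ i ∈ F, 3 * (D.co j (D.rt i) * D.co i (D.rt j)) := by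
        refine Finset.sum_le_sum fun i hi => ?_
        have h2 := D.co_le_three (hF i hi)
        have h3 := D.co_pos (hF i hi)
        have h4 := hF i hi
        nlinarith [mul_pos h4 h3]
    _ ≤ 12 := by rw [← Finset.mul_sum]; linarith

/-- If some functional takes values prime to `p` at all the roots, the invariant form is small at
the coroots: the roots at an acute angle with a given root are distributed over `p - 2` classes
modulo `p`, and Bessel's inequality bounds the contribution of each class. -/
lemma norm_le [Module.Free ℤ M] {p : ℕ} [Fact p.Prime] (φ : M →+ ℤ)
    (hφ : ∀ i, (φ (D.rt i) : ZMod p) ≠ 0) (j : ι) : D.norm j ≤ 24 * p - 40 := by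
  classical
  set P : Finset ι := {i | 0 < D.co j (D.rt i)}
  have hneg : ∀ i, D.co j (D.rt (D.neg i)) = -D.co j (D.rt i) := fun i => by
    rw [D.rt_neg, map_neg]
  have hinv : ∀ i, D.neg (D.neg i) = i := fun i => D.rt_injective (by
    rw [D.rt_neg, D.rt_neg, neg_neg])
  have h1 : D.norm j = 2 * ∑ i ∈ P, D.co j (D.rt i) ^ 2 := by
    rw [norm, ← Finset.sum_filter_add_sum_filter_not Finset.univ (fun i => 0 < D.co j (D.rt i)),
      two_mul]
    congr 1
    have h2 : ∑ i with ¬ 0 < D.co j (D.rt i), D.co j (D.rt i) ^ 2 =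
        ∑ i with D.co j (D.rt i) < 0, D.co j (D.rt i) ^ 2 := by
      refine (Finset.sum_subset (fun i hi => ?_) fun i hi hi' => ?_).symm
      · simp only [Finset.mem_filter, Finset.mem_univ, true_and] at hi ⊢
        omega
      · simp only [Finset.mem_filter, Finset.mem_univ, true_and] at hi hi'
        rw [show D.co j (D.rt i) = 0 by omega]
        rfl
    rw [h2]
    refine Finset.sum_nbij' D.neg D.neg (fun i hi => ?_) (fun i hi => ?_) (fun i _ => hinv i)
      (fun i _ => hinv i) fun i _ => by rw [hneg, neg_sq]
    · simp only [P, Finset.mem_filter, Finset.mem_univ, true_and, hneg] at hi ⊢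
      omega
    · simp only [P, Finset.mem_filter, Finset.mem_univ, true_and, hneg] at hi ⊢
      omega
  have hjP : j ∈ P := by
    simp only [P, Finset.mem_filter, Finset.mem_univ, true_and, D.co_self]
    norm_num
  rw [← Finset.add_sum_erase P _ hjP, D.co_self] at h1
  set T : Finset (ZMod p) := (Finset.univ.erase 0).erase (φ (D.rt j) : ZMod p)
  have hT : T.card = p - 2 := by
    rw [Finset.card_erase_of_mem (by simp [hφ j]), Finset.card_erase_of_mem (Finset.mem_univ _),
      Finset.card_univ, ZMod.card]
    rfl
  have hsub : ∀ i l, i ≠ l → 0 < D.co l (D.rt i) →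
      (φ (D.rt i) : ZMod p) ≠ (φ (D.rt l) : ZMod p) := fun i l hil hpos h => by
    obtain ⟨m, hm⟩ := D.exists_sub i l hil hpos
    apply hφ m
    rw [hm, map_sub, Int.cast_sub, h, sub_self]
  have hmaps : ∀ i ∈ P.erase j, (φ (D.rt i) : ZMod p) ∈ T := fun i hi => by
    obtain ⟨hi1, hi2⟩ := Finset.mem_erase.1 hi
    simp only [T, Finset.mem_erase, Finset.mem_univ, and_true]
    exact ⟨hsub i j hi1 (by simpa [P] using hi2), hφ i⟩
  have h2 : ∑ i ∈ P.erase j, D.co j (D.rt i) ^ 2 ≤ T.card • (12 : ℤ) := by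
    rw [← Finset.sum_fiberwise_of_maps_to hmaps]
    refine Finset.sum_le_card_nsmul _ _ _ fun c _ => ?_
    refine sum_sq_le_twelve (fun i hi => ?_) fun i hi l hl hil => ?_
    · have := (Finset.mem_erase.1 (Finset.mem_filter.1 hi).1).2
      simpa [P] using this
    · by_contra! h
      exact hsub i l hil h ((Finset.mem_filter.1 hi).2.trans (Finset.mem_filter.1 hl).2.symm)
  have hp : 2 ≤ p := (Fact.out : p.Prime).two_le
  rw [hT, nsmul_eq_mul, Nat.cast_sub hp] at h2
  push_cast at h2
  rw [h1]
  linarith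

/-- Relations between coroots modulo `p²` are trivial modulo `p`. -/
lemma dvd_of_sq_dvd [Module.Free ℤ M] {p : ℕ} [Fact p.Prime] (φ : M →+ ℤ)
    (hφ : ∀ i, (φ (D.rt i) : ZMod p) ≠ 0) {κ : Type*} [Fintype κ] (s : κ → ι) (c : κ → ℤ)
    (hc : ∀ i, (p : ℤ) ^ 2 ∣ ∑ b, c b * D.co (s b) (D.rt i)) (b₀ : κ) (y : M →+ ℤ) (d : ℤ)
    (hd : d ≠ 0) (hy : ∀ i, d ∣ y (D.rt i)) (hy₀ : y (D.rt (s b₀)) = d)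
    (hyb : ∀ b, b ≠ b₀ → y (D.rt (s b)) = 0) : (p : ℤ) ∣ c b₀ := by
  classical
  have hp : Prime (p : ℤ) := Nat.prime_iff_prime_int.1 Fact.out
  -- after the addition of a multiple of `p²`, the coefficient `c b₀` may be assumed to be odd
  wlog hodd : p ≠ 2 → Odd (c b₀) generalizing c
  · push Not at hodd
    obtain ⟨hp2, hodd⟩ := hodd
    have hpo : Odd (p : ℤ) := by
      exact_mod_cast (Fact.out : p.Prime).odd_of_ne_two hp2
    have h1 := this (Function.update c b₀ (c b₀ + (p : ℤ) ^ 2)) (fun i => by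
      rw [← Finset.add_sum_erase _ _ (Finset.mem_univ b₀), Function.update_self]
      have h2 := hc i
      rw [← Finset.add_sum_erase _ _ (Finset.mem_univ b₀)] at h2
      rw [Finset.sum_congr rfl fun b hb => by
        rw [Function.update_of_ne (Finset.ne_of_mem_erase hb)],
        add_mul, add_right_comm]
      exact dvd_add h2 (dvd_mul_right _ _)) fun _ => by
        rw [Function.update_self]
        exact (Int.not_odd_iff_even.1 hodd).add_odd hpo.pow
    rw [Function.update_self] at h1
    exact (Int.dvd_add_left (Dvd.intro_left ((p : ℤ)) (by ring))).1 h1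
  by_contra hcon
  set K : M →+ ℤ := ∑ b, c b • D.co (s b)
  have hK : ∀ m, K m = ∑ b, c b * D.co (s b) m := fun m => by
    simp [K, AddMonoidHom.finsetSum_apply]
  have h1 : 2 * ∑ i, K (D.rt i) * y (D.rt i) = c b₀ * D.norm (s b₀) * d := by
    have h2 : 2 * ∑ i, K (D.rt i) * y (D.rt i) = ∑ b, c b * (D.norm (s b) * y (D.rt (s b))) := by
      simp only [hK, Finset.sum_mul]
      rw [Finset.sum_comm, Finset.mul_sum]
      refine Finset.sum_congr rfl fun b _ => ?_
      rw [norm, ← D.trace, Finset.mul_sum, Finset.mul_sum, Finset.mul_sum]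
      exact Finset.sum_congr rfl fun i _ => by ring
    rw [h2, Finset.sum_eq_single b₀ (fun b _ hb => by rw [hyb b hb]; ring) (by simp), hy₀]
    ring
  have hneg : ∀ i, K (D.rt (D.neg i)) * y (D.rt (D.neg i)) = K (D.rt i) * y (D.rt i) := fun i => by
    rw [D.rt_neg, map_neg, map_neg, neg_mul_neg]
  have hinv : ∀ i, D.neg (D.neg i) = i := fun i => D.rt_injective (by
    rw [D.rt_neg, D.rt_neg, neg_neg])
  have h3 : ∑ i, K (D.rt i) * y (D.rt i) =
      2 * ∑ i with 0 < y (D.rt i), K (D.rt i) * y (D.rt i) := by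
    rw [← Finset.sum_filter_add_sum_filter_not Finset.univ (fun i => 0 < y (D.rt i)), two_mul]
    congr 1
    have h2 : ∑ i with ¬ 0 < y (D.rt i), K (D.rt i) * y (D.rt i) =
        ∑ i with y (D.rt i) < 0, K (D.rt i) * y (D.rt i) := by
      refine (Finset.sum_subset (fun i hi => ?_) fun i hi hi' => ?_).symm
      · simp only [Finset.mem_filter, Finset.mem_univ, true_and] at hi ⊢
        omega
      · simp only [Finset.mem_filter, Finset.mem_univ, true_and] at hi hi'
        rw [show y (D.rt i) = 0 by omega, mul_zero]
    rw [h2]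
    refine Finset.sum_nbij' D.neg D.neg (fun i hi => ?_) (fun i hi => ?_) (fun i _ => hinv i)
      (fun i _ => hinv i) fun i _ => (hneg i).symm
    · simp only [Finset.mem_filter, Finset.mem_univ, true_and, D.rt_neg, map_neg] at hi ⊢
      omega
    · simp only [Finset.mem_filter, Finset.mem_univ, true_and, D.rt_neg, map_neg] at hi ⊢
      omega
  have h4 : (p : ℤ) ^ 2 * d ∣ ∑ i with 0 < y (D.rt i), K (D.rt i) * y (D.rt i) :=
    Finset.dvd_sum fun i _ => mul_dvd_mul ((hK (D.rt i)).symm ▸ hc i) (hy i)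
  have h5 : 4 * (p : ℤ) ^ 2 ∣ c b₀ * D.norm (s b₀) := by
    obtain ⟨q, hq⟩ := h4
    refine ⟨q, mul_right_cancel₀ hd ?_⟩
    rw [← h1, h3, hq]
    ring
  have h6 : IsCoprime (4 * (p : ℤ) ^ 2) (c b₀) := by
    have h7 : IsCoprime (p : ℤ) (c b₀) := (hp.coprime_iff_not_dvd).2 hcon
    refine IsCoprime.mul_left ?_ h7.pow_left
    have h8 : IsCoprime (2 : ℤ) (c b₀) := by
      by_cases h2 : p = 2
      · rw [h2] at h7; exact_mod_cast h7
      · exact (Int.prime_two.coprime_iff_not_dvd).2 fun h => by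
          have := hodd h2
          rw [← Int.not_even_iff_odd] at this
          exact this (even_iff_two_dvd.2 h)
    have := h8.pow_left (m := 2)
    norm_num at this
    exact this
  have h7 := Int.le_of_dvd (D.norm_pos _) (h6.dvd_of_dvd_mul_left h5)
  have h8 := D.norm_le φ hφ (s b₀)
  nlinarith [sq_nonneg ((p : ℤ) - 3)]

end CorootSystem

end GroupScheme

/-! ### Heights, and toral elements as combinations of coroots -/

namespace GroupScheme

/-- An independent family in a lattice admits dual functionals up to a factor. -/
lemma exists_dual_functional {M κ : Type*} [AddCommGroup M] [Module.Free ℤ M] [Module.Finite ℤ M]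
    [DecidableEq κ] {v : κ → M} (hv : LinearIndependent ℤ v) (b₀ : κ) :
    ∃ (y : M →+ ℤ) (d : ℤ), d ≠ 0 ∧ ∀ b, y (v b) = if b = b₀ then d else 0 := by
  let b := Module.Free.chooseBasis ℤ M
  let f : M →ₗ[ℤ] (Module.Free.ChooseBasisIndex ℤ M → ℚ) := b.constr ℤ fun i => Pi.single i (1 : ℚ)
  have hf : ∀ m i, f m i = (b.repr m i : ℚ) := fun m i => by
    classical
    rw [Module.Basis.constr_apply_fintype, Finset.sum_apply]
    simp [Pi.single_apply]
  have hinj : Function.Injective f := fun m n h => b.ext_elem fun i => by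
    have := congrFun h i
    rw [hf, hf] at this
    exact_mod_cast this
  have h1 : LinearIndependent ℚ (f ∘ v) :=
    (LinearIndependent.iff_fractionRing ℤ ℚ).1 (hv.map' f (LinearMap.ker_eq_bot.2 hinj))
  obtain ⟨g, hg⟩ := LinearMap.exists_leftInverse_of_injective (Finsupp.linearCombination ℚ (f ∘ v))
    (LinearMap.ker_eq_bot.2 h1)
  have hg' : ∀ c, g (f (v c)) = Finsupp.single c 1 := fun c => by
    have := LinearMap.congr_fun hg (Finsupp.single c 1)
    simpa using this
  obtain ⟨d, hd⟩ := IsLocalization.exist_integer_multiples_of_finite (nonZeroDivisors ℤ)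
    fun i => g (f (b i)) b₀
  choose z hz using hd
  refine ⟨(b.constr ℤ z).toAddMonoidHom, d, nonZeroDivisors.ne_zero d.2, fun c => ?_⟩
  have h2 : ∀ m, ((b.constr ℤ z m : ℤ) : ℚ) = d * g (f m) b₀ := fun m => by
    have h3 : (Int.castAddHom ℚ).toIntLinearMap ∘ₗ b.constr ℤ z =
        (d : ℤ) • ((Finsupp.lapply b₀ ∘ₗ g).restrictScalars ℤ ∘ₗ f) := by
      refine b.ext fun i => ?_
      have h4 := hz i
      simp only [eq_intCast] at h4
      simp [h4]
    have h5 := LinearMap.congr_fun h3 m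
    simpa using h5
  have h6 := h2 (v c)
  rw [hg', Finsupp.single_apply] at h6
  change b.constr ℤ z (v c) = _
  split_ifs at h6 ⊢ with h7
  · exact_mod_cast h6.trans (mul_one _)
  · exact_mod_cast h6.trans (mul_zero _)

section Height

variable {M : Type*} [AddCommGroup M] {Φ Δ : Set M}

lemma height_linearCombination (hΔ : LinearIndependent ℤ (Subtype.val : Δ → M)) (c : Δ →₀ ℤ) :
    height Δ (Finsupp.linearCombination ℤ Subtype.val c) = c.sum fun _ n => n := by
  have h := Classical.epsilon_spec (p := fun c' : Δ →₀ ℤ =>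
    Finsupp.linearCombination ℤ Subtype.val c' = Finsupp.linearCombination ℤ Subtype.val c) ⟨c, rfl⟩
  rw [height, hΔ h]

lemma height_of_mem (hΔ : LinearIndependent ℤ (Subtype.val : Δ → M)) {β : M} (hβ : β ∈ Δ) :
    height Δ β = 1 := by
  have h := height_linearCombination hΔ (Finsupp.single ⟨β, hβ⟩ 1)
  simpa using h

lemma height_add (hΔ : IsSimpleSystem Φ Δ) {α β : M} (hα : α ∈ Φ) (hβ : β ∈ Φ) :
    height Δ (α + β) = height Δ α + height Δ β := by
  obtain ⟨c, rfl, -⟩ := hΔ.pos_or_neg α hα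
  obtain ⟨d, rfl, -⟩ := hΔ.pos_or_neg β hβ
  rw [← map_add, height_linearCombination hΔ.2, height_linearCombination hΔ.2,
    height_linearCombination hΔ.2, Finsupp.sum_add_index' (by simp) (by simp)]

lemma height_neg (hΔ : IsSimpleSystem Φ Δ) {α : M} (hα : α ∈ Φ) :
    height Δ (-α) = -height Δ α := by
  obtain ⟨c, rfl, -⟩ := hΔ.pos_or_neg α hα
  rw [← map_neg, height_linearCombination hΔ.2, height_linearCombination hΔ.2,
    Finsupp.sum_neg_index (by simp), Finsupp.sum, Finsupp.sum, Finset.sum_neg_distrib]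

end Height

namespace ChevalleyBasis

variable {A M : Type*} [CommRing A] [HopfAlgebra ℤ A] [AddCommGroup M] [Module.Free ℤ M]
  [Module.Finite ℤ M] {π : A →ₐc[ℤ] AddMonoidAlgebra ℤ M} (hG : IsSplitReductive π) {Δ : Set M}
  (C : ChevalleyBasis π Δ)

include hG C in
omit [Module.Finite ℤ M] in
lemma neg_root_mem (α : roots π) : -(α : M) ∈ roots π := by
  have := hG.smooth
  have : IsAddTorsionFree M := Module.isTorsionFree_int_iff_isAddTorsionFree.1 inferInstance
  exact C.neg_mem_roots (AlgebraicClosure ℚ)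
    (by
      rw [show algebraMap ℤ (AlgebraicClosure ℚ) = Int.castRingHom _ from Subsingleton.elim _ _]
      exact Int.cast_injective)
    (hG.fibres _) α

include hG in
/-- The negative of a root. -/
def negRoot (α : roots π) : roots π := ⟨-α, C.neg_root_mem hG α⟩

omit [Module.Finite ℤ M] in
lemma h_negRoot (α β : roots π) : C.h (C.negRoot hG α) β = -C.h α β := by
  have := hG.smooth
  have h1 : toral π (C.h (C.negRoot hG α)) = -toral π (C.h α) := by
    rw [← C.lie_X_neg _ α (by simp [negRoot]), ← C.lie_X_neg α (C.negRoot hG α) rfl, lie_skew]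
  have h2 := C.lie_H_X β (C.negRoot hG α)
  rw [h1, neg_lie, C.lie_H_X, ← neg_smul] at h2
  exact (smul_left_injective ℤ (C.X_ne_zero β) h2).symm

include hG in
/-- The roots and coroots of a split reductive group. -/
def corootSystem [Fintype (roots π)] : CorootSystem (roots π) M where
  rt := Subtype.val
  co := C.h
  neg := C.negRoot hG
  rt_neg _ := rfl
  rt_injective := Subtype.val_injective
  co_self := C.h_self
  exists_sub α β hne hpos := by
    have := hG.smooth
    exact ⟨⟨_, C.sub_mem_roots (β' := C.negRoot hG β) rfl hne rfl hpos⟩, rfl⟩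
  trace β y := by
    classical
    have := hG.smooth
    have h := C.two_mul_sum (β := β) (β' := C.negRoot hG β) rfl y
    have h1 : ∀ f : M → ℤ, ∑ α ∈ (finite_roots (A := A) π).toFinset, f α =
        ∑ α : roots π, f α := fun f =>
      Finset.sum_subtype _ (fun α => Set.Finite.mem_toFinset _) f
    rwa [h1 fun α => C.h β α * y α, h1 fun α => C.h β α ^ 2] at h
  rt_ne_double α β h := by
    have := hG.smooth
    exact C.not_add_self_mem β (h ▸ α.2)

include hG C in
omit [Module.Finite ℤ M] in
/-- A root of even height is the sum of two roots of odd height. -/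
lemma exists_odd_add_odd (hΔ : IsSimpleSystem (roots π) Δ) (γ : roots π)
    (hγ : ¬ Odd (height Δ (γ : M))) : ∃ α β : roots π, Odd (height Δ (α : M)) ∧
      Odd (height Δ (β : M)) ∧ (γ : M) = α + β := by
  have := hG.smooth
  -- some simple coroot does not vanish at `γ`, because `γ` does not vanish at its own coroot
  obtain ⟨β, hβΔ, hβ⟩ : ∃ β : roots π, (β : M) ∈ Δ ∧ C.h β γ ≠ 0 := by
    by_contra! hcon
    have h1 : ∀ v ∈ Submodule.span ℤ ((fun β => toral π (C.h β)) '' {β | (β : M) ∈ Δ}),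
        ⁅v, C.X γ⁆ = 0 := by
      intro v hv
      induction hv using Submodule.span_induction with
      | mem x hx =>
        obtain ⟨β, hβ, rfl⟩ := hx
        change ⁅toral π (C.h β), C.X γ⁆ = 0
        rw [C.lie_H_X, hcon β hβ, zero_smul]
      | zero => exact zero_lie _
      | add x y _ _ hx hy => rw [add_lie, hx, hy, add_zero]
      | smul c x _ hx => rw [zsmul_lie, hx, smul_zero]
    have h2 := h1 _ (C.H_span γ)
    rw [C.lie_H_X, C.h_self, smul_eq_zero] at h2
    exact h2.elim (by norm_num) (C.X_ne_zero γ)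
  have h1 : height Δ (β : M) = 1 := height_of_mem hΔ.2 hβΔ
  have key : ∀ β : roots π, Odd (height Δ (β : M)) → 0 < C.h β γ → ∃ α β : roots π,
      Odd (height Δ (α : M)) ∧ Odd (height Δ (β : M)) ∧ (γ : M) = α + β := by
    intro β hβ hpos
    have hne : γ ≠ β := fun h => hγ (h ▸ hβ)
    have h2 := C.sub_mem_roots (β' := C.negRoot hG β) rfl hne rfl hpos
    refine ⟨⟨_, h2⟩, β, ?_, hβ, (sub_add_cancel _ _).symm⟩
    change Odd (height Δ ((γ : M) - β))
    rw [sub_eq_add_neg, height_add hΔ γ.2 (C.neg_root_mem hG β), height_neg hΔ β.2]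
    exact (Int.not_odd_iff_even.1 hγ).add_odd hβ.neg
  rcases lt_or_gt_of_ne hβ with h2 | h2
  · refine key (C.negRoot hG β) ?_ (by rw [h_negRoot]; omega)
    change Odd (height Δ (-(β : M)))
    rw [height_neg hΔ β.2, h1]
    exact odd_one.neg
  · exact key β (by rw [h1]; exact odd_one) h2

include hG in
/-- A toral element of the Lie algebra of the derived group is a combination of simple coroots with
denominator not divisible by `p²`. -/
lemma exists_smul_eq_sum (hΔ : IsSimpleSystem (roots π) Δ) {p : ℕ} [Fact p.Prime] (φ : M →+ ℤ)
    (hφ : ∀ α ∈ roots π, (φ α : ZMod p) ≠ 0) [Fintype {β : roots π // (β : M) ∈ Δ}]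
    {v : lie ℤ A} (hv : v ∈ lieDer ℤ A) (hv0 : v ∈ weightSpace π 0) :
    ∃ (n : ℤ) (c : {β : roots π // (β : M) ∈ Δ} → ℤ), ¬ (p : ℤ) ^ 2 ∣ n ∧
      n • v = ∑ β, c β • toral π (C.h β.1) := by
  classical
  have := hG.smooth
  let : Fintype (roots π) := (finite_roots (A := A) π).fintype
  have hp : Prime (p : ℤ) := Nat.prime_iff_prime_int.1 Fact.out
  -- a first denominator, from the definition of a Chevalley basis
  have hex : ∃ (n : ℤ) (c : {β : roots π // (β : M) ∈ Δ} → ℤ), n ≠ 0 ∧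
      n • v = ∑ β, c β • toral π (C.h β.1) := by
    obtain ⟨n, hn, hmem⟩ := C.span_der v hv
    have h1 : ∀ w ∈ Submodule.span ℤ (Set.range (Sum.elim
        (fun β : {β : roots π // (β : M) ∈ Δ} => toral π (C.h β)) C.X)), wtComp π 0 w ∈
        Submodule.span ℤ (Set.range fun β : {β : roots π // (β : M) ∈ Δ} => toral π (C.h β)) := by
      intro w hw
      induction hw using Submodule.span_induction with
      | mem x hx =>
        obtain ⟨β | α, rfl⟩ := hx
        · rw [Sum.elim_inl, wtComp_of_mem π (toral_mem_weightSpace π _), if_pos rfl]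
          exact Submodule.subset_span ⟨β, rfl⟩
        · rw [Sum.elim_inr, wtComp_of_mem π (C.X_mem_weightSpace α),
            if_neg (C.ne_zero α)]
          exact Submodule.zero_mem _
      | zero => rw [map_zero]; exact Submodule.zero_mem _
      | add x y _ _ hx hy => rw [map_add]; exact Submodule.add_mem _ hx hy
      | smul c x _ hx => rw [map_smul]; exact Submodule.smul_mem _ _ hx
    have h2 := h1 _ hmem
    rw [wtComp_of_mem π (Submodule.smul_mem _ n hv0), if_pos rfl,
      Submodule.mem_span_range_iff_exists_fun] at h2
    obtain ⟨c, hc⟩ := h2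
    exact ⟨n, c, hn, hc.symm⟩
  -- a denominator divisible by `p²` can be divided by `p`
  have hdiv : ∀ (n : ℤ) (c : {β : roots π // (β : M) ∈ Δ} → ℤ), (p : ℤ) ^ 2 ∣ n →
      n • v = ∑ β, c β • toral π (C.h β.1) → ∀ β, (p : ℤ) ∣ c β := by
    intro n c hn h b
    have hli : LinearIndependent ℤ fun β : {β : roots π // (β : M) ∈ Δ} => (β.1 : M) :=
      hΔ.2.comp (fun β : {β : roots π // (β : M) ∈ Δ} => (⟨β.1, β.2⟩ : Δ)) fun β β' h =>
        Subtype.ext (Subtype.ext (congrArg (fun x : Δ => (x : M)) h))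
    obtain ⟨y, d, hd, hy⟩ := exists_dual_functional hli b
    refine (C.corootSystem hG).dvd_of_sq_dvd φ (fun α => hφ α α.2)
      (fun β : {β : roots π // (β : M) ∈ Δ} => β.1) c (fun α => ?_) b y d hd (fun α => ?_)
      ((hy b).trans (if_pos rfl)) fun β hβ => (hy β).trans (if_neg hβ)
    · have h1 : ⁅v, C.X α⁆ ∈ weightSpace π (α : M) := by
        have := lie_mem_weightSpace π hv0 (C.X_mem_weightSpace α)
        rwa [zero_add] at this
      obtain ⟨t, ht⟩ := C.exists_eq_smul_X α h1
      have h2 : n • ⁅v, C.X α⁆ = (∑ β, c β * C.h β.1 α) • C.X α := by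
        rw [← zsmul_lie, h, sum_lie, Finset.sum_smul]
        exact Finset.sum_congr rfl fun β _ => by rw [zsmul_lie, C.lie_H_X, mul_smul]
      rw [← ht, smul_smul] at h2
      have h3 := smul_left_injective ℤ (C.X_ne_zero α) h2
      change (p : ℤ) ^ 2 ∣ ∑ β, c β * C.h β.1 α
      rw [← h3]
      exact hn.mul_right t
    · obtain ⟨e, he, -⟩ := hΔ.pos_or_neg α α.2
      change d ∣ y (α : M)
      rw [← he, Finsupp.linearCombination_apply, Finsupp.sum, map_sum]
      refine Finset.dvd_sum fun β _ => ?_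
      rw [map_zsmul, smul_eq_mul]
      refine Dvd.dvd.mul_left ?_ _
      rw [hy ⟨⟨β, hΔ.1 β.2⟩, β.2⟩]
      split_ifs
      · exact dvd_rfl
      · exact dvd_zero d
  obtain ⟨n, c, hn, h⟩ := hex
  induction hN : n.natAbs using Nat.strong_induction_on generalizing n c with
  | _ N ih =>
    by_cases hpn : (p : ℤ) ^ 2 ∣ n
    · choose c' hc' using hdiv n c hpn h
      obtain ⟨m, rfl⟩ := hpn
      have hm : m ≠ 0 := right_ne_zero_of_mul hn
      refine ih _ ?_ (p * m) c' (mul_ne_zero hp.ne_zero hm) ?_ rfl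
      · rw [← hN, Int.natAbs_mul, Int.natAbs_mul, Int.natAbs_pow, Int.natAbs_natCast, sq, mul_assoc]
        exact lt_mul_left (Nat.mul_pos (Fact.out : p.Prime).pos (Int.natAbs_pos.2 hm))
          (Fact.out : p.Prime).one_lt
      · have h1 : (p : ℤ) • (((p : ℤ) * m) • v) = (p : ℤ) • ∑ β, c' β • toral π (C.h β.1) := by
          rw [smul_smul, ← mul_assoc, ← sq, h, Finset.smul_sum]
          exact Finset.sum_congr rfl fun β _ => by rw [smul_smul, ← hc']
        exact smul_right_injective _ hp.ne_zero h1
    · exact ⟨n, c, hpn, h⟩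

end ChevalleyBasis

end GroupScheme

/-! ### The congruence filtration -/

namespace GroupScheme

section Expansion

variable {R D : Type*} [CommRing R] [Ring D] [Algebra R D] {t : R}

lemma inv_eq_one_sub {x x' F : D} {m : ℕ} (hx : x = 1 + t ^ m • F) (hx' : x * x' = 1) :
    x' = 1 - t ^ m • (F * x') := by
  rw [hx, add_mul, one_mul, smul_mul_assoc] at hx'
  rw [← hx', add_sub_cancel_right]

lemma commutator_eq_one_add {x y x' y' : D} (hx : x * x' = 1) (hy : y * y' = 1) :
    x * y * x' * y' = 1 + (x * y - y * x) * (x' * y') := by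
  have h : y * x * (x' * y') = 1 := by
    rw [mul_assoc, ← mul_assoc x, hx, one_mul, hy]
  rw [sub_mul, h]
  simp only [mul_assoc]
  abel

/-- The leading term of a commutator. -/
lemma exists_commutator_eq {x y x' y' F G : D} {m n : ℕ} (hm : 1 ≤ m) (hn : 1 ≤ n)
    (hx : x = 1 + t ^ m • F) (hy : y = 1 + t ^ n • G) (hx' : x * x' = 1) (hy' : y * y' = 1) :
    ∃ r, x * y * x' * y' = 1 + t ^ (m + n) • (F * G - G * F + t • r) := by
  obtain ⟨i, rfl⟩ := Nat.exists_eq_add_of_le' hm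
  obtain ⟨j, rfl⟩ := Nat.exists_eq_add_of_le' hn
  have h1 : x * y - y * x = t ^ (i + 1 + (j + 1)) • (F * G - G * F) := by
    rw [hx, hy]
    simp only [add_mul, mul_add, one_mul, mul_one, smul_mul_smul_comm, pow_add, smul_sub]
    rw [mul_comm (t ^ j * t ^ 1)]
    abel
  have h2 : ∃ s, x' * y' = 1 + t • s := by
    refine ⟨-(t ^ i • (F * x')) - t ^ j • (x' * (G * y')), ?_⟩
    have e1 : x' * y' = x' - t ^ (j + 1) • (x' * (G * y')) := by
      conv_lhs => rw [inv_eq_one_sub hy hy']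
      rw [mul_sub, mul_one, mul_smul_comm]
    have e2 := inv_eq_one_sub hx hx'
    rw [e1, smul_sub, smul_neg, smul_smul, smul_smul, ← pow_succ', ← pow_succ']
    conv_lhs => rw [sub_eq_add_neg]; enter [1]; rw [e2]
    abel
  obtain ⟨s, hs⟩ := h2
  refine ⟨(F * G - G * F) * s, ?_⟩
  rw [commutator_eq_one_add hx' hy', h1, hs, mul_add, mul_one, mul_smul_comm, smul_mul_assoc,
    smul_add, smul_comm t]

/-- The second term of a commutator. -/
lemma exists_commutator_eq_second {x y x' y' X Y f g : D} (hx : x = 1 + t • (X + t • f))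
    (hy : y = 1 + t ^ 2 • (Y + t • g)) (hx' : x * x' = 1) (hy' : y * y' = 1) :
    ∃ r, x * y * x' * y' = 1 + t ^ 3 • (X * Y - Y * X +
      t • ((f * Y - Y * f) + (X * g - g * X) - (X * Y - Y * X) * X) + t ^ 2 • r) := by
  have h1 : x * y - y * x = t ^ 3 • ((X * Y - Y * X) + t • ((f * Y - Y * f) + (X * g - g * X)) +
      t ^ 2 • (f * g - g * f)) := by
    rw [hx, hy]
    simp only [add_mul, mul_add, one_mul, mul_one, smul_mul_assoc, mul_smul_comm, smul_add,
      smul_sub, smul_smul]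
    match_scalars <;> ring
  have h2 : ∃ s, x' * y' = 1 - t • X + t ^ 2 • s := by
    have e1 : x' = 1 - t • ((X + t • f) * x') := by
      have := inv_eq_one_sub (F := X + t • f) (m := 1)
        (show x = 1 + t ^ 1 • (X + t • f) by rw [pow_one, hx]) hx'
      rwa [pow_one] at this
    have e2 := inv_eq_one_sub hy hy'
    have e3 : x' = 1 - t • X + t ^ 2 • ((X * (X + t • f) * x') - f * x') := by
      nth_rewrite 1 [e1]
      rw [add_mul]
      nth_rewrite 1 [e1]
      simp only [mul_sub, mul_one, smul_mul_assoc, mul_smul_comm, smul_add, smul_sub, smul_smul,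
        mul_assoc]
      match_scalars <;> ring
    refine ⟨(X * (X + t • f) * x') - f * x' - x' * ((Y + t • g) * y'), ?_⟩
    nth_rewrite 1 [e2]
    rw [mul_sub, mul_one, mul_smul_comm]
    nth_rewrite 1 [e3]
    rw [smul_sub _ _ (x' * ((Y + t • g) * y'))]
    abel
  obtain ⟨s, hs⟩ := h2
  rw [commutator_eq_one_add hx' hy', h1, hs]
  set H := X * Y - Y * X
  set P := (f * Y - Y * f) + (X * g - g * X)
  set Q := f * g - g * f
  refine ⟨Q - t • (Q * X) + t ^ 2 • (Q * s) - P * X + t • (P * s) + H * s, ?_⟩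
  simp only [add_mul, mul_add, mul_sub, mul_one, smul_mul_assoc, mul_smul_comm, smul_add,
    smul_sub, smul_smul]
  match_scalars <;> ring

lemma exists_one_add_pow_eq (z : D) (n : ℕ) : ∃ q, (1 + z) ^ n = 1 + n • z + z ^ 2 * q := by
  induction n with
  | zero => exact ⟨0, by simp⟩
  | succ n ih =>
    obtain ⟨q, hq⟩ := ih
    refine ⟨n • 1 + q + q * z, ?_⟩
    rw [pow_succ, hq]
    simp only [add_mul, mul_add, one_mul, mul_one, add_smul, one_smul, sq, mul_assoc,
      smul_mul_assoc, mul_smul_comm]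
    abel

end Expansion

section Layers

variable {A : Type*} [CommRing A] [HopfAlgebra ℤ A] {p : ℕ} [Fact p.Prime]

lemma red_eq_one_iff {m : ℕ} {x : Pts ℤ A ℤ_[p]} : GaloisRep.red A p m x = 1 ↔
    ∃ F : Form ℤ A ℤ_[p], ptForm x = 1 + (p : ℤ_[p]) ^ m • F := by
  have hp0 : (p : ℤ_[p]) ^ m ≠ 0 := pow_ne_zero _ (by exact_mod_cast (Fact.out : p.Prime).ne_zero)
  have h1 : ∀ a, (1 : Form ℤ A ℤ_[p]) a = ((Bialgebra.counitAlgHom ℤ A a : ℤ) : ℤ_[p]) :=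
    fun a => by
      change algebraMap ℤ ℤ_[p] _ = _
      rw [algebraMap_int_padicInt]
      rfl
  have h2 : GaloisRep.red A p m x = 1 ↔
      ∀ a, (p : ℤ_[p]) ^ m ∣ (ptForm x - 1 : Form ℤ A ℤ_[p]) a := by
    have h3 : ∀ a, (p : ℤ_[p]) ^ m ∣ (ptForm x - 1 : Form ℤ A ℤ_[p]) a ↔
        PadicInt.toZModPow m (x.ofConv a) = (Bialgebra.counitAlgHom ℤ A a : ℤ) := fun a => by
      rw [← Ideal.mem_span_singleton, ← PadicInt.ker_toZModPow, RingHom.mem_ker]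
      change PadicInt.toZModPow m (x.ofConv a - (1 : Form ℤ A ℤ_[p]) a) = 0 ↔ _
      rw [map_sub, h1, map_intCast, sub_eq_zero]
    rw [forall_congr' h3]
    constructor
    · intro h a
      have h4 := congrArg (fun y : Pts ℤ A (ZMod (p ^ m)) => y.ofConv a) h
      refine h4.trans ?_
      change algebraMap ℤ (ZMod (p ^ m)) _ = _
      simp
    · intro h
      apply WithConv.ofConv_injective
      ext1 a
      refine (h a).trans ?_
      change _ = algebraMap ℤ (ZMod (p ^ m)) _
      simp
  rw [h2]
  constructor
  · intro h
    obtain ⟨g, hg⟩ := exists_eq_smul_of_dvd hp0 h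
    exact ⟨g, by rw [← hg]; abel⟩
  · rintro ⟨F, hF⟩ a
    rw [hF, add_sub_cancel_left]
    exact ⟨F a, rfl⟩

end Layers

end GroupScheme

/-! ### Leading terms of subgroups of `G(ℤ_p)` -/

namespace GroupScheme

lemma exists_lie_eq_smul {O A : Type*} [CommRing O] [IsDomain O] [CommRing A] [HopfAlgebra O A]
    {c : O} (hc : c ≠ 0) {v : lie O A} (h : ∀ a, c ∣ v.1 a) : ∃ w : lie O A, v = c • w := by
  obtain ⟨g, hg⟩ := exists_eq_smul_of_dvd (R := O) hc (f := v.1) h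
  have hv := v.2
  refine ⟨⟨g, fun a b => mul_left_cancel₀ hc ?_⟩, Subtype.ext hg⟩
  have h1 := hv a b
  rw [hg] at h1
  change c * g (a * b) = _ * (c * g b) + (c * g a) * _ at h1
  rw [h1]
  ring

section Layers

variable {A : Type*} [CommRing A] [HopfAlgebra ℤ A] {p : ℕ} [Fact p.Prime]

lemma castForm_zsmul (c : ℤ) (v : Dist ℤ A) :
    castForm ℤ_[p] (c • v) = (c : ℤ_[p]) • castForm ℤ_[p] v := by
  rw [castForm_smul', algebraMap_int_padicInt]

lemma castForm_lie (v w : lie ℤ A) : castForm ℤ_[p] (⁅v, w⁆ : lie ℤ A).1 =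
    castForm ℤ_[p] v.1 * castForm ℤ_[p] w.1 - castForm ℤ_[p] w.1 * castForm ℤ_[p] v.1 := by
  rw [lie_val, map_sub, map_mul, map_mul]

lemma castForm_add_lie (v w : lie ℤ A) : castForm ℤ_[p] (v + w : lie ℤ A).1 =
    castForm ℤ_[p] v.1 + castForm ℤ_[p] w.1 := map_add (castForm ℤ_[p]) v.1 w.1

lemma castForm_zsmul_lie (c : ℤ) (v : lie ℤ A) : castForm ℤ_[p] (c • v : lie ℤ A).1 =
    (c : ℤ_[p]) • castForm ℤ_[p] v.1 := castForm_zsmul c v.1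

/-- An element of the Lie algebra over `ℤ` that is divisible by an integer over `ℤ_p` is divisible
by its `p`-part over `ℤ`. -/
lemma exists_eq_pow_smul {n : ℕ} {v : lie ℤ A} {g : Form ℤ A ℤ_[p]}
    (h : castForm ℤ_[p] v.1 = (p : ℤ_[p]) ^ n • g) : ∃ w : lie ℤ A, v = (p : ℤ) ^ n • w := by
  refine exists_lie_eq_smul (pow_ne_zero _ (by exact_mod_cast (Fact.out : p.Prime).ne_zero))
    fun a => ?_
  rw [← intCast_dvd_iff, ← algebraMap_int_padicInt]
  exact ⟨g a, congrArg (fun f : Form ℤ A ℤ_[p] => f a) h⟩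

/-- A point congruent to `1` modulo `p ^ m` is, to twice this precision, given by an element of the
Lie algebra. -/
lemma exists_lie_of_ptForm_eq [Algebra.FormallySmooth ℤ A] {m : ℕ} {x : Pts ℤ A ℤ_[p]}
    {F : Form ℤ A ℤ_[p]} (hx : ptForm x = 1 + (p : ℤ_[p]) ^ m • F) :
    ∃ (v : lie ℤ A) (g : Form ℤ A ℤ_[p]), F = castForm ℤ_[p] v.1 + (p : ℤ_[p]) ^ m • g := by
  have hp0 : (p : ℤ_[p]) ^ m ≠ 0 := pow_ne_zero _ (by exact_mod_cast (Fact.out : p.Prime).ne_zero)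
  have h1 : ∀ a, x.ofConv a = ((Bialgebra.counitAlgHom ℤ A a : ℤ) : ℤ_[p]) +
      (p : ℤ_[p]) ^ m * F a := fun a => by
    have h2 := congrArg (fun f : Form ℤ A ℤ_[p] => f a) hx
    refine h2.trans ?_
    change algebraMap ℤ ℤ_[p] _ + _ = _
    rw [algebraMap_int_padicInt]
    rfl
  refine exists_lie_congr m F fun a b => ⟨F a * F b, ?_⟩
  have h3 := map_mul x.ofConv a b
  rw [h1, h1, h1, map_mul, Int.cast_mul] at h3
  apply mul_left_cancel₀ hp0
  linear_combination h3

/-- The elements `v` of the Lie algebra for which `H` contains a point of the form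
`1 + p ^ m v + O(p ^ (m + k))`. They form a group as long as `k ≤ m`. -/
def approxTerms (H : Subgroup (Pts ℤ A ℤ_[p])) {m k : ℕ} (hk : k ≤ m) : AddSubgroup (lie ℤ A) where
  carrier := {v | ∃ x ∈ H, ∃ g : Form ℤ A ℤ_[p],
    ptForm x = 1 + (p : ℤ_[p]) ^ m • (castForm ℤ_[p] v.1 + (p : ℤ_[p]) ^ k • g)}
  zero_mem' := ⟨1, H.one_mem, 0, by
    rw [map_one, smul_zero, add_zero]
    change _ = 1 + (p : ℤ_[p]) ^ m • castForm ℤ_[p] (0 : Dist ℤ A)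
    rw [map_zero, smul_zero, add_zero]⟩
  add_mem' := by
    rintro v w ⟨x, hx, g, hg⟩ ⟨y, hy, h, hh⟩
    obtain ⟨i, rfl⟩ := Nat.exists_eq_add_of_le hk
    refine ⟨x * y, H.mul_mem hx hy, g + h + (p : ℤ_[p]) ^ i •
      ((castForm ℤ_[p] v.1 + (p : ℤ_[p]) ^ k • g) *
        (castForm ℤ_[p] w.1 + (p : ℤ_[p]) ^ k • h)), ?_⟩
    rw [map_mul, hg, hh, castForm_add_lie]
    set F := castForm ℤ_[p] v.1
    set G := castForm ℤ_[p] w.1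
    simp only [add_mul, mul_add, one_mul, mul_one, smul_mul_assoc, mul_smul_comm, smul_add,
      smul_smul]
    match_scalars <;> ring
  neg_mem' := by
    rintro v ⟨x, hx, g, hg⟩
    obtain ⟨i, rfl⟩ := Nat.exists_eq_add_of_le hk
    have h1 := inv_eq_one_sub hg (ptForm_mul_inv x)
    set F := castForm ℤ_[p] v.1 + (p : ℤ_[p]) ^ k • g with hF
    have h2 : ptForm x⁻¹ = 1 - (p : ℤ_[p]) ^ (k + i) • F +
        (p : ℤ_[p]) ^ (k + i + (k + i)) • (F * F * ptForm x⁻¹) := by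
      conv_lhs => rw [h1, h1]
      simp only [mul_sub, mul_one, mul_smul_comm, smul_sub, smul_smul, mul_assoc]
      match_scalars <;> ring
    refine ⟨x⁻¹, H.inv_mem hx, -g + (p : ℤ_[p]) ^ i • (F * F * ptForm x⁻¹), ?_⟩
    have h3 : castForm ℤ_[p] (-v : lie ℤ A).1 = -castForm ℤ_[p] v.1 :=
      map_neg (castForm ℤ_[p]) v.1
    rw [h3]
    refine h2.trans ?_
    set Q := F * F * ptForm x⁻¹
    rw [hF]
    match_scalars <;> ring

/-- The leading terms of the elements of `H` congruent to `1` modulo `p ^ m`: the elements `v` of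
the Lie algebra for which `H` contains some `1 + p ^ m v + O(p ^ (m + 1))`. -/
def leadingTerms (H : Subgroup (Pts ℤ A ℤ_[p])) {m : ℕ} (hm : 1 ≤ m) : AddSubgroup (lie ℤ A) :=
  (approxTerms H hm).copy {v | ∃ x ∈ H, ∃ g : Form ℤ A ℤ_[p],
    ptForm x = 1 + (p : ℤ_[p]) ^ m • (castForm ℤ_[p] v.1 + (p : ℤ_[p]) • g)} <| by
      change _ = {v : lie ℤ A | ∃ x ∈ H, ∃ g : Form ℤ A ℤ_[p],
        ptForm x = 1 + (p : ℤ_[p]) ^ m • (castForm ℤ_[p] v.1 + (p : ℤ_[p]) ^ 1 • g)}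
      rw [pow_one]

variable {H K L : Subgroup (Pts ℤ A ℤ_[p])} {m n : ℕ} {hm : 1 ≤ m} {hn : 1 ≤ n}

lemma leadingTerms_mono (h : H ≤ K) : leadingTerms H hm ≤ leadingTerms K hm :=
  fun _ ⟨x, hx, g, hg⟩ => ⟨x, h hx, g, hg⟩

lemma prime_smul_mem_leadingTerms (w : lie ℤ A) : (p : ℤ) • w ∈ leadingTerms H hm := by
  refine ⟨1, H.one_mem, -castForm ℤ_[p] w.1, ?_⟩
  rw [castForm_zsmul_lie, map_one, smul_neg]
  simp

lemma mem_leadingTerms_of_smul {c : ℤ} (hc : ¬ (p : ℤ) ∣ c) {v : lie ℤ A}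
    (h : c • v ∈ leadingTerms H hm) : v ∈ leadingTerms H hm := by
  obtain ⟨a, b, hab⟩ := ((Nat.prime_iff_prime_int.1 (Fact.out : p.Prime)).coprime_iff_not_dvd).2 hc
  have h1 : v = (p : ℤ) • (a • v) + b • (c • v) := by
    rw [smul_smul, smul_smul, ← add_smul, mul_comm (p : ℤ), hab, one_smul]
  rw [h1]
  exact add_mem (prime_smul_mem_leadingTerms _) (zsmul_mem h b)

lemma lie_mem_leadingTerms {k : ℕ} {hk : 1 ≤ k} (hmn : m + n = k)
    (hL : ∀ x ∈ H, ∀ y ∈ K, x * y * x⁻¹ * y⁻¹ ∈ L) {v w : lie ℤ A}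
    (hv : v ∈ leadingTerms H hm) (hw : w ∈ leadingTerms K hn) :
    ⁅v, w⁆ ∈ leadingTerms L hk := by
  subst hmn
  obtain ⟨x, hx, g, hg⟩ := hv
  obtain ⟨y, hy, h, hh⟩ := hw
  obtain ⟨r, hr⟩ := exists_commutator_eq hm hn hg hh (ptForm_mul_inv x) (ptForm_mul_inv y)
  rw [← map_mul, ← map_mul, ← map_mul] at hr
  refine ⟨_, hL x hx y hy, castForm ℤ_[p] v.1 * h + g * castForm ℤ_[p] w.1 -
    castForm ℤ_[p] w.1 * g - h * castForm ℤ_[p] v.1 + (p : ℤ_[p]) • (g * h - h * g) + r,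
    hr.trans ?_⟩
  rw [castForm_lie]
  set F := castForm ℤ_[p] v.1
  set G := castForm ℤ_[p] w.1
  simp only [add_mul, mul_add, smul_mul_assoc, mul_smul_comm, smul_add, smul_sub, smul_smul]
  match_scalars <;> ring

/-- Raising to the `p`-th power. -/
lemma mem_leadingTerms_succ (hm : 2 ≤ m) {v : lie ℤ A}
    (hv : v ∈ leadingTerms H ((Nat.le_succ 1).trans hm)) :
    v ∈ leadingTerms H (m := m + 1) (Nat.le_add_left 1 m) := by
  obtain ⟨x, hx, g, hg⟩ := hv
  obtain ⟨i, rfl⟩ := Nat.exists_eq_add_of_le' hm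
  obtain ⟨q, hq⟩ := exists_one_add_pow_eq
    ((p : ℤ_[p]) ^ (i + 2) • (castForm ℤ_[p] v.1 + (p : ℤ_[p]) • g)) p
  rw [← hg, ← map_pow] at hq
  set F := castForm ℤ_[p] v.1 + (p : ℤ_[p]) • g with hF
  refine ⟨x ^ p, H.pow_mem hx p, g + (p : ℤ_[p]) ^ i • (F ^ 2 * q), hq.trans ?_⟩
  rw [smul_pow, smul_mul_assoc]
  set Q := F ^ 2 * q
  rw [hF, ← Nat.cast_smul_eq_nsmul ℤ_[p]]
  match_scalars <;> ring

end Layers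

end GroupScheme

/-! ### Second-order terms of commutators of root vectors -/

namespace GroupScheme

section ToralBracket

variable {O A M : Type*} [CommRing O] [IsDomain O] [IsPrincipalIdealRing O] [CommRing A]
  [HopfAlgebra O A] [Algebra.FiniteType O A] [AddCommGroup M]
  (π : A →ₐc[O] AddMonoidAlgebra O M)

lemma wtComp_lie_toral (φ : M →+ O) (v : lie O A) (γ : M) :
    wtComp π γ ⁅toral π φ, v⁆ = φ γ • wtComp π γ v := by
  classical
  have h1 : ∀ m, wtComp π γ ⁅toral π φ, wtComp π m v⁆ = φ γ • wtComp π γ (wtComp π m v) :=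
    fun m => by
      rw [lie_toral_of_mem π (wtComp_mem π m v), map_smul, wtComp_wtComp]
      split_ifs with h
      · rw [h]
      · rw [smul_zero, smul_zero]
  have h2 := sum_wtComp π v (s := wtSupp π v) subset_rfl
  rw [← h2, lie_sum, map_sum, map_sum, Finset.smul_sum]
  exact Finset.sum_congr rfl fun m _ => h1 m

end ToralBracket

namespace ChevalleyBasis

variable {A M : Type*} [CommRing A] [HopfAlgebra ℤ A] [AddCommGroup M]
  {π : A →ₐc[ℤ] AddMonoidAlgebra ℤ M} (hG : IsSplitReductive π) {Δ : Set M}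
  (C : ChevalleyBasis π Δ) {p : ℕ} [Fact p.Prime]

include hG in
/-- Root vectors of a Chevalley basis are primitive. -/
lemma dvd_of_smul_X_eq {n k : ℤ} {α : roots π} {w : lie ℤ A} (h : n • C.X α = k • w) : k ∣ n := by
  classical
  have := hG.smooth
  obtain ⟨t, ht⟩ := C.exists_eq_smul_X α (wtComp_mem π (α : M) w)
  have h1 := congrArg (wtComp π (α : M)) h
  rw [map_smul, map_smul, wtComp_of_mem π (C.X_mem_weightSpace α), if_pos rfl, ← ht,
    smul_smul] at h1
  exact ⟨t, smul_left_injective ℤ (C.X_ne_zero α) h1⟩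

include hG in
/-- An element which commutes modulo `p` with a regular toral element is toral modulo `p`. -/
lemma exists_eq_add_smul (φ : M →+ ℤ) (hφ : ∀ α ∈ roots π, (φ α : ZMod p) ≠ 0) {d m : lie ℤ A}
    (h : ⁅toral π φ, d⁆ = (p : ℤ) • m) :
    ∃ d₀ d' : lie ℤ A, d₀ ∈ weightSpace π 0 ∧ d = d₀ + (p : ℤ) • d' := by
  classical
  have := hG.smooth
  have hp : Prime (p : ℤ) := Nat.prime_iff_prime_int.1 Fact.out
  have h1 : ∀ γ : M, γ ≠ 0 → ∃ w : lie ℤ A, wtComp π γ d = (p : ℤ) • w := by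
    intro γ hγ
    by_cases hr : γ ∈ roots π
    · obtain ⟨a, b, hab⟩ := (hp.coprime_iff_not_dvd (n := φ γ)).2 fun hd =>
        hφ γ hr ((ZMod.intCast_zmod_eq_zero_iff_dvd _ _).2 hd)
      have h2 := wtComp_lie_toral π φ d γ
      rw [h, map_smul] at h2
      refine ⟨a • wtComp π γ d + b • wtComp π γ m, ?_⟩
      rw [smul_add, smul_comm _ b, h2, smul_smul, smul_smul, ← add_smul, mul_comm (p : ℤ), hab,
        one_smul]
    · exact ⟨0, by rw [eq_zero_of_mem_weightSpace hγ hr (wtComp_mem π γ d), smul_zero]⟩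
  choose! w hw using h1
  refine ⟨wtComp π 0 d, ∑ γ ∈ (wtSupp π d).erase 0, w γ, wtComp_mem π 0 d, ?_⟩
  have h3 := sum_wtComp π d (s := insert 0 (wtSupp π d)) (Finset.subset_insert _ _)
  rw [← Finset.add_sum_erase _ _ (Finset.mem_insert_self _ _), Finset.erase_insert_eq_erase] at h3
  rw [Finset.smul_sum, ← Finset.sum_congr rfl fun γ hγ => hw γ (Finset.ne_of_mem_erase hγ)]
  exact h3.symm

end ChevalleyBasis

section QuadraticTerm

variable {A : Type*} [CommRing A] [HopfAlgebra ℤ A] {p : ℕ} [Fact p.Prime]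

/-- For a point `1 + p (v + p f)` with `v` in the Lie algebra, `2 f - v²` is congruent to an element
`d` of the Lie algebra, modulo `p` and, if `p = 2`, even modulo `4`: `p² (2 f - v²)` is twice the
second-order term of the logarithm of the point. -/
lemma exists_quadratic_term [Algebra.FormallySmooth ℤ A] {x : Pts ℤ A ℤ_[p]}
    {v : lie ℤ A} {f : Form ℤ A ℤ_[p]} {N : ℕ} (hN : (p : ℤ_[p]) ^ N ∣ 2 * p)
    (hx : ptForm x = 1 + (p : ℤ_[p]) • (castForm ℤ_[p] v.1 + (p : ℤ_[p]) • f)) :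
    ∃ (d : lie ℤ A) (g : Form ℤ A ℤ_[p]), (2 : ℤ_[p]) • f =
      castForm ℤ_[p] v.1 * castForm ℤ_[p] v.1 + castForm ℤ_[p] d.1 + (p : ℤ_[p]) ^ N • g := by
  set X := castForm ℤ_[p] v.1
  have hp0 : (p : ℤ_[p]) ≠ 0 := by exact_mod_cast (Fact.out : p.Prime).ne_zero
  set ε : A → ℤ_[p] := fun a => ((Bialgebra.counitAlgHom ℤ A a : ℤ) : ℤ_[p])
  have hε : ∀ a, (1 : Form ℤ A ℤ_[p]) a = ε a := fun a => by
    change algebraMap ℤ ℤ_[p] _ = _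
    rw [algebraMap_int_padicInt]
    rfl
  have hεm : ∀ a b, ε (a * b) = ε a * ε b := fun a b => by
    simp only [ε, map_mul, Int.cast_mul]
  have hX : IsDer X := isDer_castForm v
  have hX1 : ∀ a b, X (a * b) = ε a * X b + X a * ε b := fun a b => by
    have := pullMul_ext.1 hX a b
    change X (a * b) = X a * (1 : Form ℤ A ℤ_[p]) b + (1 : Form ℤ A ℤ_[p]) a * X b at this
    rw [this, hε, hε]
    ring
  have hX2 : ∀ a b, (X * X) (a * b) = ε a * (X * X) b + 2 * (X a * X b) + (X * X) a * ε b :=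
    fun a b => by
      have h2 := hX.pullMul_pow 2 a b
      simp only [Finset.sum_range_succ, Finset.sum_range_zero, zero_add, Nat.choose_zero_right,
        Nat.choose_one_right, Nat.choose_self, Nat.cast_one, one_mul, pow_zero, pow_one, hε,
        Nat.reduceSub, Nat.cast_ofNat, Nat.sub_zero] at h2
      rw [← sq, h2]
  have hx1 : ∀ a, x.ofConv a = ε a + p * (X a + p * f a) := fun a => by
    have h2 := congrArg (fun f : Form ℤ A ℤ_[p] => f a) hx
    refine h2.trans ?_
    change (1 : Form ℤ A ℤ_[p]) a + _ = _
    rw [hε]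
    rfl
  have hf : ∀ a b, f (a * b) = ε a * f b + f a * ε b + X a * X b +
      p * (X a * f b + f a * X b + p * (f a * f b)) := fun a b => by
    have h3 := map_mul x.ofConv a b
    rw [hx1, hx1, hx1, hεm, hX1] at h3
    apply mul_left_cancel₀ (pow_ne_zero 2 hp0)
    linear_combination h3
  obtain ⟨d, g, hd⟩ := exists_lie_congr N ((2 : ℤ_[p]) • f - X * X) fun a b => by
    refine hN.trans ⟨X a * f b + f a * X b + p * (f a * f b), ?_⟩
    change (2 * f (a * b) - (X * X) (a * b)) - (ε a * (2 * f b - (X * X) b) +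
      (2 * f a - (X * X) a) * ε b) = _
    rw [hf, hX2]
    ring
  exact ⟨d, g, by rw [add_assoc, ← hd]; abel⟩

end QuadraticTerm

end GroupScheme

namespace GroupScheme

namespace ChevalleyBasis

variable {A M : Type*} [CommRing A] [HopfAlgebra ℤ A] [AddCommGroup M]
  {π : A →ₐc[ℤ] AddMonoidAlgebra ℤ M} (hG : IsSplitReductive π) {Δ : Set M}
  (C : ChevalleyBasis π Δ) {p : ℕ} [Fact p.Prime] {Λ : AddSubgroup (lie ℤ A)}

include hG in
/-- If `x` has leading term `v = C.X α` at level `1` and quadratic term `f`, then the commutator of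
`x` with `1 + p² (C.X β + p u) + …` is `1 + p³ (toral π (C.h α) + p δ) + …`, where `δ` satisfies the
congruence `hδ` with `d = 2 f - v²`. This determines `2 δ` up to `Λ`; for `p = 2` one has to show
in addition that `⁅d, C.X β⁆` lies in `2 Λ`, for which the regular element `φ` is needed. -/
lemma mem_of_two_smul_eq {α β : roots π} (hβ : (β : M) = -α) (φ : M →+ ℤ)
    (hφ : ∀ α ∈ roots π, (φ α : ZMod p) ≠ 0) (hX : ∀ α, C.X α ∈ Λ)
    (hlie : ∀ (v : lie ℤ A) α, ⁅v, C.X α⁆ ∈ Λ) (hp : ∀ w : lie ℤ A, (p : ℤ) • w ∈ Λ)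
    (hdiv : ∀ (c : ℤ) (v : lie ℤ A), ¬ (p : ℤ) ∣ c → c • v ∈ Λ → v ∈ Λ)
    {d u δ κ : lie ℤ A} {N : ℕ} (hN : N = if p = 2 then 2 else 1)
    {f g : Form ℤ A ℤ_[p]} (hd : (2 : ℤ_[p]) • f = castForm ℤ_[p] (C.X α).1 *
      castForm ℤ_[p] (C.X α).1 + castForm ℤ_[p] d.1 + (p : ℤ_[p]) ^ N • g)
    (hδ : (2 : ℤ) • δ + (2 : ℤ) • C.X α - ⁅d, C.X β⁆ - (2 : ℤ) • ⁅C.X α, u⁆ =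
      (p : ℤ) ^ N • κ) : δ ∈ Λ := by
  have := hG.smooth
  have hu : ⁅C.X α, u⁆ ∈ Λ := by
    rw [← lie_skew]
    exact neg_mem (hlie u α)
  by_cases hp2 : p = 2
  · subst hp2
    rw [if_pos rfl] at hN
    subst hN
    set X := castForm ℤ_[2] (C.X α).1 with hXdef
    set Y := castForm ℤ_[2] (C.X β).1 with hYdef
    have h2 : ((2 : ℕ) : ℤ_[2]) = 2 := by norm_num
    rw [h2] at hd
    have hd' : castForm ℤ_[2] d.1 = (2 : ℤ_[2]) • f - X * X - (2 : ℤ_[2]) ^ 2 • g := by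
      rw [hd]; abel
    -- `d` is congruent to `-X²` modulo `2`, and `X²` has the even weight `2 α`, so that `d`
    -- commutes with toral elements modulo `2`
    obtain ⟨m, hm⟩ : ∃ m, ⁅toral π φ, d⁆ = ((2 : ℕ) : ℤ) ^ 1 • m := by
      have h3 : castForm ℤ_[2] (toral π φ).1 * X - X * castForm ℤ_[2] (toral π φ).1 =
          (φ α : ℤ_[2]) • X := by
        rw [hXdef, ← castForm_lie, lie_toral_of_mem π (C.X_mem_weightSpace α), castForm_zsmul_lie]
      set T := castForm ℤ_[2] (toral π φ).1
      have h4 : T * (X * X) - X * X * T = (2 : ℤ_[2]) • ((φ α : ℤ_[2]) • (X * X)) := by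
        have h5 : T * (X * X) - X * X * T = (T * X - X * T) * X + X * (T * X - X * T) := by
          noncomm_ring
        rw [h5, h3, smul_mul_assoc, mul_smul_comm, two_smul]
      refine exists_eq_pow_smul (p := 2) (n := 1) (g := (T * f - f * T) - (φ α : ℤ_[2]) • (X * X) -
        (2 : ℤ_[2]) • (T * g - g * T)) ?_
      have h6 : T * castForm ℤ_[2] d.1 - castForm ℤ_[2] d.1 * T =
          (2 : ℤ_[2]) • (T * f - f * T) - (T * (X * X) - X * X * T) -
            (2 : ℤ_[2]) ^ 2 • (T * g - g * T) := by
        rw [hd']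
        simp only [mul_sub, sub_mul, smul_mul_assoc, mul_smul_comm, smul_sub]
        abel
      rw [castForm_lie, h6, h4, h2]
      match_scalars <;> ring
    obtain ⟨d₀, d', hd₀, rfl⟩ := exists_eq_add_smul hG φ hφ (m := m) (by simpa using hm)
    obtain ⟨m', hm'⟩ : ∃ m', ⁅d₀ + ((2 : ℕ) : ℤ) • d', C.X β⁆ = ((2 : ℕ) : ℤ) ^ 1 • m' := by
      have h3 : X * Y - Y * X = castForm ℤ_[2] (toral π (C.h α)).1 := by
        rw [hXdef, hYdef, ← castForm_lie, C.lie_X_neg α β hβ]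
      set T := castForm ℤ_[2] (toral π (C.h α)).1
      have h4 : T * X - X * T = (2 : ℤ_[2]) • X := by
        rw [hXdef, ← castForm_lie, C.lie_H_X, C.h_self, castForm_zsmul_lie]
        norm_num
      have h5 : X * X * Y - Y * (X * X) = (2 : ℤ_[2]) • (T * X - X) := by
        have h7 : X * X * Y - Y * (X * X) = X * (X * Y - Y * X) + (X * Y - Y * X) * X := by
          noncomm_ring
        have h8 : X * T = T * X - (2 : ℤ_[2]) • X := by rw [← h4]; abel
        rw [h7, h3, h8]
        match_scalars <;> ring
      refine exists_eq_pow_smul (p := 2) (n := 1) (g := (f * Y - Y * f) - (T * X - X) -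
        (2 : ℤ_[2]) • (g * Y - Y * g)) ?_
      rw [castForm_lie, hd']
      have h6 : (((2 : ℤ_[2]) • f - X * X - (2 : ℤ_[2]) ^ 2 • g) * Y -
          Y * ((2 : ℤ_[2]) • f - X * X - (2 : ℤ_[2]) ^ 2 • g)) =
          (2 : ℤ_[2]) • (f * Y - Y * f) - (X * X * Y - Y * (X * X)) -
            (2 : ℤ_[2]) ^ 2 • (g * Y - Y * g) := by
        simp only [mul_sub, sub_mul, smul_mul_assoc, mul_smul_comm, smul_sub]
        abel
      rw [h6, h5, h2]
      match_scalars <;> ring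
    obtain ⟨c, hc⟩ : ∃ c : ℤ, c • C.X β = ⁅d₀, C.X β⁆ := by
      refine C.exists_eq_smul_X β ?_
      have := lie_mem_weightSpace π hd₀ (C.X_mem_weightSpace β)
      rwa [zero_add] at this
    rw [pow_one, Nat.cast_ofNat] at hm'
    rw [Nat.cast_ofNat] at hδ
    rw [add_lie, zsmul_lie] at hm' hδ
    obtain ⟨c', rfl⟩ := C.dvd_of_smul_X_eq hG (n := c) (k := 2) (α := β) (w := m' - ⁅d', C.X β⁆) (by
      rw [hc, smul_sub, ← hm', add_sub_cancel_right])
    have h9 : δ = -C.X α + c' • C.X β + ⁅d', C.X β⁆ + ⁅C.X α, u⁆ + ((2 : ℕ) : ℤ) • κ := by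
      have := hG.smooth
      apply smul_right_injective _ (two_ne_zero : (2 : ℤ) ≠ 0)
      change (2 : ℤ) • δ = (2 : ℤ) • _
      have h10 : (2 : ℤ) • δ = (2 : ℤ) ^ 2 • κ - (2 : ℤ) • C.X α +
          (⁅d₀, C.X β⁆ + (2 : ℤ) • ⁅d', C.X β⁆) + (2 : ℤ) • ⁅C.X α, u⁆ := by
        rw [← hδ]; abel
      rw [h10, ← hc, Nat.cast_ofNat]
      module
    rw [h9]
    exact add_mem (add_mem (add_mem (add_mem (neg_mem (hX α)) (zsmul_mem (hX β) c'))
      (hlie d' β)) hu) (hp κ)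
  -- for odd `p` the factor `2` is harmless
  · rw [if_neg hp2] at hN
    subst hN
    refine hdiv 2 δ (fun h => hp2 ?_) ?_
    · have h1 : p ∣ 2 := by exact_mod_cast h
      exact (Nat.prime_dvd_prime_iff_eq Fact.out Nat.prime_two).1 h1
    · have h10 : (2 : ℤ) • δ = (p : ℤ) ^ 1 • κ - (2 : ℤ) • C.X α +
          ⁅d, C.X β⁆ + (2 : ℤ) • ⁅C.X α, u⁆ := by
        rw [← hδ]; abel
      rw [h10, pow_one]
      exact add_mem (add_mem (sub_mem (hp κ) (zsmul_mem (hX α) 2)) (hlie d β)) (zsmul_mem hu 2)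

end ChevalleyBasis

end GroupScheme

namespace GroupScheme

lemma form_smul_cancel {R A S : Type*} [CommRing R] [CommRing A] [HopfAlgebra R A] [CommRing S]
    [IsDomain S] [Algebra R S] {c : S} (hc : c ≠ 0) {f g : Form R A S} (h : c • f = c • g) :
    f = g := by
  apply WithConv.ofConv_injective
  ext1 a
  exact mul_left_cancel₀ hc (congrArg (fun f : Form R A S => f a) h)

namespace ChevalleyBasis

variable {A M : Type*} [CommRing A] [HopfAlgebra ℤ A] [AddCommGroup M]
  {π : A →ₐc[ℤ] AddMonoidAlgebra ℤ M} (hG : IsSplitReductive π) {Δ : Set M}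
  (C : ChevalleyBasis π Δ) {p : ℕ} [Fact p.Prime] {Λ : AddSubgroup (lie ℤ A)}

include hG in
/-- Commutators of elements with opposite root vectors as leading terms give toral elements to
second order, up to `Λ`. -/
lemma exists_add_smul_mem_approxTerms {α β : roots π} (hβ : (β : M) = -α) (φ : M →+ ℤ)
    (hφ : ∀ α ∈ roots π, (φ α : ZMod p) ≠ 0) (hX : ∀ α, C.X α ∈ Λ)
    (hlie : ∀ (v : lie ℤ A) α, ⁅v, C.X α⁆ ∈ Λ) (hp : ∀ w : lie ℤ A, (p : ℤ) • w ∈ Λ)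
    (hdiv : ∀ (c : ℤ) (v : lie ℤ A), ¬ (p : ℤ) ∣ c → c • v ∈ Λ → v ∈ Λ)
    {H K : Subgroup (Pts ℤ A ℤ_[p])} (hHK : ∀ x ∈ H, ∀ y ∈ K, x * y * x⁻¹ * y⁻¹ ∈ K)
    (hXH : C.X α ∈ leadingTerms H (le_refl 1))
    (hXK : C.X β ∈ leadingTerms K (one_le_two : 1 ≤ 2)) :
    ∃ δ ∈ Λ, toral π (C.h α) + (p : ℤ) • δ ∈ approxTerms K (Nat.le_succ 2 : 2 ≤ 3) := by
  have := hG.smooth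
  have hp0 : (p : ℤ_[p]) ≠ 0 := by exact_mod_cast (Fact.out : p.Prime).ne_zero
  obtain ⟨x, hxH, f, hx⟩ := hXH
  obtain ⟨y, hyK, g, hy⟩ := hXK
  rw [pow_one] at hx
  -- the third term of `y` comes from the Lie algebra
  obtain ⟨u, g, rfl⟩ : ∃ (u : lie ℤ A) (g' : Form ℤ A ℤ_[p]),
      g = castForm ℤ_[p] u.1 + (p : ℤ_[p]) • g' := by
    obtain ⟨v, g', h1⟩ := exists_lie_of_ptForm_eq hy
    obtain ⟨u, hu⟩ := exists_eq_pow_smul (p := p) (n := 1) (v := v - C.X β)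
      (g := g - (p : ℤ_[p]) • g') (by
        have h2 : castForm ℤ_[p] (v - C.X β : lie ℤ A).1 =
          castForm ℤ_[p] v.1 - castForm ℤ_[p] (C.X β).1 := map_sub (castForm ℤ_[p]) _ _
        have h3 : castForm ℤ_[p] v.1 = castForm ℤ_[p] (C.X β).1 + (p : ℤ_[p]) • g -
            (p : ℤ_[p]) ^ 2 • g' := by rw [h1]; abel
        rw [h2, h3]
        match_scalars <;> ring)
    refine ⟨u, g', ?_⟩
    apply form_smul_cancel hp0
    have h4 : castForm ℤ_[p] v.1 = castForm ℤ_[p] (C.X β).1 + (p : ℤ_[p]) • castForm ℤ_[p] u.1 := by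
      rw [sub_eq_iff_eq_add.1 hu, castForm_add_lie, castForm_zsmul_lie, add_comm, pow_one,
        Int.cast_natCast]
    rw [h4, add_assoc] at h1
    rw [add_left_cancel h1]
    match_scalars <;> ring
  obtain ⟨r, hr⟩ := exists_commutator_eq_second hx hy (ptForm_mul_inv x) (ptForm_mul_inv y)
  rw [← map_mul, ← map_mul, ← map_mul] at hr
  set X := castForm ℤ_[p] (C.X α).1 with hXdef
  set Y := castForm ℤ_[p] (C.X β).1 with hYdef
  set U := castForm ℤ_[p] u.1 with hU
  have hT : X * Y - Y * X = castForm ℤ_[p] (toral π (C.h α)).1 := by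
    rw [hXdef, hYdef, ← castForm_lie, C.lie_X_neg α β hβ]
  set T := castForm ℤ_[p] (toral π (C.h α)).1
  rw [hT] at hr
  have hTX : T * X - X * T = (2 : ℤ_[p]) • X := by
    rw [hXdef, ← castForm_lie, C.lie_H_X, C.h_self, castForm_zsmul_lie]
    norm_num
  -- the first two terms of the commutator come from the Lie algebra
  obtain ⟨w, g₁, h1⟩ := exists_lie_of_ptForm_eq hr
  obtain ⟨δ, hδ⟩ := exists_eq_pow_smul (p := p) (n := 1) (v := w - toral π (C.h α))
    (g := (f * Y - Y * f + (X * (U + (p : ℤ_[p]) • g) - (U + (p : ℤ_[p]) • g) * X) - T * X) +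
      (p : ℤ_[p]) • r - (p : ℤ_[p]) ^ 2 • g₁) (by
        have h2 : castForm ℤ_[p] (w - toral π (C.h α) : lie ℤ A).1 =
          castForm ℤ_[p] w.1 - T := map_sub (castForm ℤ_[p]) _ _
        rw [h2, ← sub_eq_iff_eq_add.2 h1]
        match_scalars <;> ring)
  have hw : w = toral π (C.h α) + (p : ℤ) • δ := by rw [sub_eq_iff_eq_add'.1 hδ, pow_one]
  have hW : castForm ℤ_[p] w.1 = T + (p : ℤ_[p]) • castForm ℤ_[p] δ.1 := by
    rw [hw, castForm_add_lie, castForm_zsmul_lie, Int.cast_natCast]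
  set D := castForm ℤ_[p] δ.1
  refine ⟨δ, ?_, ?_⟩
  · have h2 : D + (p : ℤ_[p]) ^ 2 • g₁ = (f * Y - Y * f + (X * (U + (p : ℤ_[p]) • g) -
        (U + (p : ℤ_[p]) • g) * X) - T * X) + (p : ℤ_[p]) • r := by
      apply form_smul_cancel hp0
      have h3 : (p : ℤ_[p]) • (D + (p : ℤ_[p]) ^ 2 • g₁) =
          T + (p : ℤ_[p]) • D + (p : ℤ_[p]) ^ 3 • g₁ - T := by
        match_scalars <;> ring
      rw [h3, ← hW, ← h1]
      match_scalars <;> ring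
    obtain ⟨N, hN, hN1, hN2⟩ : ∃ N, N = (if p = 2 then 2 else 1) ∧ (p : ℤ_[p]) ^ N ∣ 2 * p ∧
        ∃ c : ℤ_[p], (2 : ℤ_[p]) * p = (p : ℤ_[p]) ^ N * c := by
      refine ⟨_, rfl, ?_, ?_⟩ <;> split_ifs with h2
      · subst h2
        exact ⟨1, by push_cast; ring⟩
      · exact ⟨2, by ring⟩
      · subst h2
        exact ⟨1, by push_cast; ring⟩
      · exact ⟨2, by ring⟩
    obtain ⟨c, hc⟩ := hN2
    obtain ⟨d, g₂, hd⟩ := exists_quadratic_term hN1 hx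
    refine Exists.elim (exists_eq_pow_smul (p := p) (n := N) (v := (2 : ℤ) • δ +
      (2 : ℤ) • C.X α - ⁅d, C.X β⁆ - (2 : ℤ) • ⁅C.X α, u⁆) (g := g₂ * Y - Y * g₂ +
        c • (X * g - g * X + r - (p : ℤ_[p]) • g₁)) ?_) ?_
    rotate_left
    · intro κ hκ
      exact C.mem_of_two_smul_eq hG hβ φ hφ hX hlie hp hdiv hN hd hκ
    · have e1 : castForm ℤ_[p] ((2 : ℤ) • δ + (2 : ℤ) • C.X α - ⁅d, C.X β⁆ -
          (2 : ℤ) • ⁅C.X α, u⁆ : lie ℤ A).1 = castForm ℤ_[p] ((2 : ℤ) • δ : lie ℤ A).1 +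
          castForm ℤ_[p] ((2 : ℤ) • C.X α : lie ℤ A).1 - castForm ℤ_[p] (⁅d, C.X β⁆ : lie ℤ A).1 -
          castForm ℤ_[p] ((2 : ℤ) • ⁅C.X α, u⁆ : lie ℤ A).1 := by
        rw [← map_add, ← map_sub, ← map_sub]
        rfl
      rw [e1, castForm_zsmul_lie, castForm_zsmul_lie, castForm_zsmul_lie, castForm_lie,
        castForm_lie, ← hXdef, ← hYdef, ← hU]
      change ((2 : ℤ) : ℤ_[p]) • D + _ - _ - _ = _
      rw [eq_sub_of_add_eq h2]
      have e2 : castForm ℤ_[p] d.1 = (2 : ℤ_[p]) • f - X * X - (p : ℤ_[p]) ^ N • g₂ := by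
        rw [hd]; abel
      have e3 : X * X * Y - Y * (X * X) = (2 : ℤ_[p]) • (T * X - X) := by
        have e4 : X * X * Y - Y * (X * X) = X * (X * Y - Y * X) + (X * Y - Y * X) * X := by
          noncomm_ring
        have e5 : X * T = T * X - (2 : ℤ_[p]) • X := by rw [← hTX]; abel
        rw [e4, hT, e5]
        match_scalars <;> ring
      have e6 : X * X * Y = (2 : ℤ_[p]) • (T * X - X) + Y * (X * X) := by rw [← e3]; abel
      rw [e2]
      simp only [add_mul, mul_add, sub_mul, mul_sub, smul_mul_assoc, mul_smul_comm, smul_add,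
        smul_sub, smul_smul, e6]
      have e7 : (p : ℤ_[p]) ^ N * c = 2 * p := hc.symm
      simp only [← mul_assoc, e7]
      push_cast
      match_scalars <;> ring
  · rw [← hw]
    refine ⟨_, hHK x hxH y hyK, (p : ℤ_[p]) • g₁, ?_⟩
    rw [hr, h1]
    match_scalars <;> ring

end ChevalleyBasis

end GroupScheme

/-! ### The fourth layer contains the derived Lie algebra -/

namespace GroupScheme

namespace ChevalleyBasis

variable {A M : Type*} [CommRing A] [HopfAlgebra ℤ A] [AddCommGroup M]
  {π : A →ₐc[ℤ] AddMonoidAlgebra ℤ M} (hG : IsSplitReductive π) {Δ : Set M}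
  (C : ChevalleyBasis π Δ) {p : ℕ} [Fact p.Prime] {Λ : AddSubgroup (lie ℤ A)}

include hG in
/-- Root space components are accounted for by the root vectors in `Λ`; only the weight zero
component remains. -/
lemma exists_mem_weightSpace_zero (hX : ∀ α, C.X α ∈ Λ)
    (v : lie ℤ A) : ∃ v₀ ∈ weightSpace π 0, v - v₀ ∈ Λ ∧ v - v₀ ∈ lieDer ℤ A := by
  classical
  have := hG.smooth
  refine ⟨wtComp π 0 v, wtComp_mem π 0 v, ?_⟩
  have h3 := sum_wtComp π v (s := insert 0 (wtSupp π v)) (Finset.subset_insert _ _)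
  rw [← Finset.add_sum_erase _ _ (Finset.mem_insert_self _ _), Finset.erase_insert_eq_erase] at h3
  have h1 : ∀ γ ∈ (wtSupp π v).erase 0, wtComp π γ v ∈ Λ ∧ wtComp π γ v ∈ lieDer ℤ A := by
    intro γ hγ
    by_cases hr : γ ∈ roots π
    · obtain ⟨c, hc⟩ := C.exists_eq_smul_X ⟨γ, hr⟩ (wtComp_mem π γ v)
      rw [← hc]
      exact ⟨zsmul_mem (hX _) c, Submodule.smul_mem _ _ (C.X_mem _)⟩
    · rw [eq_zero_of_mem_weightSpace (Finset.ne_of_mem_erase hγ) hr (wtComp_mem π γ v)]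
      exact ⟨zero_mem _, zero_mem _⟩
  have h2 : v - wtComp π 0 v = ∑ γ ∈ (wtSupp π v).erase 0, wtComp π γ v := by
    rw [sub_eq_iff_eq_add', h3]
  rw [h2]
  exact ⟨sum_mem fun γ hγ => (h1 γ hγ).1, sum_mem fun γ hγ => (h1 γ hγ).2⟩

include hG in
/-- Brackets with root vectors never leave the span of the Chevalley basis, even if the Lie algebra
is larger. -/
lemma lie_X_mem (hX : ∀ α, C.X α ∈ Λ) (hH : ∀ α : roots π, (α : M) ∈ Δ → toral π (C.h α) ∈ Λ)
    (v : lie ℤ A) (α : roots π) : ⁅v, C.X α⁆ ∈ Λ := by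
  classical
  have := hG.smooth
  have hH' : ∀ α : roots π, toral π (C.h α) ∈ Λ := fun α => by
    have h1 := C.H_span α
    have h2 : Submodule.span ℤ ((fun β => toral π (C.h β)) '' {β : roots π | (β : M) ∈ Δ}) ≤
        AddSubgroup.toIntSubmodule Λ := by
      rw [Submodule.span_le]
      rintro _ ⟨β, hβ, rfl⟩
      exact hH β hβ
    exact h2 h1
  have h1 : ∀ γ, ⁅wtComp π γ v, C.X α⁆ ∈ Λ := fun γ => by
    have hγ := wtComp_mem π γ v
    by_cases h0 : γ = 0
    · subst h0
      obtain ⟨c, hc⟩ := C.exists_eq_smul_X α (v := ⁅wtComp π 0 v, C.X α⁆) (by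
        have := lie_mem_weightSpace π hγ (C.X_mem_weightSpace α)
        rwa [zero_add] at this)
      rw [← hc]
      exact zsmul_mem (hX α) c
    by_cases hr : γ ∈ roots π
    · obtain ⟨c, hc⟩ := C.exists_eq_smul_X ⟨γ, hr⟩ hγ
      rw [← hc, zsmul_lie]
      refine zsmul_mem ?_ c
      by_cases h2 : γ + α = 0
      · rw [C.lie_X_neg ⟨γ, hr⟩ α (neg_eq_of_add_eq_zero_right h2).symm]
        exact hH' _
      by_cases h3 : γ + α ∈ roots π
      · rw [(C.lie_X_X ⟨γ, hr⟩ α ⟨_, h3⟩ rfl).1]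
        exact zsmul_mem (hX _) _
      · rw [C.lie_X_X_zero ⟨γ, hr⟩ α h2 h3]
        exact zero_mem _
    · rw [eq_zero_of_mem_weightSpace h0 hr hγ, zero_lie]
      exact zero_mem _
  have h2 := sum_wtComp π v (s := wtSupp π v) subset_rfl
  rw [← h2, sum_lie]
  exact sum_mem fun γ _ => h1 γ

include hG in
/-- A subgroup containing enough root vectors in its first layer contains the derived Lie algebra
in its fourth layer. -/
theorem lieDer_le_leadingTerms [Module.Free ℤ M] [Module.Finite ℤ M]
    (hΔ : IsSimpleSystem (roots π) Δ)
    (hp : ∀ α β : roots π, (α : M) + β ∈ roots π → |C.N α β| < p)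
    (φ : M →+ ℤ) (hφ : ∀ α ∈ roots π, (φ α : ZMod p) ≠ 0)
    {H K : Subgroup (Pts ℤ A ℤ_[p])} (hKH : K ≤ H)
    (hHH : ∀ x ∈ H, ∀ y ∈ H, x * y * x⁻¹ * y⁻¹ ∈ K)
    (hφH : toral π φ ∈ leadingTerms H (le_refl 1))
    (hXH : ∀ α : roots π, Odd (height Δ (α : M)) → C.X α ∈ leadingTerms H (le_refl 1))
    {v : lie ℤ A} (hv : v ∈ lieDer ℤ A) :
    v ∈ leadingTerms K (m := 4) (by norm_num) := by
  classical
  have := hG.smooth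
  have hodd : ∀ α : roots π, Odd (height Δ (α : M)) →
      C.X α ∈ leadingTerms K (one_le_two : 1 ≤ 2) := fun α hα => by
    refine mem_leadingTerms_of_smul (c := φ α)
      (fun h => hφ α α.2 ((ZMod.intCast_zmod_eq_zero_iff_dvd _ _).2 h)) ?_
    rw [← lie_toral_of_mem π (C.X_mem_weightSpace α)]
    exact lie_mem_leadingTerms (m := 1) (n := 1) (k := 2) one_add_one_eq_two hHH hφH (hXH α hα)
  have hX2 : ∀ α, C.X α ∈ leadingTerms K (one_le_two : 1 ≤ 2) := fun γ => by
    by_cases hγ : Odd (height Δ (γ : M))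
    · exact hodd γ hγ
    · obtain ⟨α, β, hα, hβ, h1⟩ := C.exists_odd_add_odd hG hΔ γ hγ
      obtain ⟨h2, h3⟩ := C.lie_X_X α β γ h1
      refine mem_leadingTerms_of_smul (c := C.N α β) (fun h => h3 ?_) ?_
      · exact Int.eq_zero_of_abs_lt_dvd h (hp α β (h1 ▸ γ.2))
      · rw [← h2]
        exact lie_mem_leadingTerms (m := 1) (n := 1) (k := 2) one_add_one_eq_two hHH (hXH α hα)
          (hXH β hβ)
  have h24 : ∀ v : lie ℤ A, v ∈ leadingTerms K (one_le_two : 1 ≤ 2) →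
      v ∈ leadingTerms K (m := 4) (by norm_num) := fun v hv =>
    mem_leadingTerms_succ (m := 3) (by norm_num) (mem_leadingTerms_succ (m := 2) le_rfl hv)
  have hoddΔ : ∀ α : roots π, (α : M) ∈ Δ → Odd (height Δ (α : M)) := fun α hα => by
    rw [height_of_mem hΔ.2 hα]
    exact odd_one
  have hoddn : ∀ α : roots π, (α : M) ∈ Δ → Odd (height Δ (C.negRoot hG α : M)) := fun α hα => by
    change Odd (height Δ (-(α : M)))
    rw [height_neg hΔ α.2]
    exact (hoddΔ α hα).neg
  have hH2 : ∀ α : roots π, (α : M) ∈ Δ →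
      toral π (C.h α) ∈ leadingTerms K (one_le_two : 1 ≤ 2) := fun α hα => by
    rw [← C.lie_X_neg α (C.negRoot hG α) rfl]
    exact lie_mem_leadingTerms (m := 1) (n := 1) (k := 2) one_add_one_eq_two hHH
      (hXH α (hoddΔ α hα)) (hXH _ (hoddn α hα))
  have hX4 := fun α => h24 _ (hX2 α)
  have hH4 := fun α hα => h24 _ (hH2 α hα)
  obtain ⟨v₀, hv₀, h1, h2⟩ := C.exists_mem_weightSpace_zero hG hX4 v
  suffices h : v₀ ∈ leadingTerms K (m := 4) (by norm_num) by
    have := add_mem h1 h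
    rwa [sub_add_cancel] at this
  have hv₀' : v₀ ∈ lieDer ℤ A := by
    have := sub_mem hv h2
    rwa [sub_sub_cancel] at this
  have : Finite (roots π) := (finite_roots (A := A) π).to_subtype
  let := Fintype.ofFinite {β : roots π // (β : M) ∈ Δ}
  obtain ⟨n, c, hn, hc⟩ := C.exists_smul_eq_sum hG hΔ φ hφ hv₀' hv₀
  -- if `p` divides the denominator `n`, the missing factor `p` is gained by dividing the
  -- `1 + p³ (H_β + p δ_β) + O(p⁵)`, whose combination has `H`-part divisible by `p`
  by_cases hpn : (p : ℤ) ∣ n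
  · obtain ⟨n, rfl⟩ := hpn
    have hn' : ¬ (p : ℤ) ∣ n := fun ⟨k, hk⟩ => hn ⟨k, by rw [hk]; ring⟩
    refine mem_leadingTerms_of_smul hn' ?_
    choose δ hδ hδ' using fun β : {β : roots π // (β : M) ∈ Δ} =>
      C.exists_add_smul_mem_approxTerms hG (α := β.1) (β := C.negRoot hG β.1) rfl φ hφ hX4
        (C.lie_X_mem hG hX4 hH4) (fun w => prime_smul_mem_leadingTerms w)
        (fun c v hc hv => mem_leadingTerms_of_smul hc hv)
        (fun x hx y hy => hHH x hx y (hKH hy)) (hXH β.1 (hoddΔ _ β.2)) (hX2 (C.negRoot hG β.1))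
    have h3 : (p : ℤ) • (n • v₀ + ∑ β, c β • δ β) ∈
        approxTerms K (Nat.le_succ 2 : 2 ≤ 3) := by
      have h4 := sum_mem fun β (_ : β ∈ Finset.univ) => zsmul_mem (hδ' β) (c β)
      simp only [smul_add, Finset.sum_add_distrib] at h4
      rw [← hc] at h4
      rw [smul_add, smul_smul, Finset.smul_sum]
      simpa only [smul_comm (p : ℤ)] using h4
    obtain ⟨z, hz, g, hg⟩ := h3
    have h5 : n • v₀ + ∑ β, c β • δ β ∈ leadingTerms K (m := 4) (by norm_num) := by
      refine ⟨z, hz, g, hg.trans ?_⟩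
      rw [castForm_zsmul_lie, Int.cast_natCast]
      match_scalars <;> ring
    have h6 := sub_mem h5 (sum_mem fun β (_ : β ∈ Finset.univ) => zsmul_mem (hδ β) (c β))
    rwa [add_sub_cancel_right] at h6
  · refine mem_leadingTerms_of_smul hpn ?_
    rw [hc]
    exact sum_mem fun β _ => zsmul_mem (hH4 β.1 β.2) (c β)

end ChevalleyBasis

end GroupScheme

/-! ### Leading terms of points of the derived group -/

namespace GroupScheme

section DerivedLeadingTerm

variable {A : Type*} [CommRing A] [HopfAlgebra ℤ A]

/-- An element of the Lie algebra which vanishes on the ideal of the derived group modulo a high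
power of `p` lies in the derived Lie algebra modulo `p`: this is the Artin-Rees lemma. -/
lemma exists_mem_lieDer_of_pow_dvd [Algebra.FiniteType ℤ A] (p : ℤ) :
    ∃ n : ℕ, ∀ v : lie ℤ A, (∀ a ∈ derIdeal ℤ A, p ^ n ∣ v.1 a) →
      ∃ w : lie ℤ A, v - p • w ∈ lieDer ℤ A := by
  -- finitely many functions in the ideal suffice
  let ev : A →ₗ[ℤ] Module.Dual ℤ (lie ℤ A) := AddMonoidHom.toIntLinearMap
    { toFun := fun a => AddMonoidHom.toIntLinearMap
        { toFun := fun v => v.1 a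
          map_zero' := rfl
          map_add' := fun _ _ => rfl }
      map_zero' := LinearMap.ext fun v => map_zero v.1.ofConv
      map_add' := fun a b => LinearMap.ext fun v => map_add v.1.ofConv a b }
  obtain ⟨S, hS⟩ := IsNoetherian.noetherian
    (((derIdeal ℤ A).restrictScalars ℤ).map ev)
  let f : lie ℤ A →ₗ[ℤ] (S → ℤ) := LinearMap.pi fun s => s.1
  obtain ⟨k, hk⟩ := Ideal.exists_pow_inf_eq_pow_smul (Ideal.span {p}) (LinearMap.range f)
  refine ⟨k + 1, fun v hv => ?_⟩
  have h1 : ∀ s ∈ S, p ^ (k + 1) ∣ s v := fun s hs => by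
    have h2 : s ∈ ((derIdeal ℤ A).restrictScalars ℤ).map ev := hS ▸ Submodule.subset_span hs
    obtain ⟨a, ha, rfl⟩ := h2
    exact hv a ha
  have h2 : f v ∈ Ideal.span {p} ^ (k + 1) • (⊤ : Submodule ℤ (S → ℤ)) ⊓ LinearMap.range f := by
    refine ⟨?_, v, rfl⟩
    choose c hc using h1
    have h3 : f v = p ^ (k + 1) • fun s : S => c s.1 s.2 := by
      ext s
      exact hc s.1 s.2
    rw [h3]
    exact Submodule.smul_mem_smul
      (Ideal.pow_mem_pow (Ideal.mem_span_singleton_self p) _) trivial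
  rw [hk _ (Nat.le_succ k), Nat.succ_sub le_rfl, Nat.sub_self, pow_one] at h2
  rw [Submodule.ideal_span_singleton_smul] at h2
  obtain ⟨_, ⟨-, w, rfl⟩, hw⟩ := (Submodule.mem_smul_pointwise_iff_exists _ _ _).1 h2
  refine ⟨w, fun a ha => ?_⟩
  have h3 : f (v - p • w) = 0 := by
    rw [map_sub, map_smul, hw, sub_self]
  have h4 : ((derIdeal ℤ A).restrictScalars ℤ).map ev ≤
      LinearMap.ker (LinearMap.applyₗ (R := ℤ) (M₂ := ℤ) (v - p • w)) := by
    rw [← hS, Submodule.span_le]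
    exact fun s hs => congrFun h3 ⟨s, hs⟩
  exact h4 ⟨a, ha, rfl⟩

end DerivedLeadingTerm

section Padic

variable {A : Type*} [CommRing A] [HopfAlgebra ℤ A] {p : ℕ} [Fact p.Prime]

lemma exists_ptForm_pow_eq {m : ℕ} (hm : 2 ≤ m) {u : Pts ℤ A ℤ_[p]} {F : Form ℤ A ℤ_[p]}
    (hF : ptForm u = 1 + (p : ℤ_[p]) ^ m • F) (j : ℕ) : ∃ G : Form ℤ A ℤ_[p],
      ptForm (u ^ p ^ j) = 1 + (p : ℤ_[p]) ^ (m + j) • (F + (p : ℤ_[p]) • G) := by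
  induction j with
  | zero => exact ⟨0, by simpa using hF⟩
  | succ j ih =>
    obtain ⟨G, hG⟩ := ih
    obtain ⟨i, rfl⟩ := Nat.exists_eq_add_of_le' hm
    obtain ⟨q, hq⟩ := exists_one_add_pow_eq
      ((p : ℤ_[p]) ^ (i + 2 + j) • (F + (p : ℤ_[p]) • G)) p
    rw [← hG, ← map_pow, ← pow_mul, ← pow_succ] at hq
    set E := F + (p : ℤ_[p]) • G with hE
    refine ⟨G + (p : ℤ_[p]) ^ (i + j) • (E ^ 2 * q), hq.trans ?_⟩
    rw [smul_pow, smul_mul_assoc]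
    set Q := E ^ 2 * q
    rw [hE, ← Nat.cast_smul_eq_nsmul ℤ_[p]]
    match_scalars <;> ring

lemma counit_eq_zero_of_mem_derIdeal {a : A} (ha : a ∈ derIdeal ℤ A) :
    (1 : Form ℤ A ℤ_[p]) a = 0 :=
  mem_derPts.1 (one_mem (derPts ℤ A ℤ_[p])) a ha

/-- The leading term of a point of the derived group lies in the derived Lie algebra. As the
fibre of the derived group at `p` need not be smooth, this is first proved for high powers
of the point, whose leading terms are the same. -/
lemma exists_mem_lieDer_of_mem_derPts [Algebra.FiniteType ℤ A] [Algebra.FormallySmooth ℤ A] {m : ℕ}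
    (hm : 2 ≤ m) {u : Pts ℤ A ℤ_[p]} (hu : u ∈ derPts ℤ A ℤ_[p]) {F : Form ℤ A ℤ_[p]}
    (hF : ptForm u = 1 + (p : ℤ_[p]) ^ m • F) :
    ∃ v ∈ lieDer ℤ A, ∃ g : Form ℤ A ℤ_[p], F = castForm ℤ_[p] v.1 + (p : ℤ_[p]) • g := by
  have hp0 : ∀ m, (p : ℤ_[p]) ^ m ≠ 0 :=
    fun m => pow_ne_zero _ (by exact_mod_cast (Fact.out : p.Prime).ne_zero)
  obtain ⟨n, hn⟩ := exists_mem_lieDer_of_pow_dvd (A := A) (p : ℤ)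
  obtain ⟨G, hG⟩ := exists_ptForm_pow_eq hm hF n
  obtain ⟨v, g, hv⟩ := exists_lie_of_ptForm_eq hG
  obtain ⟨w, hw⟩ := hn v fun a ha => by
    have h1 : ptForm (u ^ p ^ n) a = (0 : ℤ_[p]) := mem_derPts.1 (pow_mem hu (p ^ n)) a ha
    rw [hG, hv] at h1
    change (1 : Form ℤ A ℤ_[p]) a + (p : ℤ_[p]) ^ (m + n) * (algebraMap ℤ ℤ_[p] (v.1 a) +
      (p : ℤ_[p]) ^ (m + n) * g a) = 0 at h1
    rw [counit_eq_zero_of_mem_derIdeal ha, zero_add, mul_eq_zero, or_iff_right (hp0 _),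
      algebraMap_int_padicInt] at h1
    rw [← intCast_dvd_iff]
    exact ⟨-((p : ℤ_[p]) ^ m * g a), by linear_combination h1⟩
  refine ⟨v - (p : ℤ) • w, hw, castForm ℤ_[p] w.1 - G + (p : ℤ_[p]) ^ (m + n - 1) • g, ?_⟩
  have h2 : castForm ℤ_[p] (v - (p : ℤ) • w : lie ℤ A).1 =
      castForm ℤ_[p] v.1 - castForm ℤ_[p] ((p : ℤ) • w : lie ℤ A).1 := map_sub (castForm ℤ_[p]) _ _
  obtain ⟨i, hi⟩ := Nat.exists_eq_add_of_le' (show 1 ≤ m + n by omega)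
  rw [hi] at hv ⊢
  rw [h2, castForm_zsmul_lie, Int.cast_natCast, Nat.add_sub_cancel, ← sub_eq_iff_eq_add.2 hv]
  match_scalars <;> ring

end Padic

end GroupScheme

/-! ### Successive approximation -/

namespace GroupScheme

section Approximation

variable {A : Type*} [CommRing A] [HopfAlgebra ℤ A] {p : ℕ} [Fact p.Prime]

/-- A subgroup containing the derived Lie algebra in its layer `n ≥ 2` approximates all points of
the derived group congruent to `1` modulo `p ^ n`. -/
lemma exists_mul_eq_one_add [Algebra.FiniteType ℤ A] [Algebra.FormallySmooth ℤ A] {n : ℕ}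
    (hn : 2 ≤ n) {K : Subgroup (Pts ℤ A ℤ_[p])} (hK : K ≤ derPts ℤ A ℤ_[p])
    (h : ∀ v ∈ lieDer ℤ A, v ∈ leadingTerms K (one_le_two.trans hn)) {u : Pts ℤ A ℤ_[p]}
    (hu : u ∈ derPts ℤ A ℤ_[p]) (hun : GaloisRep.red A p n u = 1) (k : ℕ) :
    ∃ x ∈ K, GaloisRep.red A p (n + k) (x⁻¹ * u) = 1 := by
  have h' : ∀ k, ∀ v ∈ lieDer ℤ A, v ∈ leadingTerms K (m := n + k)
      ((one_le_two.trans hn).trans (Nat.le_add_right n k)) := fun k => by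
    induction k with
    | zero => exact h
    | succ k ih => exact fun v hv => mem_leadingTerms_succ (m := n + k) (by omega) (ih v hv)
  induction k with
  | zero => exact ⟨1, one_mem K, by simpa using hun⟩
  | succ k ih =>
    obtain ⟨x, hxK, hx⟩ := ih
    obtain ⟨F, hF⟩ := red_eq_one_iff.1 hx
    obtain ⟨v, hv, g, rfl⟩ := exists_mem_lieDer_of_mem_derPts (m := n + k) (by omega)
      (mul_mem (inv_mem (hK hxK)) hu) hF
    obtain ⟨y, hyK, g', hy⟩ := h' k v hv
    refine ⟨x * y, mul_mem hxK hyK, red_eq_one_iff.2 ⟨ptForm y⁻¹ * (g - g'), ?_⟩⟩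
    have h1 : ptForm (x⁻¹ * u) = ptForm y + (p : ℤ_[p]) ^ (n + (k + 1)) • (g - g') := by
      rw [hF, hy]
      match_scalars <;> ring
    rw [mul_inv_rev, mul_assoc, map_mul, h1, mul_add, ptForm_inv_mul, mul_smul_comm]

end Approximation

end GroupScheme

namespace GaloisRep

open GroupScheme NumberField

section Compactness

variable {A : Type*} [CommRing A] [HopfAlgebra ℤ A] {p : ℕ} [Fact p.Prime]

lemma red_eq_red_iff {n : ℕ} {x y : Pts ℤ A ℤ_[p]} :
    red A p n x = red A p n y ↔ ∀ a, ‖x.ofConv a - y.ofConv a‖ ≤ (p : ℝ) ^ (-n : ℤ) := by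
  have h1 : ∀ a, ‖x.ofConv a - y.ofConv a‖ ≤ (p : ℝ) ^ (-n : ℤ) ↔
      PadicInt.toZModPow n (x.ofConv a) = PadicInt.toZModPow n (y.ofConv a) := fun a => by
    rw [PadicInt.norm_le_pow_iff_mem_span_pow, ← PadicInt.ker_toZModPow, RingHom.mem_ker, map_sub,
      sub_eq_zero]
  simp only [h1]
  constructor
  · exact fun h a => congrArg (fun y : Pts ℤ A (ZMod (p ^ n)) => y.ofConv a) h
  · intro h
    apply WithConv.ofConv_injective
    ext1 a
    exact h a

/-- The image of a compact group is closed. -/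
lemma mem_range_of_forall_red {Γ : Type*} [Group Γ] [TopologicalSpace Γ] [CompactSpace Γ]
    (ρ : Γ →* Pts ℤ A ℤ_[p]) (hρ : ∀ a : A, Continuous fun σ => (ρ σ).ofConv a)
    {u : Pts ℤ A ℤ_[p]} (hu : ∀ n, ∃ σ, red A p n (ρ σ) = red A p n u) : u ∈ Set.range ρ := by
  have h1 : (⋂ n, {σ : Γ | red A p n (ρ σ) = red A p n u}).Nonempty := by
    have hcl : ∀ n, IsClosed {σ : Γ | red A p n (ρ σ) = red A p n u} := fun n => by
      simp only [red_eq_red_iff, Set.ofPred_forall]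
      exact isClosed_iInter fun a =>
        isClosed_le ((hρ a).sub continuous_const).norm continuous_const
    refine IsCompact.nonempty_iInter_of_sequence_nonempty_isCompact_isClosed _ (fun n σ hσ => ?_)
      hu (hcl 0).isCompact hcl
    rw [Set.mem_ofPred_eq, red_eq_red_iff] at hσ ⊢
    refine fun a => (hσ a).trans ?_
    exact zpow_le_zpow_right₀ (by exact_mod_cast (Fact.out : p.Prime).one_le) (by push_cast; omega)
  obtain ⟨σ, hσ⟩ := h1
  refine ⟨σ, WithConv.ofConv_injective (AlgHom.ext fun a => ?_)⟩
  have h2 : ∀ n : ℕ, ‖(ρ σ).ofConv a - u.ofConv a‖ ≤ (p : ℝ) ^ (-n : ℤ) := fun n =>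
    red_eq_red_iff.1 (Set.mem_iInter.1 hσ n) a
  rw [← sub_eq_zero]
  by_contra h3
  obtain ⟨n, hn⟩ := PadicInt.exists_pow_neg_lt p (norm_pos_iff.2 h3)
  exact (h2 n).not_gt hn

lemma normal_iSup_of_forall {F E : Type*} [Field F] [Field E] [Algebra F E]
    {P : IntermediateField F E → Prop} (h : ∀ L, P L → Normal F L) :
    Normal F (⨆ (L : IntermediateField F E) (_ : P L), L : IntermediateField F E) := by
  have h1 : (⨆ (L : IntermediateField F E) (_ : P L), L) = ⨆ L : {L // P L}, L.1 :=
    iSup_subtype'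
  rw [h1]
  have : ∀ L : {L // P L}, Normal F L.1 := fun L => h L.1 L.2
  exact IntermediateField.normal_iSup F E fun L : {L // P L} => L.1

instance (p : ℕ) : IsGalois ℚ (maxUnramifiedOutside p) := by
  have : Normal ℚ (maxUnramifiedOutside p) :=
    normal_iSup_of_forall fun L hL => hL.2.1.to_normal
  exact ⟨⟩

end Compactness

section Layer

variable {A : Type*} [CommRing A] [HopfAlgebra ℤ A] {p : ℕ} [Fact p.Prime]

lemma red_eq_expPow_iff {m : ℕ} (hm : 1 ≤ m) {x : Pts ℤ A ℤ_[p]} {v : lie ℤ A} :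
    red A p (m + 1) x = expPow p hm v ↔ ∃ g : Form ℤ A ℤ_[p],
      ptForm x = 1 + (p : ℤ_[p]) ^ m • (castForm ℤ_[p] v.1 + (p : ℤ_[p]) • g) := by
  have hp0 : (p : ℤ_[p]) ^ (m + 1) ≠ 0 :=
    pow_ne_zero _ (by exact_mod_cast (Fact.out : p.Prime).ne_zero)
  set E : Form ℤ A ℤ_[p] := 1 + (p : ℤ_[p]) ^ m • castForm ℤ_[p] v.1 with hE
  have h1 : ∀ a, PadicInt.toZModPow (m + 1) (E a) = (expPow p hm v).ofConv a := fun a => by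
    change PadicInt.toZModPow (m + 1) (algebraMap ℤ ℤ_[p] _ +
      (p : ℤ_[p]) ^ m * algebraMap ℤ ℤ_[p] (v.1 a)) = algebraMap ℤ _ _ +
        (p : ZMod (p ^ (m + 1))) ^ m * algebraMap ℤ _ (v.1 a)
    simp
  have h2 : ∀ a, (p : ℤ_[p]) ^ (m + 1) ∣ (ptForm x - E : Form ℤ A ℤ_[p]) a ↔
      PadicInt.toZModPow (m + 1) (x.ofConv a) = (expPow p hm v).ofConv a := fun a => by
    rw [← Ideal.mem_span_singleton, ← PadicInt.ker_toZModPow, RingHom.mem_ker, ← h1]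
    change PadicInt.toZModPow (m + 1) (x.ofConv a - E a) = 0 ↔ _
    rw [map_sub, sub_eq_zero]
  have h3 : red A p (m + 1) x = expPow p hm v ↔
      ∀ a, (p : ℤ_[p]) ^ (m + 1) ∣ (ptForm x - E : Form ℤ A ℤ_[p]) a := by
    rw [forall_congr' h2]
    constructor
    · exact fun h a => congrArg (fun y : Pts ℤ A (ZMod (p ^ (m + 1))) => y.ofConv a) h
    · intro h
      apply WithConv.ofConv_injective
      ext1 a
      exact h a
  have h4 : ∀ g : Form ℤ A ℤ_[p], 1 + (p : ℤ_[p]) ^ m • (castForm ℤ_[p] v.1 + (p : ℤ_[p]) • g) =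
      E + (p : ℤ_[p]) ^ (m + 1) • g := fun g => by
    rw [hE]
    match_scalars <;> ring
  simp only [h3, h4]
  constructor
  · intro h
    obtain ⟨g, hg⟩ := exists_eq_smul_of_dvd hp0 h
    exact ⟨g, by rw [← hg]; abel⟩
  · rintro ⟨F, hF⟩ a
    rw [hF, add_sub_cancel_left]
    exact ⟨F a, rfl⟩

variable {Γ : Type*} [Group Γ] (ρ : Γ →* Pts ℤ A ℤ_[p]) {m : ℕ} (hm : 1 ≤ m)

lemma expPow_mem_Phi_iff {v : lie ℤ A} : expPow p hm v ∈ Phi ρ m ↔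
    v ∈ leadingTerms ρ.range hm := by
  constructor
  · rintro ⟨σ, -, hσ⟩
    exact ⟨ρ σ, ⟨σ, rfl⟩, (red_eq_expPow_iff hm).1 hσ⟩
  · rintro ⟨_, ⟨σ, rfl⟩, h⟩
    refine ⟨σ, ?_, (red_eq_expPow_iff hm).2 h⟩
    obtain ⟨g, hg⟩ := h
    exact red_eq_one_iff.2 ⟨_, hg⟩

lemma tmul_mem_layer_iff {v : lie ℤ A} :
    (1 : ZMod p) ⊗ₜ[ℤ] v ∈ layer ρ hm ↔ v ∈ leadingTerms ρ.range hm := by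
  constructor
  · rintro ⟨w, hvw, hw⟩
    rw [expPow_mem_Phi_iff] at hw
    obtain ⟨t, ht⟩ : ∃ t : lie ℤ A, v - w = (p : ℤ) • t := by
      refine exists_lie_eq_smul (by exact_mod_cast (Fact.out : p.Prime).ne_zero) fun a => ?_
      let ev : lie ℤ A →ₗ[ℤ] ZMod p := AddMonoidHom.toIntLinearMap
        { toFun := fun v => (v.1 a : ZMod p)
          map_zero' := Int.cast_zero
          map_add' := fun _ _ => Int.cast_add _ _ }
      have h1 := congrArg (TensorProduct.lift ((LinearMap.mul ℤ (ZMod p)).compl₂ ev)) hvw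
      rw [TensorProduct.lift.tmul, TensorProduct.lift.tmul] at h1
      change (1 : ZMod p) * ((v.1 a : ℤ) : ZMod p) = 1 * ((w.1 a : ℤ) : ZMod p) at h1
      rw [one_mul, one_mul, ← sub_eq_zero, ← Int.cast_sub] at h1
      exact (ZMod.intCast_zmod_eq_zero_iff_dvd _ _).1 h1
    have h1 := add_mem (prime_smul_mem_leadingTerms (H := ρ.range) (hm := hm) t) hw
    rwa [← ht, sub_add_cancel] at h1
  · exact fun h => ⟨v, rfl, (expPow_mem_Phi_iff ρ hm).2 h⟩

end Layer

end GaloisRep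

end

open GroupScheme GaloisRep in
theorem mainTheorem6
    {A M : Type*} [CommRing A] [HopfAlgebra ℤ A]
    [AddCommGroup M] [Module.Free ℤ M] [Module.Finite ℤ M]
    (π : A →ₐc[ℤ] AddMonoidAlgebra ℤ M) (hG : IsSplitReductive π)
    (Δ : Set M) (hΔ : IsSimpleSystem (roots π) Δ) (C : ChevalleyBasis π Δ)
    (p : ℕ) [Fact p.Prime]
    (ρbar : GalOutside p →* Pts ℤ A (ZMod p))
    (hρbar : ∀ a : A, IsLocallyConstant fun σ => (ρbar σ).ofConv a)
    (ρ : GalOutside p →* Pts ℤ A ℤ_[p])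
    (hρ : ∀ a : A, Continuous fun σ => (ρ σ).ofConv a)
    (hlift : (redModP A p).comp ρ = ρbar)
    (hp : ∀ α β : roots π, (α : M) + β ∈ roots π → |C.N α β| < p)
    (hH : ∃ φ : M →+ ℤ, (1 : ZMod p) ⊗ₜ[ℤ] toral π φ ∈ layer ρ (le_refl 1) ∧
      ∀ α ∈ roots π, (φ α : ZMod p) ≠ 0)
    (hX : ∀ α : roots π, Odd (height Δ (α : M)) →
      (1 : ZMod p) ⊗ₜ[ℤ] C.X α ∈ layer ρ (le_refl 1)) :
    ((lieDer ℤ A).baseChange (ZMod p) : Set (ZMod p ⊗[ℤ] lie ℤ A)) ⊆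
        layer ρ (m := 4) (by norm_num) ∧
      congruenceDer A p 4 ⊆ Set.range ρ := by
  have := hG.smooth
  obtain ⟨φ, hφ, hφ'⟩ := hH
  -- the part of the image that lies in the derived group
  let K : Subgroup (Pts ℤ A ℤ_[p]) := ρ.range ⊓ derPts ℤ A ℤ_[p]
  have hHH : ∀ x ∈ ρ.range, ∀ y ∈ ρ.range, x * y * x⁻¹ * y⁻¹ ∈ K := fun x hx y hy =>
    Subgroup.mem_inf.2 ⟨mul_mem (mul_mem (mul_mem hx hy) (inv_mem hx)) (inv_mem hy),
      commutator_mem_derPts x y⟩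
  have h4 : ∀ v ∈ lieDer ℤ A, v ∈ leadingTerms K (m := 4) (by norm_num) := fun v hv =>
    C.lieDer_le_leadingTerms hG hΔ hp φ hφ' inf_le_left hHH
      ((tmul_mem_layer_iff ρ _).1 hφ) (fun α hα => (tmul_mem_layer_iff ρ _).1 (hX α hα)) hv
  constructor
  · intro x hx
    obtain ⟨v, hv, rfl⟩ : ∃ v ∈ lieDer ℤ A, (1 : ZMod p) ⊗ₜ[ℤ] v = x := by
      rw [SetLike.mem_coe, Submodule.baseChange_eq_span] at hx
      induction hx using Submodule.span_induction with
      | mem x hx =>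
        obtain ⟨v, hv, rfl⟩ := hx
        exact ⟨v, hv, rfl⟩
      | zero => exact ⟨0, zero_mem _, TensorProduct.tmul_zero _ _⟩
      | add x y _ _ hx hy =>
        obtain ⟨v, hv, rfl⟩ := hx
        obtain ⟨w, hw, rfl⟩ := hy
        exact ⟨v + w, add_mem hv hw, TensorProduct.tmul_add _ _ _⟩
      | smul c x _ hx =>
        obtain ⟨v, hv, rfl⟩ := hx
        obtain ⟨c, rfl⟩ := ZMod.intCast_surjective c
        exact ⟨c • v, zsmul_mem hv c, by
          rw [TensorProduct.tmul_smul, ← Int.cast_smul_eq_zsmul (ZMod p)]⟩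
    exact (tmul_mem_layer_iff ρ _).2 (leadingTerms_mono inf_le_left (h4 v hv))
  · rintro u ⟨hu, hu4⟩
    refine mem_range_of_forall_red ρ hρ fun n => ?_
    obtain ⟨_, ⟨⟨σ, rfl⟩, -⟩, h⟩ := exists_mul_eq_one_add (n := 4) (by norm_num)
      (K := K) inf_le_right h4 hu hu4 n
    rw [map_mul, map_inv, inv_mul_eq_one, red_eq_red_iff] at h
    refine ⟨σ, red_eq_red_iff.2 fun a => (h a).trans ?_⟩
    exact zpow_le_zpow_right₀ (by exact_mod_cast (Fact.out : p.Prime).one_le) (by push_cast; omega)
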